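/- Consider the square grid $\mathbb Z^2$ of cells $(i,j)$ ($i$ is the row, $j$ the column). Two cells are neighbours if they agree in one coordinate and differ by exactly $1$ in the other. A \emph{shape} is a finite set of cells (the cells occupied by nodes); it is \emph{connected} if its neighbour graph is connected (in particular it is non-empty). A \emph{rotation} on a shape $S$ takes a node at $p\in S$, a neighbour $q\in S$ of $p$ and a unit vector $d$ perpendicular to $q-p$ such that the cells $p+d$ and $q+d$ are both empty, and moves the node from $p$ to $q+d$ (a $90^\circ$ turn around the node at $q$, clockwise or counterclockwise). Write $A\rightsquigarrow B$ if $B$ is obtained from $A$ by a finite, possibly empty, sequence of rotations; intermediate shapes may be disconnected. Color the cell $(i,j)$ black if $i+j$ is even and red otherwise; $A$ and $B$ are \emph{color-consistent} if they have equally many black nodes and equally many red nodes. Call two shapes \emph{congruent} if one is the image of the other under a rotation of the grid (by a multiple of $90^\circ$) composed with a translation. A \emph{2-line can be extracted} from $S$ if $S\rightsquigarrow R\cup\{u,v\}$ for some shape $R$ and neighbouring cells $u,v\notin R$ that both lie beyond the same side of the bounding box of $R$, with at least one empty row or column in between (no condition if $R=\emptyset$). \textbf{Theorem.} \begin{enumerate}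 \item Let $A,B$ be connected shapes. Then $A\rightsquigarrow B$ if and only if either $A=B$, or $A$ and $B$ are color-consistent and each of $A$ and $B$ has at least one available rotation. (The condition is symmetric in $A$ and $B$, so in this case also $B\rightsquigarrow A$.) \item The same holds up to translations and rotations of the shapes: for connected $A,B$ there is $B'$ congruent to $B$ with $A\rightsquigarrow B'$ if and only if either $A$ and $B$ are congruent, or $A$ is color-consistent with some $B'$ congruent to $B$ and each of $A$ and $B$ has at least one available rotation. \item A shape $S$ has an available rotation if and only if a 2-line can be extracted from it. \item Rot-Transformability, the set of pairs $(A,B)$ of connected shapes such that $A\rightsquigarrow B'$ for some $B'$ congruent to $B$, is in $\mathbf P$, and so is its variant with fixed positions, the set of pairs $(A,B)$ of connected shapes with $A\rightsquigarrow B$. Here an instance is any pair of shapes, each given as a list (without repetition, in any order) of its cells with integer coordinates, and $\mathbf P$ is taken for random access machines (integer registers and zero-initialized integer arrays; addition, subtraction, halving, indirect access, comparison with $0$) whose running time, under the logarithmic cost measure, is polynomial in the number of bits of the input. Moreover, each of the two problems is decided by such a machine in $O(|A|+|B|+1)$ steps under the uniform cost measure. \end{enumerate} -/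

import Mathlib

/-! ### Cells, shapes and rotation movements on the square grid -/

namespace RotGrid

/-- A cell of the square grid, given by its row and its column. -/
abbrev Cell := ℤ × ℤ

/-- A shape is the finite set of cells occupied by the (indistinguishable) nodes. -/
abbrev Shape := Finset Cell

/-- The grid graph: two cells are neighbours when they agree in one coordinate and differ by
exactly one in the other. -/
def gridGraph : SimpleGraph Cell where
  Adj p q := (p.1 = q.1 ∧ |p.2 - q.2| = 1) ∨ (p.2 = q.2 ∧ |p.1 - q.1| = 1)
  symm := ⟨fun p q h => by
    rcases h with ⟨h, h'⟩ | ⟨h, h'⟩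
    · exact Or.inl ⟨h.symm, by rwa [abs_sub_comm]⟩
    · exact Or.inr ⟨h.symm, by rwa [abs_sub_comm]⟩⟩
  loopless := ⟨fun p h => by
    rcases h with ⟨_, h⟩ | ⟨_, h⟩ <;> simp at h⟩

/-- A shape is connected when the neighbouring relation on its nodes is a connected graph
(in particular the shape is nonempty). -/
def IsConnectedShape (S : Shape) : Prop :=
  (gridGraph.induce (S : Set Cell)).Connected

/-- The quarter turn of the plane about the origin. -/
def turn (c : Cell) : Cell := (-c.2, c.1)

/-- `S` transforms to `T` by a single rotation movement: a node at `p` turns by 90 degrees around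
a neighbouring node at `q`, towards the side given by the unit vector `d` perpendicular to `q - p`
(one choice of `d` is clockwise, the other one counterclockwise).  The cells `p + d` and `q + d`
have to be empty, and the node ends up at `q + d`. -/
def RotStep (S T : Shape) : Prop :=
  ∃ p q d : Cell, p ∈ S ∧ q ∈ S ∧ gridGraph.Adj p q ∧
    (d = turn (q - p) ∨ d = -turn (q - p)) ∧
    p + d ∉ S ∧ q + d ∉ S ∧ T = insert (q + d) (S.erase p)

/-- Some rotation movement is available on `S`. -/
def HasRotation (S : Shape) : Prop := ∃ T : Shape, RotStep S T

/-- `A` can be transformed to `B` (as sets of cells) by a finite, possibly empty, sequence of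
rotation movements.  The intermediate shapes may be disconnected. -/
def Transforms (A B : Shape) : Prop := Relation.ReflTransGen RotStep A B

/-- `B` is the image of `A` under a translation composed with a rotation of the grid. -/
def Congruent (A B : Shape) : Prop :=
  ∃ (k : ℕ) (t : Cell), B = A.image (fun c => turn^[k] c + t)

/-- `A` can be transformed to `B`, shapes being considered up to translations and rotations. -/
def TransformsUpToMotion (A B : Shape) : Prop :=
  ∃ B' : Shape, Congruent B B' ∧ Transforms A B'

/-- Number of nodes of `S` on the black cells of the checkered colouring. -/
def blacks (S : Shape) : ℕ := (S.filter (fun c => Even (c.1 + c.2))).card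

/-- Number of nodes of `S` on the red cells of the checkered colouring. -/
def reds (S : Shape) : ℕ := (S.filter (fun c => Odd (c.1 + c.2))).card

/-- Equal numbers of black nodes and equal numbers of red nodes. -/
def ColorConsistent (A B : Shape) : Prop := blacks A = blacks B ∧ reds A = reds B

/-- `A` is color-consistent with some placement of `B` (a translation by an odd vector
interchanges the two colours of `B`). -/
def ColorConsistentUpToMotion (A B : Shape) : Prop :=
  ∃ B' : Shape, Congruent B B' ∧ ColorConsistent A B'

/-- The cells `u`, `v` lie beyond one of the four sides of the bounding box of `R`, with at least
one empty row or column in between. -/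
def LieOutside (u v : Cell) (R : Shape) : Prop :=
  (∀ c ∈ R, u.1 + 1 < c.1 ∧ v.1 + 1 < c.1) ∨
  (∀ c ∈ R, c.1 + 1 < u.1 ∧ c.1 + 1 < v.1) ∨
  (∀ c ∈ R, u.2 + 1 < c.2 ∧ v.2 + 1 < c.2) ∨
  (∀ c ∈ R, c.2 + 1 < u.2 ∧ c.2 + 1 < v.2)

/-- A 2-line can be extracted from `S`: rotation movements can bring `S` into a position that
consists of two neighbouring nodes and a remaining part `R`, where the two nodes are outside of
the boundaries of `R` and not adjacent to it. -/
def TwoLineExtractable (S : Shape) : Prop :=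
  ∃ (R : Shape) (u v : Cell), gridGraph.Adj u v ∧ u ∉ R ∧ v ∉ R ∧ LieOutside u v R ∧
    Transforms S (insert u (insert v R))

/-! ### The decision problems -/

/-- The pairs of connected shapes that can be transformed into each other by rotations only, up to
translations and rotations of the shapes. -/
def RotTransformability : Set (Shape × Shape) :=
  {I | IsConnectedShape I.1 ∧ IsConnectedShape I.2 ∧ TransformsUpToMotion I.1 I.2}

/-- The same problem with prescribed positions on the grid. -/
def RotTransformabilityFixed : Set (Shape × Shape) :=
  {I | IsConnectedShape I.1 ∧ IsConnectedShape I.2 ∧ Transforms I.1 I.2}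

/-! ### Random access machines

A machine has integer registers `reg 0, reg 1, …` and integer arrays `mem 0, mem 1, …`, of which a
program uses finitely many.  The arithmetic is addition, subtraction and halving; there is no
multiplication. -/

/-- Contents of the registers and of the arrays. -/
structure Store where
  reg : ℕ → ℤ
  mem : ℕ → ℤ → ℤ

/-- The store after writing `z` into register `x`. -/
def Store.setReg (s : Store) (x : ℕ) (z : ℤ) : Store :=
  { s with reg := Function.update s.reg x z }

/-- The store after writing `z` into entry `i` of array `a`. -/
def Store.setMem (s : Store) (a : ℕ) (i z : ℤ) : Store :=
  { s with mem := Function.update s.mem a (Function.update (s.mem a) i z) }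

/-- Programs; `x`, `y`, `z` are numbers of registers and `a` is the number of an array. -/
inductive Prog : Type
  /-- `reg x := c` -/
  | const (x : ℕ) (c : ℤ) : Prog
  /-- `reg x := reg y + reg z` -/
  | add (x y z : ℕ) : Prog
  /-- `reg x := reg y - reg z` -/
  | sub (x y z : ℕ) : Prog
  /-- `reg x := ⌊reg y / 2⌋` -/
  | half (x y : ℕ) : Prog
  /-- `reg x := mem a [reg y]` -/
  | load (x a y : ℕ) : Prog
  /-- `mem a [reg y] := reg x` -/
  | store (a y x : ℕ) : Prog
  /-- first `P`, then `Q` -/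
  | seq (P Q : Prog) : Prog
  /-- if `reg x > 0` then `P` else `Q` -/
  | ite (x : ℕ) (P Q : Prog) : Prog
  /-- while `reg x > 0` do `P` -/
  | loop (x : ℕ) (P : Prog) : Prog

/-- Length of the binary representation of an integer, with its sign. -/
def bitLen (z : ℤ) : ℕ := z.natAbs.size + 1

/-- `Exec P s s' t c`: started in the store `s`, the program `P` halts in the store `s'`, its
running time is `t` under the uniform cost measure (every instruction and every test counts one)
and `c` under the logarithmic cost measure (every instruction and every test counts the total
bit length of the integers and addresses that it handles). -/
inductive Exec : Prog → Store → Store → ℕ → ℕ → Prop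
  | const (s : Store) (x : ℕ) (z : ℤ) :
      Exec (.const x z) s (s.setReg x z) 1 (bitLen z)
  | add (s : Store) (x y z : ℕ) :
      Exec (.add x y z) s (s.setReg x (s.reg y + s.reg z)) 1
        (bitLen (s.reg y) + bitLen (s.reg z))
  | sub (s : Store) (x y z : ℕ) :
      Exec (.sub x y z) s (s.setReg x (s.reg y - s.reg z)) 1
        (bitLen (s.reg y) + bitLen (s.reg z))
  | half (s : Store) (x y : ℕ) :
      Exec (.half x y) s (s.setReg x (s.reg y / 2)) 1 (bitLen (s.reg y))
  | load (s : Store) (x a y : ℕ) :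
      Exec (.load x a y) s (s.setReg x (s.mem a (s.reg y))) 1
        (bitLen (s.reg y) + bitLen (s.mem a (s.reg y)))
  | store (s : Store) (a y x : ℕ) :
      Exec (.store a y x) s (s.setMem a (s.reg y) (s.reg x)) 1
        (bitLen (s.reg y) + bitLen (s.reg x))
  | seq (P Q : Prog) (s₁ s₂ s₃ : Store) (t t' c c' : ℕ) :
      Exec P s₁ s₂ t c → Exec Q s₂ s₃ t' c' → Exec (.seq P Q) s₁ s₃ (t + t') (c + c')
  | ite_pos (x : ℕ) (P Q : Prog) (s s' : Store) (t c : ℕ) :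
      0 < s.reg x → Exec P s s' t c → Exec (.ite x P Q) s s' (1 + t) (bitLen (s.reg x) + c)
  | ite_nonpos (x : ℕ) (P Q : Prog) (s s' : Store) (t c : ℕ) :
      s.reg x ≤ 0 → Exec Q s s' t c → Exec (.ite x P Q) s s' (1 + t) (bitLen (s.reg x) + c)
  | loop_pos (x : ℕ) (P : Prog) (s₁ s₂ s₃ : Store) (t t' c c' : ℕ) :
      0 < s₁.reg x → Exec P s₁ s₂ t c → Exec (.loop x P) s₂ s₃ t' c' →
      Exec (.loop x P) s₁ s₃ (1 + t + t') (bitLen (s₁.reg x) + c + c')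
  | loop_nonpos (x : ℕ) (P : Prog) (s : Store) :
      s.reg x ≤ 0 → Exec (.loop x P) s s 1 (bitLen (s.reg x))

/-- The array that holds a list of integers in its entries `0, 1, …`, and zeros elsewhere. -/
def listArray (l : List ℤ) (i : ℤ) : ℤ := if i < 0 then 0 else l.getD i.toNat 0

/-- The initial store for an instance whose shapes are listed, in any order, by `lA` and `lB`:
registers 0 and 1 hold the numbers of nodes, arrays 0 and 1 the rows and columns of the nodes of
the first shape, arrays 2 and 3 those of the second shape; all the rest is zero. -/
def inputStore (lA lB : List Cell) : Store where
  reg i := if i = 0 then (lA.length : ℤ) else if i = 1 then (lB.length : ℤ) else 0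
  mem a :=
    if a = 0 then listArray (lA.map Prod.fst)
    else if a = 1 then listArray (lA.map Prod.snd)
    else if a = 2 then listArray (lB.map Prod.fst)
    else if a = 3 then listArray (lB.map Prod.snd)
    else fun _ => 0

/-- Length in bits of the list of the cells of a shape. -/
def shapeBits (S : Shape) : ℕ := ∑ c ∈ S, (bitLen c.1 + bitLen c.2)

/-- The program `P` decides `L`: on every pair `(A, B)` of shapes, whatever the order in which the
cells are listed, it halts with the answer 1 or 0 in register 0, within uniform cost `T A B` and
logarithmic cost `W A B`. -/
def DecidesWithin (P : Prog) (L : Set (Shape × Shape)) (T W : Shape → Shape → ℕ∞) : Prop :=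
  ∀ (A B : Shape) (lA lB : List Cell),
    lA.Nodup → lB.Nodup → lA.toFinset = A → lB.toFinset = B →
    ∃ (s : Store) (t c : ℕ), Exec P (inputStore lA lB) s t c ∧
      (((A, B) ∈ L ∧ s.reg 0 = 1) ∨ ((A, B) ∉ L ∧ s.reg 0 = 0)) ∧
      (t : ℕ∞) ≤ T A B ∧ (c : ℕ∞) ≤ W A B

/-- The class **P**: decidable by a random access machine with a running time that, under the
logarithmic cost measure, is polynomial in the number of bits of the input. -/
def InP (L : Set (Shape × Shape)) : Prop :=
  ∃ (P : Prog) (C k : ℕ),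
    DecidesWithin P L (fun _ _ => ⊤)
      (fun A B => ((C * (shapeBits A + shapeBits B + 1) ^ k : ℕ) : ℕ∞))

/-- Decidable by a random access machine in a number of steps that is linear in the number of
nodes. -/
def InLinearTime (L : Set (Shape × Shape)) : Prop :=
  ∃ (P : Prog) (C : ℕ),
    DecidesWithin P L (fun A B => ((C * (A.card + B.card + 1) : ℕ) : ℕ∞)) (fun _ _ => ⊤)

end RotGrid

/-!
# Rotation movements on the square grid and their decision problems

**Transformability.** The two nodes of an available rotation movement occupy one side of a square
of four cells, the other two cells of which are empty.  Such a pair is a *walker*: a square whose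
lower two cells are occupied and whose upper two are free.  Rows are counted upwards.  A walker
can move up through any shape whatsoever without disturbing it (`transforms_withWalker_succ`):
two nodes ahead of it take over its role, a single node ahead is exchanged for one of its own,
and in the absence of nodes ahead it simply climbs.  What was ahead of the walker is behind it
afterwards, two rows lower, so that a shape with a walker is described by the shape `R` without
it and the position of the walker (`withWalker`).  Above all the other nodes the walker can move
sideways.  Hence all its positions are equivalent (`transforms_withWalker`).  In particular it
can be moved away from the rest, which makes it an extracted 2-line
(`hasRotation_iff_twoLineExtractable`).

With a walker right above it, a node can move diagonally to the next row, either by turning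
around the walker or, when the cell next to it is occupied, around the node there
(`exchangeable_up`).  The diagonal steps generate all the cells of a given colour.  If a cell on
the way is occupied, the node there continues in place of the one that arrives, since nodes are
indistinguishable.  So the nodes of `R` can be rearranged arbitrarily within the two colours, and
two color-consistent shapes with available rotation movements transform to each other
(`transforms_of_colorConsistent`).  Conversely movements preserve the colours and can be undone.
None of this needs connectivity.

**Complexity.** It remains to decide, in linear time and without multiplication, whether a shape
with `n` nodes is connected, whether it admits a rotation movement, how many red nodes it has,
and whether two shapes are equal or congruent.  A connected shape lies in a square of side
`2 n + 1` around any of its cells (`IsConnectedShape.near`).  The cells in this square are numbered row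
by row, with a row width of `4 n + 5`, and row offsets from a table (`key`).  Then neighbourhood
is a matter of differences of numbers, arrays serve as characteristic functions of sets of cells,
connectivity is decided by breadth-first search (`runs_bfsPass`), and a translation adds a
constant to the numbers.  The only translation that can match two shapes is the one that matches
their least numbers (`exists_translate_iff`), so that congruence takes four comparisons, one for
each number of quarter turns (`runs_congruentPass`).

A program that runs in linear time under the uniform cost measure runs in polynomial time under
the logarithmic one, because each instruction at most doubles the largest absolute value
(`Exec.cost_le`, `InLinearTime.inP`).
-/

namespace RotGrid

/-! ### Rotation movements -/

theorem gridGraph_adj_iff (p q : Cell) : gridGraph.Adj p q ↔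
    (p.1 = q.1 ∧ (q.2 = p.2 + 1 ∨ p.2 = q.2 + 1)) ∨
      (p.2 = q.2 ∧ (q.1 = p.1 + 1 ∨ p.1 = q.1 + 1)) := by
  simp only [gridGraph, abs_eq (zero_le_one' ℤ)]
  omega

/-- A rotation movement is undone by the rotation movement around the same node that goes back. -/
theorem RotStep.symm {S T : Shape} (h : RotStep S T) : RotStep T S := by
  obtain ⟨p, q, d, hp, hq, hadj, hd, h₁, h₂, rfl⟩ := h
  have hpq : p ≠ q := hadj.ne
  have e₁ : q + (p - q) = p := by abel
  have e₂ : q + d + (p - q) = p + d := by abel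
  rw [gridGraph_adj_iff] at hadj
  refine ⟨q + d, q, p - q, by simp, by simp [hq, hpq.symm], ?_, ?_, ?_, ?_, ?_⟩
  · rw [gridGraph_adj_iff]
    rcases hd with rfl | rfl <;> simp only [turn, Prod.fst_add, Prod.snd_add, Prod.fst_sub,
      Prod.snd_sub, Prod.fst_neg, Prod.snd_neg] <;> omega
  · rcases hd with rfl | rfl
    · right
      ext <;> simp [turn]
    · left
      ext <;> simp [turn]
  · rw [e₂, Finset.mem_insert, Finset.mem_erase, not_or]
    exact ⟨by simpa using hpq, fun h => h₁ h.2⟩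
  · rw [e₁, Finset.mem_insert, Finset.mem_erase, not_or]
    exact ⟨fun h => h₂ (h ▸ hp), by simp⟩
  · rw [e₁, Finset.erase_insert (fun h => h₂ (Finset.mem_of_mem_erase h)),
      Finset.insert_erase hp]

theorem Transforms.symm {S T : Shape} (h : Transforms S T) : Transforms T S :=
  haveI : Std.Symm RotStep := ⟨fun _ _ h => h.symm⟩
  (Relation.ReflTransGen.stdSymm (r := RotStep)).symm _ _ h

theorem RotStep.transforms {S T : Shape} (h : RotStep S T) : Transforms S T :=
  Relation.ReflTransGen.single h

theorem Transforms.refl (S : Shape) : Transforms S S :=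
  Relation.ReflTransGen.refl

theorem Transforms.trans {S T U : Shape} (h : Transforms S T) (h' : Transforms T U) :
    Transforms S U :=
  Relation.ReflTransGen.trans h h'

/-- A rotation movement of some nodes `P` in the presence of other nodes `Q`: the node at
`(a, b)` turns around the node at `(c, d)` towards the side `(e, f)`. -/
theorem rotStep_union {Q P P' : Shape} (a b c d e f : ℤ) (hp : (a, b) ∈ P)
    (hq : (c, d) ∈ P ∪ Q) (hpQ : (a, b) ∉ Q)
    (hadj : (a = c ∧ (d = b + 1 ∨ b = d + 1)) ∨ (b = d ∧ (c = a + 1 ∨ a = c + 1)))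
    (hd : (e = b - d ∧ f = c - a) ∨ (e = d - b ∧ f = a - c))
    (h₁ : (a + e, b + f) ∉ P ∪ Q) (h₂ : (c + e, d + f) ∉ P ∪ Q)
    (hP' : ∀ x y, (x, y) ∈ P' ↔ (x = c + e ∧ y = d + f) ∨ ((x, y) ∈ P ∧ ¬(x = a ∧ y = b))) :
    RotStep (P ∪ Q) (P' ∪ Q) := by
  refine ⟨(a, b), (c, d), (e, f), Finset.mem_union_left _ hp, hq,
    (gridGraph_adj_iff _ _).2 hadj, ?_, h₁, h₂, ?_⟩
  · rcases hd with ⟨rfl, rfl⟩ | ⟨rfl, rfl⟩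
    · left
      ext <;> simp [turn]
    · right
      ext <;> simp [turn]
  · ext ⟨x, y⟩
    simp only [Finset.mem_union, Finset.mem_insert, Finset.mem_erase, hP', Prod.mk_add_mk,
      Prod.mk.injEq, ne_eq]
    by_cases hx : x = a ∧ y = b
    · obtain ⟨rfl, rfl⟩ := hx; simp [hpQ]
    · simp [hx, or_assoc]

/-! ### Local manoeuvres of a pair of adjacent nodes -/

section Local

variable {Q : Shape} {k j : ℤ}

/-- A pair of nodes side by side moves one row up if the four cells involved are free of other
nodes. -/
theorem transforms_lift (h₁ : (k, j) ∉ Q) (h₂ : (k, j + 1) ∉ Q)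
    (h₃ : (k + 1, j) ∉ Q) (h₄ : (k + 1, j + 1) ∉ Q) :
    Transforms ({(k, j), (k, j + 1)} ∪ Q) ({(k + 1, j), (k + 1, j + 1)} ∪ Q) := by
  have s₁ : RotStep ({(k, j), (k, j + 1)} ∪ Q) ({(k, j + 1), (k + 1, j + 1)} ∪ Q) := by
    apply rotStep_union k j k (j + 1) 1 0
    case hP' =>
      intro x y
      simp only [Finset.mem_insert, Finset.mem_singleton, Prod.mk.injEq]
      omega
    all_goals simp [*]
  have s₂ : RotStep ({(k, j + 1), (k + 1, j + 1)} ∪ Q) ({(k + 1, j), (k + 1, j + 1)} ∪ Q) := by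
    apply rotStep_union k (j + 1) (k + 1) (j + 1) 0 (-1)
    case hP' =>
      intro x y
      simp only [Finset.mem_insert, Finset.mem_singleton, Prod.mk.injEq]
      omega
    all_goals simp [*]
  exact s₁.transforms.trans s₂.transforms

/-- The pair moves up past a single node ahead of it in the left column: one node of the pair stays
behind, and the node that was ahead takes its place. -/
theorem transforms_pass_left (h₁ : (k, j) ∉ Q) (h₂ : (k, j + 1) ∉ Q) (h₃ : (k + 1, j) ∉ Q)
    (h₄ : (k + 1, j + 1) ∉ Q) (h₅ : (k + 2, j) ∉ Q) (h₆ : (k + 2, j + 1) ∉ Q) :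
    Transforms ({(k, j), (k, j + 1), (k + 2, j)} ∪ Q)
      ({(k, j), (k + 1, j), (k + 1, j + 1)} ∪ Q) := by
  have s₁ : RotStep ({(k, j), (k, j + 1), (k + 2, j)} ∪ Q)
      ({(k, j), (k + 1, j), (k + 2, j)} ∪ Q) := by
    apply rotStep_union k (j + 1) k j 1 0
    case hP' =>
      intro x y
      simp only [Finset.mem_insert, Finset.mem_singleton, Prod.mk.injEq]
      omega
    all_goals simp [*]
  have s₂ : RotStep ({(k, j), (k + 1, j), (k + 2, j)} ∪ Q)
      ({(k, j), (k + 1, j), (k + 1, j + 1)} ∪ Q) := by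
    apply rotStep_union (k + 2) j (k + 1) j 0 1
    case hP' =>
      intro x y
      simp only [Finset.mem_insert, Finset.mem_singleton, Prod.mk.injEq]
      omega
    case hadj => omega
    case hd => omega
    all_goals simp [*]
  exact s₁.transforms.trans s₂.transforms

/-- The mirror image of `transforms_pass_left`. -/
theorem transforms_pass_right (h₁ : (k, j) ∉ Q) (h₂ : (k, j + 1) ∉ Q) (h₃ : (k + 1, j) ∉ Q)
    (h₄ : (k + 1, j + 1) ∉ Q) (h₅ : (k + 2, j) ∉ Q) (h₆ : (k + 2, j + 1) ∉ Q) :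
    Transforms ({(k, j), (k, j + 1), (k + 2, j + 1)} ∪ Q)
      ({(k, j + 1), (k + 1, j), (k + 1, j + 1)} ∪ Q) := by
  have s₁ : RotStep ({(k, j), (k, j + 1), (k + 2, j + 1)} ∪ Q)
      ({(k, j + 1), (k + 1, j + 1), (k + 2, j + 1)} ∪ Q) := by
    apply rotStep_union k j k (j + 1) 1 0
    case hP' =>
      intro x y
      simp only [Finset.mem_insert, Finset.mem_singleton, Prod.mk.injEq]
      omega
    all_goals simp [*]
  have s₂ : RotStep ({(k, j + 1), (k + 1, j + 1), (k + 2, j + 1)} ∪ Q)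
      ({(k, j + 1), (k + 1, j), (k + 1, j + 1)} ∪ Q) := by
    apply rotStep_union (k + 2) (j + 1) (k + 1) (j + 1) 0 (-1)
    case hP' =>
      intro x y
      simp only [Finset.mem_insert, Finset.mem_singleton, Prod.mk.injEq]
      omega
    case hadj => omega
    case hd => omega
    all_goals simp [*]
  exact s₁.transforms.trans s₂.transforms

theorem transforms_lay_left (h₁ : (k, j) ∉ Q) (h₂ : (k, j + 1) ∉ Q) (h₃ : (k + 1, j) ∉ Q)
    (h₄ : (k + 1, j + 1) ∉ Q) :
    Transforms ({(k, j), (k + 1, j)} ∪ Q) ({(k, j), (k, j + 1)} ∪ Q) := by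
  apply RotStep.transforms
  apply rotStep_union (k + 1) j k j 0 1
  case hP' =>
      intro x y
      simp only [Finset.mem_insert, Finset.mem_singleton, Prod.mk.injEq]
      omega
  all_goals simp [*]

theorem transforms_lay_right (h₁ : (k, j) ∉ Q) (h₂ : (k, j + 1) ∉ Q) (h₃ : (k + 1, j) ∉ Q)
    (h₄ : (k + 1, j + 1) ∉ Q) :
    Transforms ({(k, j + 1), (k + 1, j + 1)} ∪ Q) ({(k, j), (k, j + 1)} ∪ Q) := by
  apply RotStep.transforms
  apply rotStep_union (k + 1) (j + 1) k (j + 1) 0 (-1)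
  case hP' =>
      intro x y
      simp only [Finset.mem_insert, Finset.mem_singleton, Prod.mk.injEq]
      omega
  all_goals simp [*]

/-- A pair side by side moves one column to the right, by standing up in the middle column. -/
theorem transforms_sideways (h₁ : (k, j) ∉ Q) (h₂ : (k, j + 1) ∉ Q) (h₃ : (k + 1, j) ∉ Q)
    (h₄ : (k + 1, j + 1) ∉ Q) (h₅ : (k, j + 2) ∉ Q) (h₆ : (k + 1, j + 2) ∉ Q) :
    Transforms ({(k, j), (k, j + 1)} ∪ Q) ({(k, j + 1), (k, j + 2)} ∪ Q) := by
  have e : j + 2 = j + 1 + 1 := by ring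
  rw [e] at h₅ h₆ ⊢
  exact (transforms_lay_right h₁ h₂ h₃ h₄).symm.trans (transforms_lay_left h₂ h₅ h₄ h₆)

end Local

/-! ### The walker -/

/-- Make room for a square of four cells in the rows `k`, `k + 1` and the columns `j`, `j + 1`, by
shifting everything above it in these two columns. -/
def spread (k j : ℤ) (c : Cell) : Cell :=
  if (c.2 = j ∨ c.2 = j + 1) ∧ k ≤ c.1 then (c.1 + 2, c.2) else c

/-- The shape `R` with a walker inserted at height `k` of the columns `j` and `j + 1`: a square of
four cells, the lower two of which are occupied.  The nodes of `R` above it are shifted by two. -/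
def withWalker (k j : ℤ) (R : Shape) : Shape :=
  {(k, j), (k, j + 1)} ∪ R.image (spread k j)

theorem mem_image_spread {k j x y : ℤ} {R : Shape} :
    (x, y) ∈ R.image (spread k j) ↔
      ((y = j ∨ y = j + 1) ∧ k + 2 ≤ x ∧ (x - 2, y) ∈ R) ∨
        ((y ≠ j ∧ y ≠ j + 1 ∨ x < k) ∧ (x, y) ∈ R) := by
  rw [Finset.mem_image]
  constructor
  · rintro ⟨⟨u, v⟩, hR, h⟩
    by_cases hs : (v = j ∨ v = j + 1) ∧ k ≤ u
    · rw [spread, if_pos hs, Prod.mk.injEq] at h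
      obtain ⟨rfl, rfl⟩ := h
      left
      refine ⟨hs.1, by simpa using hs.2, by simpa using hR⟩
    · rw [spread, if_neg hs, Prod.mk.injEq] at h
      obtain ⟨rfl, rfl⟩ := h
      right
      exact ⟨by omega, hR⟩
  · rintro (⟨h₁, h₂, h₃⟩ | ⟨h₁, h₂⟩)
    · refine ⟨_, h₃, ?_⟩
      rw [spread, if_pos ⟨h₁, by omega⟩]
      simp
    · refine ⟨_, h₂, ?_⟩
      rw [spread, if_neg (by omega)]

theorem notMem_image_spread {k j x y : ℤ} {R : Shape} (hx : x = k ∨ x = k + 1)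
    (hy : y = j ∨ y = j + 1) : (x, y) ∉ R.image (spread k j) := by
  rw [mem_image_spread]
  omega

/-- The walker moves one row up without disturbing the shape that it walks through: what was ahead
of it is behind it afterwards. -/
theorem transforms_withWalker_succ (k j : ℤ) (R : Shape) :
    Transforms (withWalker k j R) (withWalker (k + 1) j R) := by
  -- The nodes of `R` in the cells `(k, j)` and `(k, j + 1)` are right ahead of the walker before
  -- the move and right behind it afterwards; the image `Q` of all the others stays in place.
  set R' := (R.erase (k, j)).erase (k, j + 1) with hR'
  have hl : (k, j) ∉ R' := by simp [R']
  have hr : (k, j + 1) ∉ R' := by simp [R']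
  set Q := R'.image (spread k j) with hQ
  have hQ' : R'.image (spread (k + 1) j) = Q := by
    apply Finset.image_congr
    rintro ⟨x, y⟩ hxy
    have : (x, y) ≠ (k, j) ∧ (x, y) ≠ (k, j + 1) :=
      ⟨ne_of_mem_of_not_mem hxy hl, ne_of_mem_of_not_mem hxy hr⟩
    simp only [ne_eq, Prod.mk.injEq] at this
    simp only [spread]
    congr 1
    apply propext
    omega
  have q₁ : (k, j) ∉ Q := notMem_image_spread (by simp) (by simp)
  have q₂ : (k, j + 1) ∉ Q := notMem_image_spread (by simp) (by simp)
  have q₃ : (k + 1, j) ∉ Q := notMem_image_spread (by simp) (by simp)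
  have q₄ : (k + 1, j + 1) ∉ Q := notMem_image_spread (by simp) (by simp)
  have q₅ : (k + 2, j) ∉ Q := by rw [hQ, mem_image_spread]; simp [hl]
  have q₆ : (k + 2, j + 1) ∉ Q := by rw [hQ, mem_image_spread]; simp [hr]
  have key : ∀ X : Shape, R = X ∪ R' →
      withWalker k j R = ({(k, j), (k, j + 1)} ∪ X.image (spread k j)) ∪ Q ∧
      withWalker (k + 1) j R =
        ({(k + 1, j), (k + 1, j + 1)} ∪ X.image (spread (k + 1) j)) ∪ Q := by
    intro X hX
    simp only [withWalker]
    rw [hX, Finset.image_union, Finset.image_union, hQ', ← hQ, Finset.union_assoc,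
      Finset.union_assoc]
    exact ⟨rfl, rfl⟩
  have sp₁ : spread k j (k, j) = (k + 2, j) := by simp [spread]
  have sp₂ : spread k j (k, j + 1) = (k + 2, j + 1) := by simp [spread]
  have sp₃ : spread (k + 1) j (k, j) = (k, j) := by simp [spread]
  have sp₄ : spread (k + 1) j (k, j + 1) = (k, j + 1) := by simp [spread]
  have hX : R = R.filter (fun c => c = (k, j) ∨ c = (k, j + 1)) ∪ R' := by
    ext c
    simp only [R', Finset.mem_union, Finset.mem_filter, Finset.mem_erase]
    tauto
  clear_value R' Q
  by_cases m₁ : (k, j) ∈ R <;> by_cases m₂ : (k, j + 1) ∈ R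
  · have hY : R.filter (fun c => c = (k, j) ∨ c = (k, j + 1)) = {(k, j), (k, j + 1)} := by
      ext c; simp only [Finset.mem_filter, Finset.mem_insert, Finset.mem_singleton]; grind
    rw [hY] at hX
    obtain ⟨e₁, e₂⟩ := key _ hX
    rw [e₁, e₂, Finset.image_insert, Finset.image_insert, Finset.image_singleton,
      Finset.image_singleton, sp₁, sp₂, sp₃, sp₄]
    -- The two nodes ahead move down by one row and become the walker; the former walker stays
    -- behind in their place.
    have e : k + 1 + 1 = k + 2 := by ring
    have := (transforms_lift (Q := {(k, j), (k, j + 1)} ∪ Q) (k := k + 1) (j := j)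
      (by simp [q₃]) (by simp [q₄]) (by rw [e]; simp [q₅]) (by rw [e]; simp [q₆])).symm
    rw [e] at this
    convert this using 1
    · rw [Finset.union_left_comm, Finset.union_assoc]
    · rw [Finset.union_assoc]
  · have hY : R.filter (fun c => c = (k, j) ∨ c = (k, j + 1)) = {(k, j)} := by
      ext c; simp only [Finset.mem_filter, Finset.mem_singleton]; grind
    rw [hY] at hX
    obtain ⟨e₁, e₂⟩ := key _ hX
    rw [e₁, e₂, Finset.image_singleton, Finset.image_singleton, sp₁, sp₃]
    convert transforms_pass_left q₁ q₂ q₃ q₄ q₅ q₆ using 2 <;>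
    · ext c
      simp only [Finset.mem_union, Finset.mem_insert, Finset.mem_singleton]
      tauto
  · have hY : R.filter (fun c => c = (k, j) ∨ c = (k, j + 1)) = {(k, j + 1)} := by
      ext c; simp only [Finset.mem_filter, Finset.mem_singleton]; grind
    rw [hY] at hX
    obtain ⟨e₁, e₂⟩ := key _ hX
    rw [e₁, e₂, Finset.image_singleton, Finset.image_singleton, sp₂, sp₄]
    convert transforms_pass_right q₁ q₂ q₃ q₄ q₅ q₆ using 2 <;>
    · ext c
      simp only [Finset.mem_union, Finset.mem_insert, Finset.mem_singleton]
      tauto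
  · have hY : R.filter (fun c => c = (k, j) ∨ c = (k, j + 1)) = ∅ := by
      ext c; simp only [Finset.mem_filter, Finset.notMem_empty]; grind
    rw [hY] at hX
    obtain ⟨e₁, e₂⟩ := key _ hX
    rw [e₁, e₂]
    simpa using transforms_lift q₁ q₂ q₃ q₄

theorem transforms_withWalker_row (k k' j : ℤ) (R : Shape) :
    Transforms (withWalker k j R) (withWalker k' j R) := by
  have up : ∀ (n : ℕ) (k : ℤ), Transforms (withWalker k j R) (withWalker (k + n) j R) := by
    intro n
    induction n with
    | zero => intro k; simpa using Transforms.refl _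
    | succ n ih =>
      intro k
      refine (ih k).trans ?_
      rw [Nat.cast_succ, ← add_assoc]
      exact transforms_withWalker_succ _ _ _
  rcases le_total k k' with h | h
  · simpa [Int.toNat_of_nonneg (sub_nonneg.2 h)] using up (k' - k).toNat k
  · simpa [Int.toNat_of_nonneg (sub_nonneg.2 h)] using (up (k - k').toNat k').symm

theorem withWalker_of_lt {k j : ℤ} {R : Shape} (h : ∀ c ∈ R, c.1 < k) :
    withWalker k j R = {(k, j), (k, j + 1)} ∪ R := by
  rw [withWalker]
  congr 1
  conv_rhs => rw [← Finset.image_id (s := R)]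
  refine Finset.image_congr fun c hc => ?_
  have := h c hc
  rw [spread, if_neg (by omega), id]

theorem exists_forall_row_lt (R : Shape) : ∃ k : ℤ, ∀ c ∈ R, c.1 < k := by
  obtain ⟨m, hm⟩ := (R.image Prod.fst).bddAbove
  exact ⟨m + 1, fun c hc =>
    Int.lt_add_one_of_le (hm (Finset.mem_coe.2 (Finset.mem_image_of_mem _ hc)))⟩

/-- All positions of the walker are equivalent: it changes columns where it is above all the other
nodes. -/
theorem transforms_withWalker (k j k' j' : ℤ) (R : Shape) :
    Transforms (withWalker k j R) (withWalker k' j' R) := by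
  -- From the row `m` on there are no other nodes.
  obtain ⟨m, hm⟩ := exists_forall_row_lt R
  have side : ∀ j, Transforms (withWalker m j R) (withWalker m (j + 1) R) := by
    intro j
    have e : j + 1 + 1 = j + 2 := by ring
    rw [withWalker_of_lt hm, withWalker_of_lt hm, e]
    have hn : ∀ x y, m ≤ x → (x, y) ∉ R := fun x y hx h => absurd (hm _ h) (not_lt.2 hx)
    apply transforms_sideways <;> apply hn <;> omega
  have right : ∀ (n : ℕ) (j : ℤ), Transforms (withWalker m j R) (withWalker m (j + n) R) := by
    intro n
    induction n with
    | zero => intro j; simpa using Transforms.refl _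
    | succ n ih =>
      intro j
      refine (ih j).trans ?_
      rw [Nat.cast_succ, ← add_assoc]
      exact side _
  have key : Transforms (withWalker m j R) (withWalker m j' R) := by
    rcases le_total j j' with h | h
    · simpa [Int.toNat_of_nonneg (sub_nonneg.2 h)] using right (j' - j).toNat j
    · simpa [Int.toNat_of_nonneg (sub_nonneg.2 h)] using (right (j - j').toNat j').symm
  exact (transforms_withWalker_row k m j R).trans (key.trans (transforms_withWalker_row m k' j' R))

/-- The two nodes of an available rotation movement occupy one side of a square of four cells, the
other two of which are empty.  They can be brought to the lower side of this square, where they form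
a walker. -/
theorem HasRotation.exists_withWalker {A : Shape} (h : HasRotation A) :
    ∃ k j R, Transforms A (withWalker k j R) := by
  obtain ⟨T, ⟨a, b⟩, ⟨c, d⟩, ⟨e, f⟩, hp, hq, hadj, hd, h₁, h₂, -⟩ := h
  -- A pair in the lower side of an otherwise empty square is a walker: closing the gap of two rows
  -- recovers the remaining shape.
  have fill : ∀ (k j : ℤ) (Q : Shape), (k, j) ∉ Q → (k, j + 1) ∉ Q → (k + 1, j) ∉ Q →
      (k + 1, j + 1) ∉ Q → ∃ R : Shape, {(k, j), (k, j + 1)} ∪ Q = withWalker k j R := by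
    intro k j Q q₁ q₂ q₃ q₄
    refine ⟨Q.image fun c => if (c.2 = j ∨ c.2 = j + 1) ∧ k ≤ c.1 then (c.1 - 2, c.2) else c, ?_⟩
    rw [withWalker, Finset.image_image]
    congr 1
    conv_lhs => rw [← Finset.image_id (s := Q)]
    refine Finset.image_congr ?_
    rintro ⟨x, y⟩ hc
    have n₁ : ¬(x = k ∧ y = j) := by rintro ⟨rfl, rfl⟩; exact q₁ hc
    have n₂ : ¬(x = k ∧ y = j + 1) := by rintro ⟨rfl, rfl⟩; exact q₂ hc
    have n₃ : ¬(x = k + 1 ∧ y = j) := by rintro ⟨rfl, rfl⟩; exact q₃ hc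
    have n₄ : ¬(x = k + 1 ∧ y = j + 1) := by rintro ⟨rfl, rfl⟩; exact q₄ hc
    by_cases hs : (y = j ∨ y = j + 1) ∧ k ≤ x
    · simp only [Function.comp, if_pos hs, spread, id]
      rw [if_pos (by omega)]
      simp
    · simp only [Function.comp, if_neg hs, spread, id]
  set Q := (A.erase (a, b)).erase (c, d) with hQ
  have hA : A = {(a, b), (c, d)} ∪ Q := by
    ext x
    simp only [Q, Finset.mem_union, Finset.mem_insert, Finset.mem_singleton, Finset.mem_erase]
    grind
  have q₁ : (a, b) ∉ Q := by simp [Q]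
  have q₂ : (c, d) ∉ Q := by simp [Q]
  have q₃ : (a + e, b + f) ∉ Q := fun h =>
    h₁ (Finset.mem_of_mem_erase (Finset.mem_of_mem_erase h))
  have q₄ : (c + e, d + f) ∉ Q := fun h =>
    h₂ (Finset.mem_of_mem_erase (Finset.mem_of_mem_erase h))
  clear_value Q
  rw [gridGraph_adj_iff] at hadj
  have hd' : (e = b - d ∧ f = c - a) ∨ (e = d - b ∧ f = a - c) := by
    rcases hd with h | h <;> simp only [turn, Prod.mk.injEq, Prod.snd_sub, Prod.fst_sub,
      Prod.neg_mk] at h <;> omega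
  -- The four sides of the square on which the pair can lie.
  have bot : ∀ k j : ℤ, (k, j) ∉ Q → (k, j + 1) ∉ Q → (k + 1, j) ∉ Q → (k + 1, j + 1) ∉ Q →
      (A = {(k, j), (k, j + 1)} ∪ Q ∨ A = {(k + 1, j), (k + 1, j + 1)} ∪ Q ∨
        A = {(k, j), (k + 1, j)} ∪ Q ∨ A = {(k, j + 1), (k + 1, j + 1)} ∪ Q) →
      ∃ k j R, Transforms A (withWalker k j R) := by
    intro k j m₁ m₂ m₃ m₄ h
    obtain ⟨R, hR⟩ := fill k j Q m₁ m₂ m₃ m₄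
    refine ⟨k, j, R, ?_⟩
    rw [← hR]
    rcases h with rfl | rfl | rfl | rfl
    · exact Transforms.refl _
    · exact (transforms_lift m₁ m₂ m₃ m₄).symm
    · exact transforms_lay_left m₁ m₂ m₃ m₄
    · exact transforms_lay_right m₁ m₂ m₃ m₄
  have hn : ∀ x y, (x = a ∧ y = b ∨ x = c ∧ y = d ∨ x = a + e ∧ y = b + f ∨
      x = c + e ∧ y = d + f) → (x, y) ∉ Q := by
    rintro x y (⟨rfl, rfl⟩ | ⟨rfl, rfl⟩ | ⟨rfl, rfl⟩ | ⟨rfl, rfl⟩) <;> assumption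
  have hA' : ∀ x y z w, (x = a ∧ y = b ∧ z = c ∧ w = d ∨ x = c ∧ y = d ∧ z = a ∧ w = b) →
      A = {(x, y), (z, w)} ∪ Q := by
    rintro x y z w (⟨rfl, rfl, rfl, rfl⟩ | ⟨rfl, rfl, rfl, rfl⟩)
    · exact hA
    · rw [Finset.pair_comm]; exact hA
  clear hA h₁ h₂ q₁ q₂ q₃ q₄ hp hq hd
  simp only at hadj
  rcases hadj with ⟨h, h' | h'⟩ | ⟨h, h' | h'⟩ <;> rcases hd' with hd | hd
  · refine bot (a - 1) b ?_ ?_ ?_ ?_ (Or.inr (Or.inl (hA' _ _ _ _ (by omega)))) <;>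
      exact hn _ _ (by omega)
  · refine bot a b ?_ ?_ ?_ ?_ (Or.inl (hA' _ _ _ _ (by omega))) <;> exact hn _ _ (by omega)
  · refine bot a d ?_ ?_ ?_ ?_ (Or.inl (hA' _ _ _ _ (by omega))) <;> exact hn _ _ (by omega)
  · refine bot (a - 1) d ?_ ?_ ?_ ?_ (Or.inr (Or.inl (hA' _ _ _ _ (by omega)))) <;>
      exact hn _ _ (by omega)
  · refine bot a b ?_ ?_ ?_ ?_ (Or.inr (Or.inr (Or.inl (hA' _ _ _ _ (by omega))))) <;>
      exact hn _ _ (by omega)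
  · refine bot a (b - 1) ?_ ?_ ?_ ?_ (Or.inr (Or.inr (Or.inr (hA' _ _ _ _ (by omega))))) <;>
      exact hn _ _ (by omega)
  · refine bot c (b - 1) ?_ ?_ ?_ ?_ (Or.inr (Or.inr (Or.inr (hA' _ _ _ _ (by omega))))) <;>
      exact hn _ _ (by omega)
  · refine bot c b ?_ ?_ ?_ ?_ (Or.inr (Or.inr (Or.inl (hA' _ _ _ _ (by omega))))) <;>
      exact hn _ _ (by omega)

/-! ### Nodes of equal colour are interchangeable -/

/-- In the presence of a walker, the node at `a` can be moved to `b`, all the other nodes being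
restored.  The position of the walker does not matter by `transforms_withWalker`. -/
def Exchangeable (a b : Cell) : Prop :=
  ∀ R : Shape, a ∈ R → b ∉ R →
    Transforms (withWalker 0 0 R) (withWalker 0 0 (insert b (R.erase a)))

theorem Exchangeable.symm {a b : Cell} (h : Exchangeable a b) : Exchangeable b a := by
  intro R hb ha
  have hab : a ≠ b := fun h => ha (h ▸ hb)
  have := h (insert a (R.erase b)) (by simp) (by simp [hab.symm])
  rw [Finset.erase_insert (by simp [ha]), Finset.insert_erase hb] at this
  exact this.symm

/-- If the intermediate cell `b` is occupied, the node there moves on to `c` first, and the node at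
`a` takes its place. -/
theorem Exchangeable.trans {a b c : Cell} (h : Exchangeable a b) (h' : Exchangeable b c) :
    Exchangeable a c := by
  intro R ha hc
  by_cases hb : b ∈ R
  · by_cases hab : a = b
    · subst hab; exact h' R ha hc
    have hbc : b ≠ c := fun h => hc (h ▸ hb)
    refine (h' R hb hc).trans ?_
    convert h (insert c (R.erase b)) ?_ ?_ using 2 <;> grind
  · by_cases hbc : b = c
    · subst hbc; exact h R ha hc
    refine (h R ha hb).trans ?_
    convert h' (insert b (R.erase a)) ?_ ?_ using 2 <;> grind

theorem exchangeable_refl (a : Cell) : Exchangeable a a := fun _ h h' => absurd h h'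

/-- A node moves diagonally to the next row.  The walker, with left column `w`, is placed right
above the node `(x, y)` so that the target column `v` is next to the walker.  The node turns around
the node of the walker above it, towards the column `v`.  If the cell next to the node on that side
is occupied, it turns around the node there instead, while the pair of nodes of the walker makes
room. -/
theorem exchangeable_up (x y v w : ℤ) (hvw : v = y - 1 ∧ w = y ∨ v = y + 1 ∧ w = y - 1) :
    Exchangeable (x, y) (x + 1, v) := by
  intro R ha hb
  refine (transforms_withWalker 0 0 (x + 1) w R).trans (Transforms.trans ?_
    (transforms_withWalker (x + 1) w 0 0 _))
  set Q := (R.erase (x, y)).image (spread (x + 1) w) with hQ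
  have s₁ : spread (x + 1) w (x, y) = (x, y) := by
    rw [spread, if_neg (by dsimp only; omega)]
  have s₂ : spread (x + 1) w (x + 1, v) = (x + 1, v) := by
    rw [spread, if_neg (by dsimp only; omega)]
  have e₁ : withWalker (x + 1) w R = {(x + 1, w), (x + 1, w + 1)} ∪ ({(x, y)} ∪ Q) := by
    rw [withWalker, ← Finset.insert_eq (x, y) Q]
    conv_lhs => rw [← Finset.insert_erase ha, Finset.image_insert, ← hQ, s₁]
  have e₂ : withWalker (x + 1) w (insert (x + 1, v) (R.erase (x, y))) =
      {(x + 1, w), (x + 1, w + 1)} ∪ ({(x + 1, v)} ∪ Q) := by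
    rw [withWalker, Finset.image_insert, ← hQ, s₂, Finset.insert_eq (x + 1, v) Q]
  have q₁ : (x, y) ∉ Q := by
    rw [hQ, mem_image_spread, Finset.mem_erase, Finset.mem_erase]
    have : ¬(x + 1 + 2 ≤ x) := by omega
    simp [this]
  have q₂ : (x + 1, v) ∉ Q := by
    rw [hQ, mem_image_spread]
    have : ¬(v = w ∨ v = w + 1) := by omega
    simp [this, hb]
  have hn : ∀ u z, (u = x ∧ z = y ∨ u = x + 1 ∧ z = v ∨
      (u = x + 1 ∨ u = x + 1 + 1) ∧ (z = w ∨ z = w + 1)) → (u, z) ∉ Q := by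
    rintro u z (⟨rfl, rfl⟩ | ⟨rfl, rfl⟩ | ⟨h, h'⟩)
    · exact q₁
    · exact q₂
    · exact notMem_image_spread h h'
  clear_value Q
  rw [e₁, e₂]
  by_cases hr : (x, v) ∈ Q
  · have hm : RotStep ({(x, y)} ∪ ({(x + 1 + 1, w), (x + 1 + 1, w + 1)} ∪ Q))
        ({(x + 1, v)} ∪ ({(x + 1 + 1, w), (x + 1 + 1, w + 1)} ∪ Q)) := by
      apply rotStep_union x y x v 1 0
      case hp => simp
      case hq => simp [hr]
      case hadj => omega
      case hd => omega
      case hP' =>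
        intro x y
        simp only [Finset.mem_singleton, Prod.mk.injEq]
        omega
      all_goals
        simp only [Finset.mem_union, Finset.mem_insert, Finset.mem_singleton, Prod.mk.injEq,
          add_zero, ← or_assoc]
        exact not_or.2 ⟨by omega, hn _ _ (by omega)⟩
    rw [Finset.union_left_comm, Finset.union_left_comm {(x + 1, v)}] at hm
    refine Transforms.trans (transforms_lift ?_ ?_ ?_ ?_) (hm.transforms.trans
      (transforms_lift ?_ ?_ ?_ ?_).symm)
    all_goals
      simp only [Finset.mem_union, Finset.mem_singleton, Prod.mk.injEq]
      exact not_or.2 ⟨by omega, hn _ _ (by omega)⟩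
  · rw [← Finset.union_assoc, ← Finset.union_assoc]
    apply RotStep.transforms
    apply rotStep_union x y (x + 1) y 0 (v - y)
    case hp => simp
    case hq =>
      rcases hvw with ⟨-, rfl⟩ | ⟨-, rfl⟩ <;> simp
    case hpQ => exact q₁
    case hadj => omega
    case hd => omega
    case hP' =>
      intro x y
      simp only [Finset.mem_union, Finset.mem_insert, Finset.mem_singleton, Prod.mk.injEq]
      omega
    all_goals
      simp only [Finset.mem_union, Finset.mem_insert, Finset.mem_singleton, Prod.mk.injEq,
        add_zero, add_sub_cancel]
      first
        | exact not_or.2 ⟨by omega, hn _ _ (by omega)⟩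
        | exact not_or.2 ⟨by omega, hr⟩

/-- A lattice argument: the two diagonal directions generate all the cells of a given colour. -/
theorem exchangeable_of_even {a b : Cell} (h : Even (b.1 - a.1 + (b.2 - a.2))) :
    Exchangeable a b := by
  have diag : ∀ (n : ℕ) (x y : ℤ), Exchangeable (x, y) (x + n, y + n) := by
    intro n
    induction n with
    | zero => intro x y; simpa using exchangeable_refl _
    | succ n ih =>
      intro x y
      have := exchangeable_up (x + n) (y + n) (y + n + 1) (y + n - 1) (by omega)
      simpa [add_assoc] using (ih x y).trans this
  have anti : ∀ (n : ℕ) (x y : ℤ), Exchangeable (x, y) (x + n, y - n) := by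
    intro n
    induction n with
    | zero => intro x y; simpa using exchangeable_refl _
    | succ n ih =>
      intro x y
      have := exchangeable_up (x + n) (y - n) (y - n - 1) (y - n) (by omega)
      simpa [add_assoc, sub_sub] using (ih x y).trans this
  have diag' : ∀ m x y : ℤ, Exchangeable (x, y) (x + m, y + m) := by
    intro m x y
    obtain ⟨n, rfl | rfl⟩ := m.eq_nat_or_neg
    · exact diag n x y
    · simpa using (diag n (x + -n) (y + -n)).symm
  have anti' : ∀ m x y : ℤ, Exchangeable (x, y) (x + m, y - m) := by
    intro m x y
    obtain ⟨n, rfl | rfl⟩ := m.eq_nat_or_neg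
    · exact anti n x y
    · simpa using (anti n (x + -n) (y + n)).symm
  obtain ⟨a₁, a₂⟩ := a
  obtain ⟨b₁, b₂⟩ := b
  obtain ⟨m, hm⟩ := h
  simp only at hm
  convert (diag' m a₁ a₂).trans (anti' (b₁ - a₁ - m) (a₁ + m) (a₂ + m)) using 2
  · ring
  · linarith

/-! ### Colours -/

theorem card_eq_blacks_add_reds (S : Shape) : S.card = blacks S + reds S := by
  rw [blacks, reds, ← Finset.card_filter_add_card_filter_not (s := S) (fun c => Even (c.1 + c.2))]
  simp only [Int.not_even_iff_odd]

/-- A node that moves between cells with the same property `f` does not change the number of nodes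
in such cells. -/
theorem card_filter_insert_erase (f : Cell → Prop) [DecidablePred f] {S : Shape} {a b : Cell}
    (ha : a ∈ S) (hb : b ∉ S) (hab : f b ↔ f a) :
    ((insert b (S.erase a)).filter f).card = (S.filter f).card := by
  have hb' : b ∉ S.erase a := fun h => hb (Finset.mem_of_mem_erase h)
  rw [Finset.filter_insert]
  conv_rhs => rw [← Finset.insert_erase ha, Finset.filter_insert]
  simp only [hab]
  split_ifs
  · rw [Finset.card_insert_of_notMem (by simp [hb]), Finset.card_insert_of_notMem (by simp)]
  · rfl

theorem RotStep.colorConsistent {S T : Shape} (h : RotStep S T) : ColorConsistent S T := by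
  obtain ⟨p, q, d, hp, hq, hadj, hd, h₁, h₂, rfl⟩ := h
  have hpar : Even (p.1 + p.2) ↔ Even ((q + d).1 + (q + d).2) := by
    rw [gridGraph_adj_iff] at hadj
    simp only [Int.even_iff, Prod.fst_add, Prod.snd_add]
    rcases hd with rfl | rfl <;> simp only [turn, Prod.fst_sub, Prod.snd_sub, Prod.fst_neg,
      Prod.snd_neg] <;> omega
  refine ⟨(card_filter_insert_erase _ hp h₂ hpar.symm).symm,
    (card_filter_insert_erase _ hp h₂ ?_).symm⟩
  rw [← Int.not_even_iff_odd, ← Int.not_even_iff_odd, hpar]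

theorem Transforms.colorConsistent {S T : Shape} (h : Transforms S T) : ColorConsistent S T := by
  induction h with
  | refl => exact ⟨rfl, rfl⟩
  | tail _ h ih => exact ⟨ih.1.trans h.colorConsistent.1, ih.2.trans h.colorConsistent.2⟩

/-- In the presence of a walker the remaining nodes can be rearranged freely within the colours.
Each exchange decreases the number of cells that are occupied by `R` and not by `R'`. -/
theorem transforms_withWalker_of_colorConsistent {R R' : Shape} (h : ColorConsistent R R') :
    Transforms (withWalker 0 0 R) (withWalker 0 0 R') := by
  induction hn : (R \ R').card using Nat.strong_induction_on generalizing R with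
  | _ n ih =>
  have hcard : R.card = R'.card := by rw [card_eq_blacks_add_reds, card_eq_blacks_add_reds, h.1, h.2]
  rcases eq_or_ne R R' with rfl | hne
  · exact Transforms.refl _
  obtain ⟨a, ha, ha'⟩ : ∃ a ∈ R, a ∉ R' := by
    by_contra! hsub
    exact hne (Finset.eq_of_subset_of_card_le hsub hcard.ge)
  -- A cell of the same colour that only `R'` occupies exists because the counts agree.
  have key : ∀ (f : Cell → Prop) [DecidablePred f], f a →
      (R.filter f).card = (R'.filter f).card → ∃ b ∈ R', b ∉ R ∧ f b := by
    intro f _ hfa hc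
    by_contra! hsub
    have hsub' : R'.filter f ⊆ R.filter f := by
      intro b hb
      rw [Finset.mem_filter] at hb ⊢
      exact ⟨by by_contra hbR; exact hsub b hb.1 hbR hb.2, hb.2⟩
    have := Finset.eq_of_subset_of_card_le hsub' hc.le
    exact ha' (Finset.mem_filter.1 (this ▸ Finset.mem_filter.2 ⟨ha, hfa⟩)).1
  obtain ⟨b, hb, hb', hab⟩ : ∃ b ∈ R', b ∉ R ∧ (Even (b.1 + b.2) ↔ Even (a.1 + a.2)) := by
    by_cases hp : Even (a.1 + a.2)
    · obtain ⟨b, hb, hb', hf⟩ := key (fun c => Even (c.1 + c.2)) hp h.1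
      exact ⟨b, hb, hb', by simp [hp, hf]⟩
    · obtain ⟨b, hb, hb', hf⟩ := key (fun c => Odd (c.1 + c.2)) (Int.not_even_iff_odd.1 hp) h.2
      exact ⟨b, hb, hb', by simp [hp, Int.not_even_iff_odd.2 hf]⟩
  have hodd : Odd (b.1 + b.2) ↔ Odd (a.1 + a.2) := by
    rw [← Int.not_even_iff_odd, ← Int.not_even_iff_odd, hab]
  refine (exchangeable_of_even (a := a) (b := b) ?_ R ha hb').trans (ih _ ?_ ?_ rfl)
  · rw [show b.1 - a.1 + (b.2 - a.2) = b.1 + b.2 - (a.1 + a.2) by ring, Int.even_sub, hab]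
  · rw [← hn]
    apply Finset.card_lt_card
    rw [Finset.ssubset_iff_of_subset]
    · exact ⟨a, by simp [ha, ha'], by
        simp only [Finset.mem_sdiff, Finset.mem_insert, Finset.mem_erase]
        rintro ⟨h | h, -⟩
        · exact hb' (h ▸ ha)
        · exact h.1 rfl⟩
    · intro c
      simp only [Finset.mem_sdiff, Finset.mem_insert, Finset.mem_erase]
      rintro ⟨rfl | h, h'⟩
      · exact absurd hb h'
      · exact ⟨h.2, h'⟩
  · exact ⟨(card_filter_insert_erase _ ha hb' hab).trans h.1,
      (card_filter_insert_erase _ ha hb' hodd).trans h.2⟩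

/-! ### Transformability -/

/-- Two shapes with the same numbers of black and red nodes, connected or not, transform to each
other as soon as both admit a rotation movement. -/
theorem transforms_of_colorConsistent {A B : Shape} (h : ColorConsistent A B)
    (hA : HasRotation A) (hB : HasRotation B) : Transforms A B := by
  obtain ⟨k, j, R, hR⟩ := hA.exists_withWalker
  obtain ⟨k', j', R', hR'⟩ := hB.exists_withWalker
  -- With both walkers above everything else, in the same cells, a count shows that the remaining
  -- shapes are color-consistent.
  obtain ⟨m, hm⟩ := exists_forall_row_lt (R ∪ R')
  have hmR : ∀ c ∈ R, c.1 < m := fun c hc => hm c (Finset.mem_union_left _ hc)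
  have hmR' : ∀ c ∈ R', c.1 < m := fun c hc => hm c (Finset.mem_union_right _ hc)
  have hRm := hR.trans (transforms_withWalker k j m 0 R)
  have hRm' := hR'.trans (transforms_withWalker k' j' m 0 R')
  rw [withWalker_of_lt hmR] at hRm
  rw [withWalker_of_lt hmR'] at hRm'
  have cR := hRm.colorConsistent
  have cR' := hRm'.colorConsistent
  have count : ∀ (f : Cell → Prop) [DecidablePred f] (S : Shape), (∀ c ∈ S, c.1 < m) →
      ((({(m, 0), (m, 0 + 1)} : Shape) ∪ S).filter f).card =
        (({(m, 0), (m, 0 + 1)} : Shape).filter f).card + (S.filter f).card := by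
    intro f _ S hS
    rw [Finset.filter_union, Finset.card_union_of_disjoint]
    apply Finset.disjoint_filter_filter
    rw [Finset.disjoint_left]
    intro c hc hcS
    have := hS c hcS
    simp only [Finset.mem_insert, Finset.mem_singleton] at hc
    rcases hc with rfl | rfl <;> simp at this
  simp only [ColorConsistent, blacks, reds, count _ _ hmR, count _ _ hmR'] at cR cR' h
  have hc : ColorConsistent R R' := by
    simp only [ColorConsistent, blacks, reds]
    omega
  exact (hR.trans (transforms_withWalker k j 0 0 R)).trans
    ((transforms_withWalker_of_colorConsistent hc).trans
      ((transforms_withWalker 0 0 k' j' R').trans hR'.symm))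

theorem Transforms.hasRotation_of_ne {A B : Shape} (h : Transforms A B) (hne : A ≠ B) :
    HasRotation A := by
  rcases Relation.ReflTransGen.cases_head h with rfl | ⟨C, hC, -⟩
  · exact absurd rfl hne
  · exact ⟨C, hC⟩

/-- A nontrivial sequence of movements starts with an available rotation movement, and ends with one
that can be undone.  Connectivity plays no role. -/
theorem transforms_iff {A B : Shape} :
    Transforms A B ↔ (ColorConsistent A B ∧ HasRotation A ∧ HasRotation B) ∨ A = B := by
  constructor
  · intro h
    rcases eq_or_ne A B with rfl | hne
    · exact Or.inr rfl
    · exact Or.inl ⟨h.colorConsistent, h.hasRotation_of_ne hne, h.symm.hasRotation_of_ne hne.symm⟩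
  · rintro (⟨h, hA, hB⟩ | rfl)
    · exact transforms_of_colorConsistent h hA hB
    · exact Transforms.refl _

/-- A walker above all the other nodes is an extracted 2-line. -/
theorem hasRotation_iff_twoLineExtractable {S : Shape} :
    HasRotation S ↔ TwoLineExtractable S := by
  constructor
  · intro h
    obtain ⟨k, j, R, hR⟩ := h.exists_withWalker
    obtain ⟨m, hm⟩ := exists_forall_row_lt R
    have hm' : ∀ c ∈ R, c.1 < m + 1 := fun c hc => (hm c hc).trans (lt_add_one m)
    have hR' := hR.trans (transforms_withWalker k j (m + 1) 0 R)
    rw [withWalker_of_lt hm'] at hR'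
    refine ⟨R, (m + 1, 0), (m + 1, 1), ?_, ?_, ?_, ?_, ?_⟩
    · rw [gridGraph_adj_iff]; simp
    · exact fun h => absurd (hm' _ h) (lt_irrefl _)
    · exact fun h => absurd (hm' _ h) (lt_irrefl _)
    · exact Or.inr (Or.inl fun c hc => ⟨by simpa using hm c hc, by simpa using hm c hc⟩)
    · simpa using hR'
  · rintro ⟨R, u, v, huv, hu, hv, hout, h⟩
    by_cases hne : S = insert u (insert v R)
    · -- The isolated pair can turn on the spot, since all the cells around it are empty.
      subst hne
      have hfar : ∀ w : Cell, |w.1 - u.1| ≤ 1 ∧ |w.2 - u.2| ≤ 1 ∨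
          |w.1 - v.1| ≤ 1 ∧ |w.2 - v.2| ≤ 1 → w ∉ R := by
        intro w hw hwR
        simp only [abs_le] at hw
        rcases hout with h | h | h | h <;> have := h w hwR <;> omega
      have hadj := huv
      rw [gridGraph_adj_iff] at hadj
      have hd : ∀ w : Cell, w + turn (v - u) ≠ w := by
        intro w hw
        rw [add_eq_left, turn, Prod.mk_eq_zero] at hw
        simp only [Prod.fst_sub, Prod.snd_sub] at hw
        omega
      have hd' : u + turn (v - u) ≠ v ∧ v + turn (v - u) ≠ u := by
        constructor <;> intro hw <;> rw [Prod.ext_iff] at hw <;>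
          simp only [turn, Prod.fst_add, Prod.snd_add, Prod.fst_sub, Prod.snd_sub] at hw <;> omega
      refine ⟨_, u, v, turn (v - u), by simp, by simp, huv, Or.inl rfl, ?_, ?_, rfl⟩
      · simp only [Finset.mem_insert, not_or]
        refine ⟨hd u, hd'.1, hfar _ (Or.inl ?_)⟩
        simp only [turn, Prod.fst_add, Prod.snd_add, Prod.fst_sub, Prod.snd_sub, abs_le]
        omega
      · simp only [Finset.mem_insert, not_or]
        refine ⟨hd'.2, hd v, hfar _ (Or.inr ?_)⟩
        simp only [turn, Prod.fst_add, Prod.snd_add, Prod.fst_sub, Prod.snd_sub, abs_le]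
        omega
    · exact h.hasRotation_of_ne hne

/-! ### Motions of the plane -/

theorem turn_add (a b : Cell) : turn (a + b) = turn a + turn b := by
  ext <;> simp [turn, add_comm]

theorem turn_iterate_add (k : ℕ) (a b : Cell) : turn^[k] (a + b) = turn^[k] a + turn^[k] b := by
  induction k generalizing a b with
  | zero => rfl
  | succ k ih => rw [Function.iterate_succ_apply, turn_add, ih]; rfl

theorem turn_iterate_four_mul (k : ℕ) (a : Cell) : turn^[4 * k] a = a := by
  rw [Function.iterate_mul]
  have : turn^[4] = id := by
    funext a; simp [turn]
  rw [this, Function.iterate_id, id]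

theorem Congruent.symm {A B : Shape} (h : Congruent A B) : Congruent B A := by
  obtain ⟨k, t, rfl⟩ := h
  refine ⟨3 * k, -turn^[3 * k] t, ?_⟩
  rw [Finset.image_image]
  conv_lhs => rw [← Finset.image_id (s := A)]
  refine Finset.image_congr fun c _ => ?_
  have : turn^[3 * k] (turn^[k] c) = c := by
    rw [← Function.iterate_add_apply, show 3 * k + k = 4 * k by ring, turn_iterate_four_mul]
  simp [turn_iterate_add, this]

theorem congruent_refl (A : Shape) : Congruent A A := ⟨0, 0, by simp⟩

theorem turn_injective : Function.Injective turn := by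
  intro a b h
  simp only [turn, Prod.mk.injEq, neg_inj] at h
  exact Prod.ext h.2 h.1

theorem turn_neg (a : Cell) : turn (-a) = -turn a := by
  ext <;> simp [turn]

theorem turn_sub (a b : Cell) : turn (a - b) = turn a - turn b := by
  rw [sub_eq_add_neg, turn_add, turn_neg, ← sub_eq_add_neg]

theorem HasRotation.image_turn {S : Shape} (h : HasRotation S) : HasRotation (S.image turn) := by
  obtain ⟨T, p, q, d, hp, hq, hadj, hd, h₁, h₂, -⟩ := h
  refine ⟨_, turn p, turn q, turn d, Finset.mem_image_of_mem _ hp, Finset.mem_image_of_mem _ hq,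
    ?_, ?_, ?_, ?_, rfl⟩
  · rw [gridGraph_adj_iff] at hadj ⊢
    simp only [turn]
    omega
  · rcases hd with rfl | rfl
    · left
      rw [turn_sub, turn_sub]
    · right
      rw [turn_neg, turn_sub, turn_sub]
  · rwa [← turn_add, turn_injective.mem_finset_image]
  · rwa [← turn_add, turn_injective.mem_finset_image]

theorem HasRotation.image_add {S : Shape} (t : Cell) (h : HasRotation S) :
    HasRotation (S.image (· + t)) := by
  obtain ⟨T, p, q, d, hp, hq, hadj, hd, h₁, h₂, -⟩ := h
  refine ⟨_, p + t, q + t, d, Finset.mem_image_of_mem _ hp, Finset.mem_image_of_mem _ hq,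
    ?_, ?_, ?_, ?_, rfl⟩
  · rw [gridGraph_adj_iff] at hadj ⊢
    simp only [Prod.fst_add, Prod.snd_add]
    omega
  · rwa [add_sub_add_right_eq_sub]
  · rw [add_right_comm]
    simpa using h₁
  · rw [add_right_comm]
    simpa using h₂

theorem Congruent.hasRotation {A B : Shape} (h : Congruent A B) (hA : HasRotation A) :
    HasRotation B := by
  obtain ⟨k, t, rfl⟩ := h
  have : A.image (fun c => turn^[k] c + t) = (A.image turn^[k]).image (· + t) := by
    rw [Finset.image_image]; rfl
  rw [this]
  apply HasRotation.image_add
  induction k with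
  | zero => simpa using hA
  | succ k ih =>
    rw [Function.iterate_succ', ← Finset.image_image]
    exact (ih (by rw [Finset.image_image]; rfl)).image_turn

theorem transformsUpToMotion_iff {A B : Shape} :
    TransformsUpToMotion A B ↔
      (ColorConsistentUpToMotion A B ∧ HasRotation A ∧ HasRotation B) ∨ Congruent A B := by
  constructor
  · rintro ⟨B', hB', h⟩
    rcases transforms_iff.1 h with ⟨hc, hA, hr⟩ | rfl
    · exact Or.inl ⟨⟨B', hB', hc⟩, hA, hB'.symm.hasRotation hr⟩
    · exact Or.inr hB'.symm
  · rintro (⟨⟨B', hB', hc⟩, hA, hB⟩ | h)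
    · exact ⟨B', hB', transforms_of_colorConsistent hc hA (hB'.hasRotation hB)⟩
    · exact ⟨A, h.symm, Transforms.refl A⟩

/-! ### Running programs -/

@[simp] theorem Store.setReg_reg (s : Store) (x y : ℕ) (z : ℤ) :
    (s.setReg x z).reg y = if y = x then z else s.reg y := by
  simp [Store.setReg, Function.update_apply]

@[simp] theorem Store.setReg_mem (s : Store) (x : ℕ) (z : ℤ) : (s.setReg x z).mem = s.mem := rfl

@[simp] theorem Store.setMem_reg (s : Store) (a : ℕ) (i z : ℤ) : (s.setMem a i z).reg = s.reg := rfl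

@[simp] theorem Store.setMem_mem (s : Store) (a b : ℕ) (i j z : ℤ) :
    (s.setMem a i z).mem b j = if b = a ∧ j = i then z else s.mem b j := by
  simp only [Store.setMem, Function.update_apply]
  split_ifs <;> simp_all

/-- The program may write into the register `x`. -/
def Prog.writesReg (x : ℕ) : Prog → Bool
  | .const y _ => x == y
  | .add y _ _ => x == y
  | .sub y _ _ => x == y
  | .half y _ => x == y
  | .load y _ _ => x == y
  | .store _ _ _ => false
  | .seq P Q => P.writesReg x || Q.writesReg x
  | .ite _ P Q => P.writesReg x || Q.writesReg x
  | .loop _ P => P.writesReg x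

/-- The program may write into the array `a`. -/
def Prog.writesMem (a : ℕ) : Prog → Bool
  | .store b _ _ => a == b
  | .seq P Q => P.writesMem a || Q.writesMem a
  | .ite _ P Q => P.writesMem a || Q.writesMem a
  | .loop _ P => P.writesMem a
  | _ => false

/-- The two stores differ at most in registers and arrays that the program may write into. -/
structure Frame (P : Prog) (s s' : Store) : Prop where
  reg : ∀ x, P.writesReg x = false → s'.reg x = s.reg x
  mem : ∀ a, P.writesMem a = false → s'.mem a = s.mem a

theorem Exec.frame {P : Prog} {s s' : Store} {t c : ℕ} (h : Exec P s s' t c) : Frame P s s' := by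
  induction h with
  | const | add | sub | half | load =>
    exact ⟨fun y hy => by simp_all [Prog.writesReg], fun _ _ => rfl⟩
  | store =>
    refine ⟨fun _ _ => rfl, fun b hb => ?_⟩
    funext i
    simp_all [Prog.writesMem]
  | seq P Q s₁ s₂ s₃ t t' c c' _ _ ih ih' =>
    constructor
    · intro x hx
      simp only [Prog.writesReg, Bool.or_eq_false_iff] at hx
      rw [ih'.reg x hx.2, ih.reg x hx.1]
    · intro x hx
      simp only [Prog.writesMem, Bool.or_eq_false_iff] at hx
      rw [ih'.mem x hx.2, ih.mem x hx.1]
  | ite_pos x P Q s s' t c _ _ ih =>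
    constructor
    · intro x hx
      simp only [Prog.writesReg, Bool.or_eq_false_iff] at hx
      rw [ih.reg x hx.1]
    · intro x hx
      simp only [Prog.writesMem, Bool.or_eq_false_iff] at hx
      rw [ih.mem x hx.1]
  | ite_nonpos x P Q s s' t c _ _ ih =>
    constructor
    · intro x hx
      simp only [Prog.writesReg, Bool.or_eq_false_iff] at hx
      rw [ih.reg x hx.2]
    · intro x hx
      simp only [Prog.writesMem, Bool.or_eq_false_iff] at hx
      rw [ih.mem x hx.2]
  | loop_pos x P s₁ s₂ s₃ t t' c c' _ _ _ ih ih' =>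
    constructor
    · intro x hx
      rw [ih'.reg x hx, ih.reg x hx]
    · intro x hx
      rw [ih'.mem x hx, ih.mem x hx]
  | loop_nonpos => exact ⟨fun _ _ => rfl, fun _ _ => rfl⟩

/-- The final store of a program without loops. -/
def Prog.eval : Prog → Store → Store
  | .const x z, s => s.setReg x z
  | .add x y z, s => s.setReg x (s.reg y + s.reg z)
  | .sub x y z, s => s.setReg x (s.reg y - s.reg z)
  | .half x y, s => s.setReg x (s.reg y / 2)
  | .load x a y, s => s.setReg x (s.mem a (s.reg y))
  | .store a y x, s => s.setMem a (s.reg y) (s.reg x)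
  | .seq P Q, s => Q.eval (P.eval s)
  | .ite x P Q, s => if 0 < s.reg x then P.eval s else Q.eval s
  | .loop _ _, s => s

/-- The program contains no loops. -/
def Prog.straight : Prog → Bool
  | .seq P Q => P.straight && Q.straight
  | .ite _ P Q => P.straight && Q.straight
  | .loop _ _ => false
  | _ => true

/-- A bound for the number of steps of a program without loops. -/
def Prog.size : Prog → ℕ
  | .seq P Q => P.size + Q.size
  | .ite _ P Q => 1 + (P.size + Q.size)
  | _ => 1

/-- A program without loops always halts, within a number of steps that depends only on the
program. -/
theorem exec_of_straight {P : Prog} (h : P.straight = true) (s : Store) :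
    ∃ t c, Exec P s (P.eval s) t c ∧ t ≤ P.size := by
  induction P generalizing s with
  | const x z => exact ⟨_, _, .const s x z, le_rfl⟩
  | add x y z => exact ⟨_, _, .add s x y z, le_rfl⟩
  | sub x y z => exact ⟨_, _, .sub s x y z, le_rfl⟩
  | half x y => exact ⟨_, _, .half s x y, le_rfl⟩
  | load x a y => exact ⟨_, _, .load s x a y, le_rfl⟩
  | store a y x => exact ⟨_, _, .store s a y x, le_rfl⟩
  | seq P Q ihP ihQ =>
    simp only [Prog.straight, Bool.and_eq_true] at h
    obtain ⟨t, c, e, ht⟩ := ihP h.1 s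
    obtain ⟨t', c', e', ht'⟩ := ihQ h.2 (P.eval s)
    exact ⟨_, _, .seq _ _ _ _ _ _ _ _ _ e e', by simp only [Prog.size]; omega⟩
  | ite x P Q ihP ihQ =>
    simp only [Prog.straight, Bool.and_eq_true] at h
    obtain ⟨t, c, e, ht⟩ := ihP h.1 s
    obtain ⟨t', c', e', ht'⟩ := ihQ h.2 s
    by_cases hx : 0 < s.reg x
    · refine ⟨1 + t, bitLen (s.reg x) + c, ?_, by simp only [Prog.size]; omega⟩
      rw [Prog.eval, if_pos hx]
      exact .ite_pos _ _ _ _ _ _ _ hx e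
    · refine ⟨1 + t', bitLen (s.reg x) + c', ?_, by simp only [Prog.size]; omega⟩
      rw [Prog.eval, if_neg hx]
      exact .ite_nonpos _ _ _ _ _ _ _ (not_lt.1 hx) e'
  | loop => simp [Prog.straight] at h

theorem frame_eval {P : Prog} (h : P.straight = true) (s : Store) : Frame P s (P.eval s) := by
  obtain ⟨t, c, e, -⟩ := exec_of_straight h s
  exact e.frame

/-- Started in the store `s`, the program halts within `C * (n + 1)` steps in a store that
satisfies `Q`. -/
def Runs (P : Prog) (C n : ℕ) (s : Store) (Q : Store → Prop) : Prop :=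
  ∃ (s' : Store) (t c : ℕ), Exec P s s' t c ∧ t ≤ C * (n + 1) ∧ Q s'

section Runs

variable {P P' : Prog} {C C' n : ℕ} {s : Store} {Q Q' : Store → Prop}

theorem Runs.seq (h : Runs P C n s Q)
    (h' : ∀ s', Frame P s s' → Q s' → Runs P' C' n s' Q') : Runs (.seq P P') (C + C') n s Q' := by
  obtain ⟨s₁, t, c, e, ht, hQ⟩ := h
  obtain ⟨s₂, t', c', e', ht', hQ'⟩ := h' s₁ e.frame hQ
  exact ⟨s₂, _, _, .seq _ _ _ _ _ _ _ _ _ e e', by rw [add_mul]; omega, hQ'⟩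

theorem Runs.mono (h : Runs P C n s Q) (hC : C ≤ C') (hQ : ∀ s', Frame P s s' → Q s' → Q' s') :
    Runs P C' n s Q' := by
  obtain ⟨s₁, t, c, e, ht, hQ₁⟩ := h
  exact ⟨s₁, t, c, e, ht.trans (Nat.mul_le_mul_right _ hC), hQ _ e.frame hQ₁⟩

theorem runs_straight (h : P.straight = true) (hQ : Q (P.eval s)) : Runs P P.size n s Q := by
  obtain ⟨t, c, e, ht⟩ := exec_of_straight h s
  exact ⟨_, t, c, e, ht.trans (Nat.le_mul_of_pos_right _ n.succ_pos), hQ⟩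

theorem Runs.ite {x : ℕ} (h : 0 < s.reg x → Runs P C n s Q) (h' : s.reg x ≤ 0 → Runs P' C n s Q) :
    Runs (.ite x P P') (C + 1) n s Q := by
  by_cases hx : 0 < s.reg x
  · obtain ⟨s₁, t, c, e, ht, hQ⟩ := h hx
    exact ⟨s₁, _, _, .ite_pos _ _ _ _ _ _ _ hx e, by rw [add_mul]; omega, hQ⟩
  · obtain ⟨s₁, t, c, e, ht, hQ⟩ := h' (not_lt.1 hx)
    exact ⟨s₁, _, _, .ite_nonpos _ _ _ _ _ _ _ (not_lt.1 hx) e, by rw [add_mul]; omega, hQ⟩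

/-- The rule for loops: `I m` is an invariant, with a bound `m` for the number of remaining
iterations. -/
theorem runs_loop {x : ℕ} {I : ℕ → Store → Prop} (hP : P.straight = true) {m : ℕ} (hm : m ≤ n)
    (h₀ : I m s)
    (step : ∀ m s', Frame P s s' → I m s' → 0 < s'.reg x → ∃ m' < m, I m' (P.eval s')) :
    Runs (.loop x P) (P.size + 1) n s (fun s' => s'.reg x ≤ 0 ∧ ∃ m, I m s') := by
  have key : ∀ m s', Frame P s s' → I m s' → ∃ (s'' : Store) (t c : ℕ), Exec (.loop x P) s' s'' t c ∧
      t ≤ (P.size + 1) * (m + 1) ∧ s''.reg x ≤ 0 ∧ ∃ m, I m s'' := by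
    intro m
    induction m using Nat.strong_induction_on with
    | _ m ih =>
    intro s' hf hI
    by_cases hx : 0 < s'.reg x
    · obtain ⟨m', hm', hI'⟩ := step m s' hf hI hx
      obtain ⟨t, c, e, ht⟩ := exec_of_straight hP s'
      have hf' : Frame P s (P.eval s') :=
        ⟨fun y hy => (e.frame.reg y hy).trans (hf.reg y hy),
          fun y hy => (e.frame.mem y hy).trans (hf.mem y hy)⟩
      obtain ⟨s'', t', c', e', ht', hx', hI''⟩ := ih m' hm' _ hf' hI'
      refine ⟨s'', _, _, .loop_pos _ _ _ _ _ _ _ _ _ hx e e', ?_, hx', hI''⟩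
      have : (P.size + 1) * (m' + 1) ≤ (P.size + 1) * m := Nat.mul_le_mul_left _ hm'
      rw [mul_add, mul_one]
      omega
    · exact ⟨s', 1, _, .loop_nonpos _ _ _ (not_lt.1 hx), Nat.mul_pos (by omega) (by omega),
        not_lt.1 hx, m, hI⟩
  obtain ⟨s', t, c, e, ht, hx, hI⟩ := key m s ⟨fun _ _ => rfl, fun _ _ => rfl⟩ h₀
  exact ⟨s', t, c, e, ht.trans (Nat.mul_le_mul_left _ (by omega)), hx, hI⟩

end Runs

/-- Repeat the program `P` with the register 5 running through `n - 1, …, 1, 0`, where `n` is the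
content of the register `x`.  The registers 2 and 19 have to contain 1 and 0. -/
def Prog.countdown (x : ℕ) (P : Prog) : Prog :=
  .seq (.add 5 x 19) (.loop 5 (.seq (.sub 5 5 2) P))

/-- The rule for `Prog.countdown`: the body takes the invariant `I` from `k + 1`, with the counter
reset to this value, to `k`. -/
theorem runs_countdown {P : Prog} {x m n : ℕ} {s : Store} {I : ℕ → Store → Prop}
    (hx : s.reg x = m) (h₂ : s.reg 2 = 1) (h₁₉ : s.reg 19 = 0)
    (hP : P.straight = true) (hP₂ : P.writesReg 2 = false) (hP₅ : P.writesReg 5 = false)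
    (hm : m ≤ n) (h₀ : I m (s.setReg 5 m))
    (step : ∀ k < m, ∀ s', Frame (P.countdown x) s s' → s'.reg 5 = k →
      I (k + 1) (s'.setReg 5 (k + 1)) → I k (P.eval s')) :
    Runs (P.countdown x) (P.size + 3) n s (I 0) := by
  have h5 : (Prog.countdown x P).writesReg 5 = true := by simp [Prog.countdown, Prog.writesReg]
  refine Runs.mono (C := 1 + (1 + P.size + 1)) (Q := fun s' => s'.reg 5 ≤ 0 ∧
    ∃ k : ℕ, s'.reg 5 = k ∧ k ≤ m ∧ I k s') ?_ (by omega) ?_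
  · refine Runs.seq (Q := fun s' => s' = s.setReg 5 m)
      (runs_straight rfl (by simp [Prog.eval, hx, h₁₉])) ?_
    rintro _ - rfl
    refine runs_loop (I := fun k s' => s'.reg 5 = k ∧ k ≤ m ∧ I k s') (P := .seq (.sub 5 5 2) P)
      (by simpa [Prog.straight] using hP) hm ⟨by simp, le_rfl, h₀⟩ ?_
    rintro k s' hf ⟨hk, hkm, hI⟩ hpos
    obtain ⟨k, rfl⟩ : ∃ l, k = l + 1 := ⟨k - 1, by omega⟩
    have h₂' : s'.reg 2 = 1 := by
      rw [hf.reg 2 (by simp [Prog.writesReg, hP₂])]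
      simpa using h₂
    have hs₁ : (Prog.sub 5 5 2).eval s' = s'.setReg 5 k := by
      simp [Prog.eval, hk, h₂']
    refine ⟨k, k.lt_succ_self, ?_, by omega, ?_⟩
    · rw [Prog.eval, hs₁, (frame_eval hP _).reg 5 hP₅]
      simp
    · rw [Prog.eval, hs₁]
      refine step k (by omega) _ ⟨?_, ?_⟩ (by simp) ?_
      · intro y hy
        have hy5 : y ≠ 5 := by rintro rfl; simp [h5] at hy
        rw [Store.setReg_reg, if_neg hy5, hf.reg y, Store.setReg_reg, if_neg hy5]
        simp only [Prog.countdown, Prog.writesReg, Bool.or_eq_false_iff] at hy ⊢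
        exact hy.2
      · intro a ha
        rw [Store.setReg_mem, hf.mem a, Store.setReg_mem]
        simp only [Prog.countdown, Prog.writesMem, Bool.or_eq_false_iff] at ha ⊢
        exact ha.2
      · convert hI using 1
        simp only [Store.setReg, Function.update_idem]
        congr 1
        rw [Function.update_eq_self_iff]
        simpa using hk.symm
  · rintro s' - ⟨h, k, hk, -, hI⟩
    obtain rfl : k = 0 := by omega
    exact hI

/-! ### The logarithmic cost measure -/

/-- The constants of the program have absolute value at most `2 ^ b`. -/
def Prog.ConstsLE (b : ℕ) : Prog → Prop
  | .const _ z => z.natAbs ≤ 2 ^ b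
  | .seq P Q => P.ConstsLE b ∧ Q.ConstsLE b
  | .ite _ P Q => P.ConstsLE b ∧ Q.ConstsLE b
  | .loop _ P => P.ConstsLE b
  | _ => True

theorem Prog.ConstsLE.mono {P : Prog} {b b' : ℕ} (h : P.ConstsLE b) (hb : b ≤ b') :
    P.ConstsLE b' := by
  induction P with
  | const => exact le_trans h (Nat.pow_le_pow_right two_pos hb)
  | seq _ _ ih ih' => exact ⟨ih h.1, ih' h.2⟩
  | ite _ _ _ ih ih' => exact ⟨ih h.1, ih' h.2⟩
  | loop _ _ ih => exact ih h
  | _ => trivial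

theorem Prog.exists_constsLE (P : Prog) : ∃ b, P.ConstsLE b := by
  induction P with
  | const _ z => exact ⟨z.natAbs, Nat.lt_two_pow_self.le⟩
  | seq _ _ ih ih' | ite _ _ _ ih ih' =>
    obtain ⟨b, hb⟩ := ih
    obtain ⟨b', hb'⟩ := ih'
    exact ⟨max b b', hb.mono (le_max_left _ _), hb'.mono (le_max_right _ _)⟩
  | loop _ _ ih => exact ih
  | _ => exact ⟨0, trivial⟩

/-- All the integers in the store have absolute value at most `2 ^ b`. -/
def Store.AbsLE (b : ℕ) (s : Store) : Prop :=
  (∀ x, (s.reg x).natAbs ≤ 2 ^ b) ∧ ∀ a i, (s.mem a i).natAbs ≤ 2 ^ b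

theorem Store.AbsLE.mono {s : Store} {b b' : ℕ} (h : s.AbsLE b) (hb : b ≤ b') : s.AbsLE b' :=
  have := Nat.pow_le_pow_right two_pos hb
  ⟨fun x => (h.1 x).trans this, fun a i => (h.2 a i).trans this⟩

theorem Store.AbsLE.setReg {s : Store} {b : ℕ} (h : s.AbsLE b) (x : ℕ) {z : ℤ}
    (hz : z.natAbs ≤ 2 ^ b) : (s.setReg x z).AbsLE b := by
  refine ⟨fun y => ?_, h.2⟩
  rw [Store.setReg_reg]
  split_ifs
  · exact hz
  · exact h.1 y

theorem Store.AbsLE.setMem {s : Store} {b : ℕ} (h : s.AbsLE b) (a : ℕ) (i : ℤ) {z : ℤ}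
    (hz : z.natAbs ≤ 2 ^ b) : (s.setMem a i z).AbsLE b := by
  refine ⟨h.1, fun a' j => ?_⟩
  rw [Store.setMem_mem]
  split_ifs
  · exact hz
  · exact h.2 _ _

theorem bitLen_le {z : ℤ} {b : ℕ} (h : z.natAbs ≤ 2 ^ b) : bitLen z ≤ b + 2 := by
  have : z.natAbs.size ≤ b + 1 := by
    rw [Nat.size_le, pow_succ]
    have := Nat.two_pow_pos b
    omega
  simpa [bitLen] using this

/-- Every instruction at most doubles the largest absolute value, because there is no
multiplication.  Hence the bit lengths grow by at most one per step, and the logarithmic cost is at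
most quadratic in the uniform cost. -/
theorem Exec.cost_le {P : Prog} {s s' : Store} {t c : ℕ} (h : Exec P s s' t c) {b : ℕ}
    (hP : P.ConstsLE b) (hs : s.AbsLE b) :
    s'.AbsLE (b + t) ∧ c ≤ t * (2 * (b + t + 2)) := by
  induction h generalizing b with
  | const s x z =>
    refine ⟨(hs.mono (by omega)).setReg x (le_trans hP (Nat.pow_le_pow_right two_pos (by omega))),
      ?_⟩
    have := bitLen_le hP
    omega
  | add s x y z =>
    have h₁ := hs.1 y
    have h₂ := hs.1 z
    refine ⟨(hs.mono (by omega)).setReg x ?_, ?_⟩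
    · rw [pow_succ]; omega
    · have := bitLen_le h₁
      have := bitLen_le h₂
      omega
  | sub s x y z =>
    have h₁ := hs.1 y
    have h₂ := hs.1 z
    refine ⟨(hs.mono (by omega)).setReg x ?_, ?_⟩
    · rw [pow_succ]; omega
    · have := bitLen_le h₁
      have := bitLen_le h₂
      omega
  | half s x y =>
    have h₁ := hs.1 y
    refine ⟨(hs.mono (by omega)).setReg x ?_, ?_⟩
    · rw [pow_succ]; have := Nat.two_pow_pos b; omega
    · have := bitLen_le h₁
      omega
  | load s x a y =>
    have h₁ := hs.1 y
    have h₂ := hs.2 a (s.reg y)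
    refine ⟨(hs.mono (by omega)).setReg x (h₂.trans (Nat.pow_le_pow_right two_pos (by omega))), ?_⟩
    have := bitLen_le h₁
    have := bitLen_le h₂
    omega
  | store s a y x =>
    have h₁ := hs.1 y
    have h₂ := hs.1 x
    refine ⟨(hs.mono (by omega)).setMem a _ (h₂.trans (Nat.pow_le_pow_right two_pos (by omega))), ?_⟩
    have := bitLen_le h₁
    have := bitLen_le h₂
    omega
  | seq P Q s₁ s₂ s₃ t t' c c' _ _ ih ih' =>
    obtain ⟨h₁, h₂⟩ := ih hP.1 hs
    obtain ⟨h₃, h₄⟩ := ih' (hP.2.mono (by omega)) h₁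
    refine ⟨by rwa [← add_assoc], ?_⟩
    have k₁ : t * (2 * (b + t + 2)) ≤ t * (2 * (b + (t + t') + 2)) :=
      Nat.mul_le_mul_left _ (by omega)
    rw [add_mul, ← add_assoc b]
    rw [← add_assoc b] at k₁
    omega
  | ite_pos x P Q s s' t c _ _ ih =>
    obtain ⟨h₁, h₂⟩ := ih hP.1 hs
    have h₃ := bitLen_le (hs.1 x)
    refine ⟨h₁.mono (by omega), ?_⟩
    have k₁ : t * (2 * (b + t + 2)) ≤ t * (2 * (b + (1 + t) + 2)) :=
      Nat.mul_le_mul_left _ (by omega)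
    rw [add_mul]
    omega
  | ite_nonpos x P Q s s' t c _ _ ih =>
    obtain ⟨h₁, h₂⟩ := ih hP.2 hs
    have h₃ := bitLen_le (hs.1 x)
    refine ⟨h₁.mono (by omega), ?_⟩
    have k₁ : t * (2 * (b + t + 2)) ≤ t * (2 * (b + (1 + t) + 2)) :=
      Nat.mul_le_mul_left _ (by omega)
    rw [add_mul]
    omega
  | loop_pos x P s₁ s₂ s₃ t t' c c' _ _ _ ih ih' =>
    obtain ⟨h₁, h₂⟩ := ih hP hs
    obtain ⟨h₃, h₄⟩ := ih' (Prog.ConstsLE.mono (P := .loop x P) hP (by omega)) h₁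
    have h₅ := bitLen_le (hs.1 x)
    refine ⟨h₃.mono (by omega), ?_⟩
    have k₁ : t * (2 * (b + t + 2)) ≤ t * (2 * (b + (1 + t + t') + 2)) :=
      Nat.mul_le_mul_left _ (by omega)
    have k₂ : t' * (2 * (b + t + t' + 2)) ≤ t' * (2 * (b + (1 + t + t') + 2)) :=
      Nat.mul_le_mul_left _ (by omega)
    rw [add_mul, add_mul]
    omega
  | loop_nonpos x P s _ =>
    have h₅ := bitLen_le (hs.1 x)
    exact ⟨hs.mono (by omega), by omega⟩

theorem natAbs_le_two_pow_bitLen (z : ℤ) : z.natAbs ≤ 2 ^ bitLen z := by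
  rw [bitLen, pow_succ]
  have := Nat.lt_size_self z.natAbs
  omega

theorem length_le_shapeBits {l : List Cell} (h : l.Nodup) : l.length ≤ shapeBits l.toFinset := by
  rw [← List.toFinset_card_of_nodup h, Finset.card_eq_sum_ones]
  exact Finset.sum_le_sum fun c _ => by simp only [bitLen]; omega

theorem bitLen_le_shapeBits {S : Shape} {c : Cell} (hc : c ∈ S) :
    bitLen c.1 ≤ shapeBits S ∧ bitLen c.2 ≤ shapeBits S := by
  have := Finset.single_le_sum (f := fun c : Cell => bitLen c.1 + bitLen c.2)
    (fun _ _ => Nat.zero_le _) hc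
  simp only [shapeBits] at this ⊢
  omega

theorem natAbs_listArray_le {l : List ℤ} {b : ℕ} (h : ∀ z ∈ l, z.natAbs ≤ 2 ^ b) (i : ℤ) :
    (listArray l i).natAbs ≤ 2 ^ b := by
  rw [listArray]
  split_ifs
  · simp
  · rcases lt_or_ge i.toNat l.length with hi | hi
    · rw [List.getD_eq_getElem _ _ hi]
      exact h _ (List.getElem_mem hi)
    · rw [List.getD_eq_default _ _ hi]
      simp

theorem absLE_inputStore {lA lB : List Cell} (hA : lA.Nodup) (hB : lB.Nodup) :
    (inputStore lA lB).AbsLE (shapeBits lA.toFinset + shapeBits lB.toFinset) := by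
  have hlt : ∀ {k m : ℕ}, k ≤ m → k ≤ 2 ^ m := fun h => h.trans Nat.lt_two_pow_self.le
  have hfst : ∀ (l : List Cell) (b : ℕ), shapeBits l.toFinset ≤ b →
      (∀ z ∈ l.map Prod.fst, z.natAbs ≤ 2 ^ b) ∧ ∀ z ∈ l.map Prod.snd, z.natAbs ≤ 2 ^ b := by
    intro l b hb
    constructor <;> intro z hz <;> rw [List.mem_map] at hz <;> obtain ⟨c, hc, rfl⟩ := hz <;>
      refine (natAbs_le_two_pow_bitLen _).trans (Nat.pow_le_pow_right two_pos ?_)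
    · exact (bitLen_le_shapeBits (List.mem_toFinset.2 hc)).1.trans hb
    · exact (bitLen_le_shapeBits (List.mem_toFinset.2 hc)).2.trans hb
  have kA := hfst lA _ (Nat.le_add_right _ (shapeBits lB.toFinset))
  have kB := hfst lB _ (Nat.le_add_left _ (shapeBits lA.toFinset))
  have nA := length_le_shapeBits hA
  have nB := length_le_shapeBits hB
  constructor
  · intro x
    simp only [inputStore]
    split_ifs
    · exact hlt (by simp; omega)
    · exact hlt (by simp; omega)
    · simp
  · intro a i
    simp only [inputStore]
    split_ifs
    · exact natAbs_listArray_le kA.1 i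
    · exact natAbs_listArray_le kA.2 i
    · exact natAbs_listArray_le kB.1 i
    · exact natAbs_listArray_le kB.2 i
    · simp

/-- Linear time under the uniform cost measure implies polynomial time under the logarithmic
cost measure. -/
theorem InLinearTime.inP {L : Set (Shape × Shape)} (h : InLinearTime L) : InP L := by
  obtain ⟨P, C, h⟩ := h
  obtain ⟨b, hb⟩ := P.exists_constsLE
  refine ⟨P, C * (2 * (b + 1 + C + 2)), 2, ?_⟩
  intro A B lA lB hA hB hlA hlB
  obtain ⟨s, t, c, e, hans, ht, -⟩ := h A B lA lB hA hB hlA hlB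
  refine ⟨s, t, c, e, hans, le_top, ?_⟩
  subst hlA hlB
  rw [Nat.cast_le] at ht ⊢
  have hc := (e.cost_le (hb.mono (Nat.le_add_right b
    (shapeBits lA.toFinset + shapeBits lB.toFinset)))
    ((absLE_inputStore hA hB).mono (Nat.le_add_left _ b))).2
  have nA := length_le_shapeBits hA
  have nB := length_le_shapeBits hB
  rw [← List.toFinset_card_of_nodup hA] at nA
  rw [← List.toFinset_card_of_nodup hB] at nB
  set N := shapeBits lA.toFinset + shapeBits lB.toFinset + 1 with hN
  have ht' : t ≤ C * N := ht.trans (Nat.mul_le_mul_left _ (by omega))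
  have hN1 : 1 ≤ N := by omega
  have hlin : b + (shapeBits lA.toFinset + shapeBits lB.toFinset) + t + 2 ≤ (b + 1 + C + 2) * N := by
    nlinarith [Nat.mul_le_mul_left b hN1]
  calc c ≤ t * (2 * (b + (shapeBits lA.toFinset + shapeBits lB.toFinset) + t + 2)) := hc
    _ ≤ (C * N) * (2 * ((b + 1 + C + 2) * N)) := by gcongr
    _ = C * (2 * (b + 1 + C + 2)) * N ^ 2 := by ring

/-! ### Numbering the cells and scanning the lists -/

infixr:60 " ;; " => Prog.seq

/-- An instruction without effect on the registers that are in use. -/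
def Prog.skip : Prog := .const 18 0

/-- The truth value, as 0 or 1, of `∃ j ∈ [m, n), p j`. -/
noncomputable def anyFlag (p : ℕ → Prop) (m n : ℕ) : ℤ :=
  open Classical in if ∃ j, m ≤ j ∧ j < n ∧ p j then 1 else 0

theorem anyFlag_self (p : ℕ → Prop) (n : ℕ) : anyFlag p n n = 0 :=
  if_neg fun ⟨_, h, h', _⟩ => absurd h' (not_lt.2 h)

theorem anyFlag_of_pos {p : ℕ → Prop} {m n : ℕ} (h : m < n) (hp : p m) : anyFlag p m n = 1 :=
  if_pos ⟨m, le_rfl, h, hp⟩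

theorem anyFlag_of_neg {p : ℕ → Prop} {m n : ℕ} (hp : ¬p m) :
    anyFlag p m n = anyFlag p (m + 1) n := by
  have : (∃ j, m ≤ j ∧ j < n ∧ p j) ↔ ∃ j, m + 1 ≤ j ∧ j < n ∧ p j := by
    constructor
    · rintro ⟨j, h, h', h''⟩
      exact ⟨j, Nat.succ_le_of_lt (lt_of_le_of_ne h fun e => hp (e ▸ h'')), h', h''⟩
    · rintro ⟨j, h, h', h''⟩
      exact ⟨j, by omega, h', h''⟩
  simp only [anyFlag]
  by_cases h : ∃ j, m ≤ j ∧ j < n ∧ p j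
  · rw [if_pos h, if_pos (this.1 h)]
  · rw [if_neg h, if_neg (mt this.2 h)]

theorem anyFlag_zero_eq_zero {p : ℕ → Prop} {n : ℕ} :
    anyFlag p 0 n = 0 ↔ ∀ j < n, ¬p j := by
  simp [anyFlag]

theorem anyFlag_zero_pos {p : ℕ → Prop} {n : ℕ} :
    0 < anyFlag p 0 n ↔ ∃ j < n, p j := by
  simp only [anyFlag, zero_le, true_and]
  split_ifs with h <;> simpa using h

/-- What all the passes rely on: the number `n` of nodes in register 0 and constants in the
registers 2, 3, 4, 16 and 19. -/
structure Ready (n : ℕ) (s : Store) : Prop where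
  r0 : s.reg 0 = n
  r2 : s.reg 2 = 1
  r3 : s.reg 3 = 4 * n + 5
  r4 : s.reg 4 = -(4 * n + 5)
  r16 : s.reg 16 = -1
  r19 : s.reg 19 = 0

theorem Ready.frame {n : ℕ} {s s' : Store} {P : Prog} (h : Ready n s) (hf : Frame P s s')
    (hP : ∀ x ∈ [0, 2, 3, 4, 16, 19], P.writesReg x = false) : Ready n s' := by
  constructor
  · rw [hf.reg _ (hP _ (by simp)), h.r0]
  · rw [hf.reg _ (hP _ (by simp)), h.r2]
  · rw [hf.reg _ (hP _ (by simp)), h.r3]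
  · rw [hf.reg _ (hP _ (by simp)), h.r4]
  · rw [hf.reg _ (hP _ (by simp)), h.r16]
  · rw [hf.reg _ (hP _ (by simp)), h.r19]

/-- Load the constants. -/
def setup : Prog :=
  .const 2 1 ;; .const 16 (-1) ;; .const 19 0 ;; .add 3 0 0 ;; .add 3 3 3 ;; .const 4 5 ;;
    .add 3 3 4 ;; .sub 4 19 3

theorem runs_setup {n N : ℕ} {s : Store} (h : s.reg 0 = n) : Runs setup 8 N s (Ready n) := by
  refine runs_straight (P := setup) rfl ?_
  constructor <;> simp [setup, Prog.eval, h] <;> ring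

/-- The offset of a row in the numbering of the cells: positive exactly for `|z| ≤ n`, and 0, the
initial content of the arrays, otherwise. -/
def rowOffset (n : ℕ) (z : ℤ) : ℤ := if -n ≤ z ∧ z ≤ n then (z + n + 1) * (4 * n + 5) else 0

theorem rowOffset_pos {n : ℕ} {z : ℤ} : 0 < rowOffset n z ↔ -n ≤ z ∧ z ≤ n := by
  rw [rowOffset]
  split_ifs with h
  · simp only [h, and_self, iff_true]
    apply mul_pos <;> omega
  · simp [h]

/-- Tabulate the row offsets in array 4, because the machine cannot multiply. -/
def tablePass : Prog :=
  .add 15 0 0 ;; .add 15 15 2 ;; .sub 6 19 0 ;; .sub 6 6 2 ;; .const 7 0 ;;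
    .countdown 15 (.add 6 6 2 ;; .add 7 7 3 ;; .store 4 6 7)

theorem runs_tablePass {n : ℕ} {s : Store} (h : Ready n s) (h4 : ∀ z, s.mem 4 z = 0) :
    Runs tablePass 11 (2 * n + 1) s (fun s' => ∀ z, s'.mem 4 z = rowOffset n z) := by
  refine Runs.mono (C := 1 + (1 + (1 + (1 + (1 + 6))))) ?_ le_rfl (fun _ _ h => h)
  iterate 5 refine Runs.seq (runs_straight rfl rfl) ?_; rintro _ - rfl
  refine Runs.mono (runs_countdown (m := 2 * n + 1)
    (I := fun k s' => s'.reg 6 = n - k ∧ s'.reg 7 = (2 * n + 1 - k) * (4 * n + 5) ∧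
      ∀ z, s'.mem 4 z = if -n ≤ z ∧ z ≤ n - k then (z + n + 1) * (4 * n + 5) else 0)
    ?_ ?_ ?_ rfl rfl rfl le_rfl ?_ ?_) le_rfl ?_
  · simp [Prog.eval, h.r0, h.r2]; ring
  · simp [Prog.eval, h.r2]
  · simp [Prog.eval, h.r19]
  · simp [Prog.eval, h.r0, h.r2, h.r19, h4]
    refine ⟨by ring, fun z h₁ h₂ => by omega⟩
  · rintro k hk s' hf h5 ⟨h6, h7, hT⟩
    have f2 := hf.reg 2 rfl
    have f3 := hf.reg 3 rfl
    simp [Prog.eval, h.r2, h.r3] at f2 f3 h6 h7 hT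
    simp [Prog.eval, f2, f3, h6, h7, hT]
    refine ⟨by ring, by ring, fun z => ?_⟩
    rcases lt_trichotomy z (n - k) with hz | hz | hz
    · rw [if_neg (by omega)]
      exact if_congr (by omega) rfl rfl
    · rw [if_pos (by omega), if_pos (by omega), hz]
      ring
    · rw [if_neg (by omega), if_neg (by omega), if_neg (by omega)]
  · rintro s' - ⟨-, -, hT⟩ z
    rw [hT]
    simp [rowOffset]

/-- Write 1 into register 10 unless the registers 8 and 9 are positive. -/
def checkRange : Prog := .ite 8 (.ite 9 .skip (.const 10 1)) (.const 10 1)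

theorem checkRange_eval (s : Store) : checkRange.eval s =
    (s.setReg 10 (if 0 < s.reg 8 ∧ 0 < s.reg 9 then s.reg 10 else 1)).setReg 18
      (if 0 < s.reg 8 ∧ 0 < s.reg 9 then 0 else s.reg 18) := by
  have ext : ∀ {s s' : Store}, s.reg = s'.reg → s.mem = s'.mem → s = s' := by
    rintro ⟨_, _⟩ ⟨_, _⟩ rfl rfl; rfl
  refine ext (funext fun x => ?_) ?_
  · by_cases h₁ : 0 < s.reg 8 <;> by_cases h₂ : 0 < s.reg 9 <;>
      by_cases h₃ : x = 18 <;> by_cases h₄ : x = 10 <;>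
      simp [checkRange, Prog.eval, Prog.skip, *]
  · by_cases h₁ : 0 < s.reg 8 <;> by_cases h₂ : 0 < s.reg 9 <;>
      simp [checkRange, Prog.eval, Prog.skip, *]

/-- Number the cells listed in the arrays `R` and `C`, relative to the cell in the registers 13 and
14.  The arrays `a₀, …, a₃` receive the numbers of the cells after 0 to 3 inverse quarter turns,
up to constants, and register 10 tells whether some cell is too far away. -/
def keyPass (R C a₀ a₁ a₂ a₃ : ℕ) : Prog :=
  .const 10 0 ;; .countdown 0
    (.load 6 R 5 ;; .sub 6 6 13 ;; .load 7 C 5 ;; .sub 7 7 14 ;; .load 8 4 6 ;; .load 9 4 7 ;;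
      checkRange ;;
      .add 8 8 7 ;; .sub 9 9 6 ;; .store a₀ 5 8 ;; .store a₁ 5 9 ;;
      .sub 8 19 8 ;; .sub 9 19 9 ;; .store a₂ 5 8 ;; .store a₃ 5 9)

theorem runs_keyPass {R C a₀ a₁ a₂ a₃ n N : ℕ} {s : Store} {r c : ℕ → ℤ} {o₁ o₂ : ℤ} (hN : n ≤ N)
    (hd : [R, C, 4, a₀, a₁, a₂, a₃].Nodup) (h : Ready n s)
    (h4 : ∀ z, s.mem 4 z = rowOffset n z) (hR : ∀ i < n, s.mem R i = r i)
    (hC : ∀ i < n, s.mem C i = c i) (h13 : s.reg 13 = o₁) (h14 : s.reg 14 = o₂) :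
    Runs (keyPass R C a₀ a₁ a₂ a₃) 30 N s (fun s' =>
      s'.reg 10 = anyFlag (fun i => ¬(0 < rowOffset n (r i - o₁) ∧ 0 < rowOffset n (c i - o₂))) 0 n ∧
      ∀ i < n, s'.mem a₀ i = rowOffset n (r i - o₁) + (c i - o₂) ∧
        s'.mem a₁ i = rowOffset n (c i - o₂) - (r i - o₁) ∧
        s'.mem a₂ i = -(rowOffset n (r i - o₁) + (c i - o₂)) ∧
        s'.mem a₃ i = -(rowOffset n (c i - o₂) - (r i - o₁))) := by
  simp only [List.nodup_cons, List.mem_cons, List.not_mem_nil, not_or, or_false, not_false_eq_true,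
    List.nodup_nil, and_true] at hd
  obtain ⟨⟨-, -, d₁, d₂, d₃, d₄⟩, ⟨-, d₅, d₆, d₇, d₈⟩, ⟨e₁, e₂, e₃, e₄⟩, ⟨e₅, e₆, e₇⟩, ⟨e₈, e₉⟩,
    e₁₀⟩ := hd
  refine Runs.mono (C := 1 + 29) (Runs.seq (runs_straight rfl rfl)
    (?_ : ∀ s', _ → _ → Runs _ _ _ _ _)) (by norm_num) (fun _ _ h => h)
  rintro _ - rfl
  refine Runs.mono (runs_countdown (m := n) (I := fun m s' =>
      s'.reg 10 = anyFlag (fun i => ¬(0 < rowOffset n (r i - o₁) ∧ 0 < rowOffset n (c i - o₂))) m n ∧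
      ∀ i : ℕ, m ≤ i → i < n → s'.mem a₀ i = rowOffset n (r i - o₁) + (c i - o₂) ∧
        s'.mem a₁ i = rowOffset n (c i - o₂) - (r i - o₁) ∧
        s'.mem a₂ i = -(rowOffset n (r i - o₁) + (c i - o₂)) ∧
        s'.mem a₃ i = -(rowOffset n (c i - o₂) - (r i - o₁)))
    ?_ ?_ ?_ rfl rfl rfl hN ?_ ?_) (by simp [Prog.size, Prog.skip, checkRange]) ?_
  · simp [Prog.eval, h.r0]
  · simp [Prog.eval, h.r2]
  · simp [Prog.eval, h.r19]
  · simp [Prog.eval, anyFlag_self]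
    intro i hi hi'
    omega
  · rintro k hk s' hf h5 ⟨h10, ha⟩
    have f13 := hf.reg 13 rfl
    have f14 := hf.reg 14 rfl
    have f19 := hf.reg 19 rfl
    have fR := hf.mem R
      (by simp [Prog.countdown, Prog.writesMem, Prog.skip, checkRange, d₁, d₂, d₃, d₄])
    have fC := hf.mem C
      (by simp [Prog.countdown, Prog.writesMem, Prog.skip, checkRange, d₅, d₆, d₇, d₈])
    have f4 := hf.mem 4
      (by simp [Prog.countdown, Prog.writesMem, Prog.skip, checkRange, e₁, e₂, e₃, e₄])
    have hkR := hR k hk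
    have hkC := hC k hk
    simp [Prog.eval, h13, h14, h.r19] at f13 f14 f19 fR fC f4 h10 ha
    constructor
    · simp [Prog.eval, checkRange_eval, f13, f14, fR, fC, f4, h5, hkR, hkC, h4, h10]
      split_ifs with g
      · rw [anyFlag_of_neg (m := k) (by simpa using g)]
      · rw [anyFlag_of_pos hk (by simpa using g)]
    · intro i hi hin
      rcases eq_or_ne i k with rfl | hik
      · simp [Prog.eval, checkRange_eval, f13, f14, f19, fR, fC, f4, h5, hkR, hkC, h4, e₅, e₆, e₇,
          e₈, e₉, e₁₀]
      · have := ha i (lt_of_le_of_ne hi hik.symm) hin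
        simpa [Prog.eval, checkRange_eval, h5, hik] using this
  · rintro s' - ⟨h₁, h₂⟩
    exact ⟨h₁, fun i hi => h₂ i i.zero_le hi⟩

/-- Mark the numbers listed in the array `K` by 1 in the arrays `G` and `U`. -/
def markPass (K G U : ℕ) : Prog := .countdown 0 (.load 6 K 5 ;; .store G 6 2 ;; .store U 6 2)

theorem runs_markPass {K G U n N : ℕ} {s : Store} {ks : ℕ → ℤ} (hN : n ≤ N)
    (hd : [K, G, U].Nodup) (h : Ready n s) (hK : ∀ i < n, s.mem K i = ks i)
    (hG : ∀ z, s.mem G z = 0) (hU : ∀ z, s.mem U z = 0) :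
    Runs (markPass K G U) 6 N s (fun s' => ∀ z,
      s'.mem G z = anyFlag (fun i => ks i = z) 0 n ∧
      s'.mem U z = anyFlag (fun i => ks i = z) 0 n) := by
  simp only [List.nodup_cons, List.mem_cons, List.not_mem_nil, not_or, or_false, not_false_eq_true,
    List.nodup_nil, and_true] at hd
  obtain ⟨⟨d₁, d₂⟩, d₃⟩ := hd
  refine runs_countdown (I := fun m s' => ∀ z,
      s'.mem G z = anyFlag (fun i => ks i = z) m n ∧
      s'.mem U z = anyFlag (fun i => ks i = z) m n) h.r0 h.r2 h.r19 rfl rfl rfl hN ?_ ?_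
  · simp [hG, hU, anyFlag_self]
  · intro k hk s' hf h5 hI z
    have f2 := hf.reg 2 rfl
    have fK := hf.mem K (by simp [Prog.countdown, Prog.writesMem, d₁, d₂])
    have hkk := hK k hk
    simp only [Store.setReg_mem] at hI
    obtain ⟨hI₁, hI₂⟩ := hI z
    simp [Prog.eval, f2, fK, h5, hkk, h.r2, d₃, Ne.symm d₃, hI₁, hI₂]
    rcases eq_or_ne z (ks k) with rfl | hz
    · simp [anyFlag_of_pos hk]
    · simp [hz, anyFlag_of_neg (p := fun i => ks i = z) (Ne.symm hz)]

/-- Count the red cells listed in the arrays `R` and `C`, in register 10.  The parity of a number is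
obtained by subtracting its half twice. -/
def redsPass (R C : ℕ) : Prog :=
  .const 10 0 ;; .countdown 0
    (.load 6 R 5 ;; .load 7 C 5 ;; .add 6 6 7 ;; .half 7 6 ;; .sub 6 6 7 ;; .sub 6 6 7 ;;
      .add 10 10 6)

theorem runs_redsPass {R C n N : ℕ} {s : Store} {r c : ℕ → ℤ} (hN : n ≤ N) (h : Ready n s)
    (hR : ∀ i < n, s.mem R i = r i) (hC : ∀ i < n, s.mem C i = c i) :
    Runs (redsPass R C) 11 N s (fun s' => s'.reg 10 = ∑ i ∈ Finset.range n, (r i + c i) % 2) := by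
  refine Runs.mono (C := 1 + 10) (Runs.seq (runs_straight rfl rfl)
    (?_ : ∀ s', _ → _ → Runs _ _ _ _ _)) (by norm_num) (fun _ _ h => h)
  rintro _ - rfl
  refine Runs.mono (runs_countdown (m := n)
    (I := fun m s' => s'.reg 10 = ∑ i ∈ Finset.Ico m n, (r i + c i) % 2)
    ?_ ?_ ?_ rfl rfl rfl hN ?_ ?_) le_rfl ?_
  · simp [Prog.eval, h.r0]
  · simp [Prog.eval, h.r2]
  · simp [Prog.eval, h.r19]
  · simp [Prog.eval]
  · intro k hk s' hf h5 hI
    have fR := hf.mem R rfl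
    have fC := hf.mem C rfl
    have hkR := hR k hk
    have hkC := hC k hk
    simp [Prog.eval] at fR fC hI
    simp [Prog.eval, fR, fC, h5, hkR, hkC, hI]
    rw [Finset.sum_eq_sum_Ico_succ_bot hk]
    omega
  · intro s' _ h
    simpa using h

/-- Test for the pair of cells `x`, `x + reg e` whether the two cells at distance `reg d` on one
side of it are empty, where register 6 contains `x`. -/
def sideTest (G e d : ℕ) : Prog :=
  .add 7 6 e ;; .load 8 G 7 ;; .add 7 7 d ;; .load 9 G 7 ;; .sub 8 8 9 ;; .add 7 6 d ;;
    .load 9 G 7 ;; .sub 8 8 9 ;; .ite 8 (.const 10 1) .skip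

/-- Look for an available rotation movement, among the cells marked in `G` and listed in `K`: a pair
of neighbouring cells `x`, `x + e` with two empty cells on one side `d`.  By symmetry only the pairs
with `e = 1` and with `e = 4 n + 5` need to be tested. -/
def rotPass (K G : ℕ) : Prog :=
  .const 10 0 ;; .countdown 0
    (.load 6 K 5 ;; sideTest G 2 3 ;; sideTest G 2 4 ;; sideTest G 3 2 ;; sideTest G 3 16)

/-- The condition of `sideTest`, where `g` is the indicator function of a set of integers: the
number `x + e` is in the set, `x + d` and `x + e + d` are not. -/
def SideFree (g : ℤ → ℤ) (x e d : ℤ) : Prop := g (x + d) < g (x + e) - g (x + e + d)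

theorem sideTest_eval {G e d : ℕ} (he : e < 6) (hd : d < 6 ∨ 10 < d ∧ d < 18) (s : Store) :
    ((sideTest G e d).eval s).mem = s.mem ∧
    (∀ x, x < 7 ∨ 10 < x ∧ x < 18 → ((sideTest G e d).eval s).reg x = s.reg x) ∧
    (SideFree (s.mem G) (s.reg 6) (s.reg e) (s.reg d) →
      ((sideTest G e d).eval s).reg 10 = 1) ∧
    (¬SideFree (s.mem G) (s.reg 6) (s.reg e) (s.reg d) →
      ((sideTest G e d).eval s).reg 10 = s.reg 10) := by
  refine ⟨?_, fun x hx => ?_, fun h => ?_, fun h => ?_⟩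
  · funext a
    exact (frame_eval rfl s).mem a rfl
  · refine (frame_eval rfl s).reg x ?_
    simp [sideTest, Prog.writesReg, Prog.skip]
    omega
  · have e7 : e ≠ 7 := by omega
    have e8 : e ≠ 8 := by omega
    have d7 : d ≠ 7 := by omega
    have d8 : d ≠ 8 := by omega
    have d9 : d ≠ 9 := by omega
    simp only [SideFree] at h
    simp [sideTest, Prog.eval, d7, d8, d9, h]
  · have e7 : e ≠ 7 := by omega
    have e8 : e ≠ 8 := by omega
    have d7 : d ≠ 7 := by omega
    have d8 : d ≠ 8 := by omega
    have d9 : d ≠ 9 := by omega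
    simp only [SideFree] at h
    simp [sideTest, Prog.eval, d7, d8, d9, h, Prog.skip]

theorem runs_rotPass {K G n N : ℕ} {s : Store} {ks : ℕ → ℤ} {g : ℤ → ℤ} {W : ℤ}
    (hW : W = 4 * n + 5) (hN : n ≤ N)
    (h : Ready n s) (hK : ∀ i < n, s.mem K i = ks i) (hG : ∀ z, s.mem G z = g z) :
    Runs (rotPass K G) 60 N s (fun s' => s'.reg 10 = anyFlag (fun i =>
      SideFree g (ks i) 1 W ∨ SideFree g (ks i) 1 (-W) ∨
        SideFree g (ks i) W 1 ∨ SideFree g (ks i) W (-1)) 0 n) := by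
  refine Runs.mono (C := 1 + 59) (Runs.seq (runs_straight rfl rfl)
    (?_ : ∀ s', _ → _ → Runs _ _ _ _ _)) (by norm_num) (fun _ _ h => h)
  rintro _ - rfl
  refine Runs.mono (runs_countdown (m := n)
    (I := fun m s' => s'.reg 10 = anyFlag (fun i =>
      SideFree g (ks i) 1 W ∨ SideFree g (ks i) 1 (-W) ∨
        SideFree g (ks i) W 1 ∨ SideFree g (ks i) W (-1)) m n)
    ?_ ?_ ?_ rfl rfl rfl hN ?_ ?_) (by simp [Prog.size, Prog.skip, sideTest]) (fun _ _ h => h)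
  · simp [Prog.eval, h.r0]
  · simp [Prog.eval, h.r2]
  · simp [Prog.eval, h.r19]
  · simp [Prog.eval, anyFlag_self]
  · rintro k hk s' hf h5 hI
    have fK := hf.mem K rfl
    have fG := hf.mem G rfl
    have f2 := hf.reg 2 rfl
    have f3 := hf.reg 3 rfl
    have f4 := hf.reg 4 rfl
    have f16 := hf.reg 16 rfl
    have hkK := hK k hk
    have hG' : s.mem G = g := funext hG
    simp [Prog.eval, h.r2, h.r3, h.r4, h.r16, ← hW] at fK fG f2 f3 f4 f16 hI
    set s₁ := (Prog.load 6 K 5).eval s' with hs₁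
    have r₁ : s₁.reg 6 = ks k ∧ s₁.reg 2 = 1 ∧ s₁.reg 3 = W ∧ s₁.reg 4 = -W ∧ s₁.reg 16 = -1 ∧
        s₁.mem G = g ∧ s₁.reg 10 = s'.reg 10 := by
      simp [hs₁, Prog.eval, f2, f3, f4, f16, fK, fG, hG', h5, hkK]
    set s₂ := (sideTest G 2 3).eval s₁ with hs₂
    set s₃ := (sideTest G 2 4).eval s₂ with hs₃
    set s₄ := (sideTest G 3 2).eval s₃ with hs₄
    set s₅ := (sideTest G 3 16).eval s₄ with hs₅
    change s₅.reg 10 = _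
    obtain ⟨m₂, a₂, p₂, n₂⟩ := sideTest_eval (G := G) (e := 2) (d := 3)
      (by norm_num) (by norm_num) s₁
    obtain ⟨m₃, a₃, p₃, n₃⟩ := sideTest_eval (G := G) (e := 2) (d := 4)
      (by norm_num) (by norm_num) s₂
    obtain ⟨m₄, a₄, p₄, n₄⟩ := sideTest_eval (G := G) (e := 3) (d := 2)
      (by norm_num) (by norm_num) s₃
    obtain ⟨m₅, a₅, p₅, n₅⟩ := sideTest_eval (G := G) (e := 3) (d := 16)
      (by norm_num) (by norm_num) s₄
    rw [← hs₂] at m₂ a₂ p₂ n₂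
    rw [← hs₃] at m₃ a₃ p₃ n₃
    rw [← hs₄] at m₄ a₄ p₄ n₄
    rw [← hs₅] at m₅ a₅ p₅ n₅
    clear_value s₁ s₂ s₃ s₄ s₅
    obtain ⟨x6, x2, x3, x4, x16, xG, x10⟩ := r₁
    simp [m₂, m₃, m₄, a₂, a₃, a₄, x6, x2, x3, x4, x16, xG] at p₂ p₃ p₄ p₅ n₂ n₃ n₄ n₅
    by_cases c₅ : SideFree g (ks k) W (-1)
    · rw [p₅ c₅, anyFlag_of_pos hk (by simp [c₅])]
    rw [n₅ c₅]
    by_cases c₄ : SideFree g (ks k) W 1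
    · rw [p₄ c₄, anyFlag_of_pos hk (by simp [c₄])]
    rw [n₄ c₄]
    by_cases c₃ : SideFree g (ks k) 1 (-W)
    · rw [p₃ c₃, anyFlag_of_pos hk (by simp [c₃])]
    rw [n₃ c₃]
    by_cases c₂ : SideFree g (ks k) 1 W
    · rw [p₂ c₂, anyFlag_of_pos hk (by simp [c₂])]
    rw [n₂ c₂, anyFlag_of_neg (m := k) (by simp [c₂, c₃, c₄, c₅]), x10, hI]

/-- The minimum, in register 10, of the numbers listed in the array `K`. -/
def minPass (K : ℕ) : Prog :=
  .load 10 K 19 ;; .countdown 0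
    (.load 6 K 5 ;; .sub 7 10 6 ;; .ite 7 (.add 10 6 19) .skip)

theorem runs_minPass {K n N : ℕ} {s : Store} {ks : ℕ → ℤ} (hN : n ≤ N) (hn : 0 < n) (h : Ready n s)
    (hK : ∀ i < n, s.mem K i = ks i) :
    Runs (minPass K) 10 N s (fun s' => (∃ i < n, s'.reg 10 = ks i) ∧ ∀ i < n, s'.reg 10 ≤ ks i) := by
  refine Runs.mono (C := 1 + 8) (Runs.seq (runs_straight rfl rfl)
    (?_ : ∀ s', _ → _ → Runs _ _ _ _ _)) (by norm_num) (fun _ _ h => h)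
  rintro _ - rfl
  refine Runs.mono (runs_countdown (m := n)
    (I := fun m s' => (∃ i < n, s'.reg 10 = ks i) ∧ ∀ i : ℕ, m ≤ i → i < n → s'.reg 10 ≤ ks i)
    ?_ ?_ ?_ rfl rfl rfl hN ?_ ?_) (by simp [Prog.size, Prog.skip]) ?_
  · simp [Prog.eval, h.r0]
  · simp [Prog.eval, h.r2]
  · simp [Prog.eval, h.r19]
  · simp [Prog.eval, h.r19]
    exact ⟨⟨0, hn, by simpa using hK 0 hn⟩, fun i h₁ h₂ => by omega⟩
  · rintro k hk s' hf h5 hI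
    have fK := hf.mem K rfl
    have hkK := hK k hk
    simp [Prog.eval, h.r19] at fK hI
    obtain ⟨⟨i, hi, hi'⟩, hI⟩ := hI
    by_cases hlt : ks k < s'.reg 10
    · have f19 := hf.reg 19 rfl
      simp [Prog.eval, h.r19] at f19
      simp [Prog.eval, fK, f19, h5, hkK, hlt]
      refine ⟨⟨k, hk, rfl⟩, fun j hj hjn => ?_⟩
      rcases eq_or_lt_of_le hj with rfl | hj
      · exact le_rfl
      · exact hlt.le.trans (hI j hj hjn)
    · simp [Prog.eval, fK, h5, hkK, hlt, Prog.skip]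
      refine ⟨⟨i, hi, hi'⟩, fun j hj hjn => ?_⟩
      rcases eq_or_lt_of_le hj with rfl | hj
      · exact not_lt.1 hlt
      · exact hI j hj hjn
  · rintro s' - ⟨h₁, h₂⟩
    exact ⟨h₁, fun i => h₂ i i.zero_le⟩

/-- Test whether some number in the array `K`, shifted by the content of register 11, is not
marked in the array `G`. -/
def subsetPass (K G : ℕ) : Prog :=
  .const 10 0 ;; .countdown 0
    (.load 6 K 5 ;; .add 6 6 11 ;; .load 7 G 6 ;; .ite 7 .skip (.const 10 1))

theorem runs_subsetPass {K G n N : ℕ} {s : Store} {ks : ℕ → ℤ} {g : ℤ → ℤ} {d : ℤ} (hN : n ≤ N)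
    (h : Ready n s) (hK : ∀ i < n, s.mem K i = ks i) (hG : ∀ z, s.mem G z = g z)
    (h11 : s.reg 11 = d) :
    Runs (subsetPass K G) 11 N s
      (fun s' => s'.reg 10 = anyFlag (fun i => ¬ 0 < g (ks i + d)) 0 n) := by
  refine Runs.mono (C := 1 + 9) (Runs.seq (runs_straight rfl rfl)
    (?_ : ∀ s', _ → _ → Runs _ _ _ _ _)) (by norm_num) (fun _ _ h => h)
  rintro _ - rfl
  refine Runs.mono (runs_countdown (m := n)
    (I := fun m s' => s'.reg 10 = anyFlag (fun i => ¬ 0 < g (ks i + d)) m n)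
    ?_ ?_ ?_ rfl rfl rfl hN ?_ ?_) (by simp [Prog.size, Prog.skip]) (fun _ _ h => h)
  · simp [Prog.eval, h.r0]
  · simp [Prog.eval, h.r2]
  · simp [Prog.eval, h.r19]
  · simp [Prog.eval, anyFlag_self]
  · rintro k hk s' hf h5 hI
    have fK := hf.mem K rfl
    have fG := hf.mem G rfl
    have f11 := hf.reg 11 rfl
    have hkK := hK k hk
    simp [Prog.eval, h11] at fK fG f11 hI
    by_cases hg : 0 < g (ks k + d)
    · simp [Prog.eval, fK, fG, f11, h5, hkK, hG, hg, Prog.skip, hI]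
      rw [anyFlag_of_neg (m := k) (by simpa using hg)]
    · simp [Prog.eval, fK, fG, f11, h5, hkK, hG, hg]
      rw [anyFlag_of_pos hk (by simpa using hg)]

/-! ### Breadth-first search -/

/-- The numbers `a` and `b` are those of neighbouring cells, where `W` is the difference between
consecutive rows. -/
def KeyAdj (W a b : ℤ) : Prop := b = a + 1 ∨ b = a + -1 ∨ b = a + W ∨ b = a + -W

/-- The number `y` can be reached from `x` through `K`. -/
def KeyReach (W : ℤ) (K : Set ℤ) (x y : ℤ) : Prop :=
  Relation.ReflTransGen (fun a b => b ∈ K ∧ KeyAdj W a b) x y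

/-- Append the number `reg 6 + reg d` to the queue `Q` if it is marked in `U`, and unmark it. -/
def visitKey (U Q d : ℕ) : Prog :=
  .add 7 6 d ;; .load 8 U 7 ;; .ite 8 (.store U 7 19 ;; .store Q 12 7 ;; .add 12 12 2) .skip

/-- The body of the search: take a number from the queue and visit its neighbours. -/
def bfsStep (U Q : ℕ) : Prog :=
  .load 6 Q 11 ;; .add 11 11 2 ;; visitKey U Q 2 ;; visitKey U Q 16 ;; visitKey U Q 3 ;;
    visitKey U Q 4 ;; .sub 10 12 11

/-- Breadth-first search from the first number in the array `K`, among the numbers that are marked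
in `U`; the marks of the numbers found are removed.  The queue is the array `Q`; register 11 points
to its front and register 12 to its end. -/
def bfsPass (K U Q : ℕ) : Prog :=
  .load 6 K 19 ;; .store U 6 19 ;; .store Q 19 6 ;; .const 11 0 ;; .const 12 1 ;; .sub 10 12 11 ;;
    .loop 10 (bfsStep U Q)

/-- The list `D` of the numbers found so far is in the queue, and these numbers are unmarked. -/
structure BfsInv (W : ℤ) (K : Set ℤ) (x₀ : ℤ) (U Q : ℕ) (D : List ℤ) (s : Store) : Prop where
  nodup : D.Nodup
  sub : ∀ y ∈ D, y ∈ K ∧ KeyReach W K x₀ y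
  r12 : s.reg 12 = D.length
  queue : ∀ (i : ℕ) (h : i < D.length), s.mem Q i = D[i]
  marks : ∀ y, 0 < s.mem U y ↔ y ∈ K ∧ y ∉ D

/-- The queue can only grow, and it contains the number `x + δ` after the visit if that is a number
in `K` at all. -/
theorem BfsInv.visit {W : ℤ} {K : Set ℤ} {x₀ : ℤ} {U Q d : ℕ} {D : List ℤ} {s : Store} {x δ : ℤ}
    (h : BfsInv W K x₀ U Q D s) (hUQ : U ≠ Q) (h2 : s.reg 2 = 1) (h19 : s.reg 19 = 0)
    (h6 : s.reg 6 = x) (hx : x ∈ D) (hδ : s.reg d = δ) (hadj : KeyAdj W x (x + δ)) :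
    ∃ D', BfsInv W K x₀ U Q (D ++ D') ((visitKey U Q d).eval s) ∧
      (x + δ ∈ K → x + δ ∈ D ++ D') := by
  by_cases hm : 0 < s.mem U (x + δ)
  · refine ⟨[x + δ], ?_, by simp⟩
    have hmem := (h.marks _).1 hm
    have ev : (visitKey U Q d).eval s = ((((s.setReg 7 (x + δ)).setReg 8 (s.mem U (x + δ))).setMem U
        (x + δ) 0).setMem Q D.length (x + δ)).setReg 12 (D.length + 1) := by
      simp [visitKey, Prog.eval, h6, hδ, hm, h19, h2, h.r12]
    rw [ev]
    constructor
    · rw [List.nodup_append]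
      simp [h.nodup]
      rintro y hy rfl
      exact hmem.2 hy
    · intro y hy
      rw [List.mem_append, List.mem_singleton] at hy
      rcases hy with hy | rfl
      · exact h.sub y hy
      · exact ⟨hmem.1, (h.sub x hx).2.tail ⟨hmem.1, hadj⟩⟩
    · simp
    · intro i hi
      simp at hi
      rcases eq_or_ne i D.length with rfl | hne
      · simp
      · have hi' : i < D.length := by omega
        simp [hne, hUQ.symm, List.getElem_append_left hi', h.queue i hi']
    · intro y
      rcases eq_or_ne y (x + δ) with rfl | hne
      · simp [hUQ]
      · simp [hUQ, hne, h.marks]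
  · refine ⟨[], ?_, ?_⟩
    · have ev : (visitKey U Q d).eval s =
          ((s.setReg 7 (x + δ)).setReg 8 (s.mem U (x + δ))).setReg 18 0 := by
        simp [visitKey, Prog.eval, h6, hδ, hm, Prog.skip]
      rw [ev, List.append_nil]
      exact ⟨h.nodup, h.sub, by simpa using h.r12, by simpa using h.queue, by simpa using h.marks⟩
    · intro hK
      by_contra hD
      exact hm ((h.marks _).2 ⟨hK, by simpa using hD⟩)

/-- After one step of the search the queue contains all the neighbours in `K` of the number that was
at its front. -/
theorem BfsInv.step {W : ℤ} {K : Set ℤ} {x₀ : ℤ} {U Q k : ℕ} {D : List ℤ} {s' : Store}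
    (hD : BfsInv W K x₀ U Q D s') (hUQ : U ≠ Q) (h11 : s'.reg 11 = k) (hkD : k < D.length)
    (g2 : s'.reg 2 = 1) (g19 : s'.reg 19 = 0) (g3 : s'.reg 3 = W) (g4 : s'.reg 4 = -W)
    (g16 : s'.reg 16 = -1) :
    ∃ D', BfsInv W K x₀ U Q (D ++ D') ((bfsStep U Q).eval s') ∧
      ((bfsStep U Q).eval s').reg 11 = k + 1 ∧
      ((bfsStep U Q).eval s').reg 10 = (D ++ D').length - (k + 1 : ℤ) ∧
      ∀ y ∈ K, KeyAdj W D[k] y → y ∈ D ++ D' := by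
  set s₁ := (Prog.add 11 11 2).eval ((Prog.load 6 Q 11).eval s') with hs₁
  have hD₁ : BfsInv W K x₀ U Q D s₁ :=
    ⟨hD.nodup, hD.sub, by simpa [hs₁, Prog.eval] using hD.r12,
      by simpa [hs₁, Prog.eval] using hD.queue, by simpa [hs₁, Prog.eval] using hD.marks⟩
  have r6 : s₁.reg 6 = D[k] := by simp [hs₁, Prog.eval, h11, hD.queue k hkD]
  have r11 : s₁.reg 11 = k + 1 := by simp [hs₁, Prog.eval, h11, g2]
  have r2 : s₁.reg 2 = 1 := by simp [hs₁, Prog.eval, g2]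
  have r19 : s₁.reg 19 = 0 := by simp [hs₁, Prog.eval, g19]
  have r3 : s₁.reg 3 = W := by simp [hs₁, Prog.eval, g3]
  have r4 : s₁.reg 4 = -W := by simp [hs₁, Prog.eval, g4]
  have r16 : s₁.reg 16 = -1 := by simp [hs₁, Prog.eval, g16]
  have hx : D[k] ∈ D := List.getElem_mem hkD
  have fr : ∀ (d : ℕ) (s : Store) (x : ℕ), x ∈ [2, 3, 4, 6, 11, 16, 19] →
      ((visitKey U Q d).eval s).reg x = s.reg x := by
    intro d s x hx
    refine (frame_eval rfl s).reg x ?_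
    simp [visitKey, Prog.writesReg, Prog.skip]
    simp at hx
    omega
  obtain ⟨D₁, hD₂, c₁⟩ := hD₁.visit (d := 2) hUQ r2 r19 r6 hx r2 (Or.inl rfl)
  set s₂ := (visitKey U Q 2).eval s₁ with hs₂
  have fr₂ := fr 2 s₁
  rw [← hs₂] at fr₂
  obtain ⟨D₂, hD₃, c₂⟩ := hD₂.visit (d := 16) (x := D[k]) (δ := -1) hUQ
    (by rw [fr₂ _ (by simp), r2]) (by rw [fr₂ _ (by simp), r19]) (by rw [fr₂ _ (by simp), r6])
    (by simp) (by rw [fr₂ _ (by simp), r16]) (Or.inr (Or.inl rfl))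
  set s₃ := (visitKey U Q 16).eval s₂ with hs₃
  have fr₃ := fun x hx => (fr 16 s₂ x hx).trans (fr₂ x hx)
  rw [← hs₃] at fr₃
  obtain ⟨D₃, hD₄, c₃⟩ := hD₃.visit (d := 3) (x := D[k]) (δ := W) hUQ
    (by rw [fr₃ _ (by simp), r2]) (by rw [fr₃ _ (by simp), r19]) (by rw [fr₃ _ (by simp), r6])
    (by simp) (by rw [fr₃ _ (by simp), r3]) (Or.inr (Or.inr (Or.inl rfl)))
  set s₄ := (visitKey U Q 3).eval s₃ with hs₄
  have fr₄ := fun x hx => (fr 3 s₃ x hx).trans (fr₃ x hx)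
  rw [← hs₄] at fr₄
  obtain ⟨D₄, hD₅, c₄⟩ := hD₄.visit (d := 4) (x := D[k]) (δ := -W) hUQ
    (by rw [fr₄ _ (by simp), r2]) (by rw [fr₄ _ (by simp), r19]) (by rw [fr₄ _ (by simp), r6])
    (by simp) (by rw [fr₄ _ (by simp), r4]) (Or.inr (Or.inr (Or.inr rfl)))
  set s₅ := (visitKey U Q 4).eval s₄ with hs₅
  have fr₅ := fun x hx => (fr 4 s₄ x hx).trans (fr₄ x hx)
  rw [← hs₅] at fr₅
  have ev : (bfsStep U Q).eval s' = (Prog.sub 10 12 11).eval s₅ := rfl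
  rw [ev]
  clear_value s₁ s₂ s₃ s₄ s₅
  refine ⟨D₁ ++ D₂ ++ D₃ ++ D₄, ?_⟩
  have happ : D ++ (D₁ ++ D₂ ++ D₃ ++ D₄) = D ++ D₁ ++ D₂ ++ D₃ ++ D₄ := by
    simp only [List.append_assoc]
  rw [happ]
  refine ⟨⟨hD₅.nodup, hD₅.sub, by simpa [Prog.eval] using hD₅.r12,
    by simpa [Prog.eval] using hD₅.queue, by simpa [Prog.eval] using hD₅.marks⟩,
    by simp [Prog.eval, fr₅, r11], by simp [Prog.eval, fr₅, r11, hD₅.r12], ?_⟩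
  rintro y hy (rfl | rfl | rfl | rfl)
  · exact List.mem_append_left _ (List.mem_append_left _ (List.mem_append_left _ (c₁ hy)))
  · exact List.mem_append_left _ (List.mem_append_left _ (c₂ hy))
  · exact List.mem_append_left _ (c₃ hy)
  · exact c₄ hy

/-- The search takes linear time because each number enters the queue at most once.  It ends when
all the neighbours of the numbers found have been found, so that these are the reachable numbers. -/
theorem runs_bfsPass {K U Q n N : ℕ} {s : Store} {W : ℤ} (hW : W = 4 * n + 5) {S : Finset ℤ} {x₀ : ℤ}
    (hN : n ≤ N) (hd : [K, U, Q].Nodup) (h : Ready n s) (hx₀ : s.mem K 0 = x₀) (hxS : x₀ ∈ S)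
    (hS : S.card ≤ n) (hU : ∀ y, 0 < s.mem U y ↔ y ∈ S) :
    Runs (bfsPass K U Q) 50 N s (fun s' => ∃ D : Finset ℤ, s'.reg 12 = D.card ∧
      ∀ y, y ∈ D ↔ y ∈ S ∧ KeyReach W (S : Set ℤ) x₀ y) := by
  simp only [List.nodup_cons, List.mem_cons, List.not_mem_nil, not_or, or_false, not_false_eq_true,
    List.nodup_nil, and_true] at hd
  obtain ⟨⟨-, -⟩, d₁⟩ := hd
  refine Runs.mono (C := 1 + (1 + (1 + (1 + (1 + (1 + 44)))))) ?_ le_rfl (fun _ _ h => h)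
  iterate 6 refine Runs.seq (runs_straight rfl rfl) ?_; rintro _ - rfl
  -- The first `k` numbers in the queue are processed, and `S.card - k` bounds the remaining
  -- iterations.
  refine Runs.mono (runs_loop (I := fun m s' => ∃ (D : List ℤ) (k : ℕ),
      BfsInv W (S : Set ℤ) x₀ U Q D s' ∧
      s'.reg 11 = k ∧ s'.reg 10 = D.length - k ∧ k ≤ D.length ∧ m = S.card - k ∧ x₀ ∈ D ∧
      ∀ (i : ℕ) (hi : i < D.length), i < k → ∀ y ∈ S, KeyAdj W D[i] y → y ∈ D)
      (m := S.card) (n := N) rfl (hS.trans hN) ?_ ?_)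
    (by simp [Prog.size, bfsStep, visitKey, Prog.skip]) ?_
  · refine ⟨[x₀], 0, ⟨by simp, ?_, ?_, ?_, ?_⟩, by simp [Prog.eval], by simp [Prog.eval], by simp,
      by simp, by simp, by simp⟩
    · simp only [List.mem_singleton, forall_eq]
      exact ⟨hxS, Relation.ReflTransGen.refl⟩
    · simp [Prog.eval]
    · simp [Prog.eval, h.r19, hx₀]
    · intro y
      rcases eq_or_ne y x₀ with rfl | hne
      · simp [Prog.eval, h.r19, hx₀, d₁]
      · simp [Prog.eval, h.r19, hx₀, d₁, hne, hU]
  · rintro m s' hf ⟨D, k, hD, h11, h10, hk, hm, hx₀D, hcl⟩ hpos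
    have hkD : k < D.length := by omega
    have hDS : D.length ≤ S.card := by
      rw [← List.toFinset_card_of_nodup hD.nodup]
      exact Finset.card_le_card fun y hy => by simpa using (hD.sub y (by simpa using hy)).1
    have g2 : s'.reg 2 = 1 := (hf.reg 2 rfl).trans (by simp [Prog.eval, h.r2])
    have g19 : s'.reg 19 = 0 := (hf.reg 19 rfl).trans (by simp [Prog.eval, h.r19])
    have g3 : s'.reg 3 = W := (hf.reg 3 rfl).trans (by simp [Prog.eval, h.r3, hW])
    have g4 : s'.reg 4 = -W := (hf.reg 4 rfl).trans (by simp [Prog.eval, h.r4, hW])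
    have g16 : s'.reg 16 = -1 := (hf.reg 16 rfl).trans (by simp [Prog.eval, h.r16])
    obtain ⟨D', hD', k11, k10, hcl'⟩ := hD.step d₁ h11 hkD g2 g19 g3 g4 g16
    refine ⟨S.card - (k + 1), by omega, D ++ D', k + 1, hD', by simpa using k11,
      by simpa using k10, by simp; omega, rfl, by simp [hx₀D], ?_⟩
    intro i hi hik y hy hadj
    have hiD : i < D.length := by omega
    rw [List.getElem_append_left hiD] at hadj
    rcases Nat.lt_or_eq_of_le (Nat.lt_succ_iff.1 hik) with hlt | rfl
    · exact List.mem_append_left _ (hcl i hiD hlt y hy hadj)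
    · exact hcl' y hy hadj
  · rintro s' - ⟨h10, m, D, k, hD, h11, h10', hk, hm, hx₀D, hcl⟩
    have hkD : k = D.length := by omega
    refine ⟨D.toFinset, by rw [hD.r12, List.toFinset_card_of_nodup hD.nodup], fun y => ?_⟩
    rw [List.mem_toFinset]
    refine ⟨fun hy => by simpa using hD.sub y hy, fun hy => ?_⟩
    have hr := hy.2
    clear hy
    induction hr with
    | refl => exact hx₀D
    | tail _ hstep ih =>
      obtain ⟨i, hi, rfl⟩ := List.getElem_of_mem ih
      exact hcl i hi (by omega) _ (by simpa using hstep.1) hstep.2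

/-! ### Cells and their numbers -/

/-- The number of the cell `c`, relative to the cell `o`.  The row width `4 n + 5` is so large that
cells with columns at distance at most `n + 1` from that of `o`, and differences of such cells, are
determined by their numbers. -/
def key (n : ℕ) (o c : Cell) : ℤ := (c.1 - o.1 + n + 1) * (4 * n + 5) + (c.2 - o.2)

/-- The coordinates of `c` differ by at most `n` from those of `o`. -/
def Near (n : ℕ) (o c : Cell) : Prop := |c.1 - o.1| ≤ n ∧ |c.2 - o.2| ≤ n

theorem near_iff {n : ℕ} {o c : Cell} :
    Near n o c ↔ 0 < rowOffset n (c.1 - o.1) ∧ 0 < rowOffset n (c.2 - o.2) := by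
  rw [Near, rowOffset_pos, rowOffset_pos, abs_le, abs_le]

theorem Near.key_eq {n : ℕ} {o c : Cell} (h : Near n o c) :
    rowOffset n (c.1 - o.1) + (c.2 - o.2) = key n o c := by
  rw [Near, abs_le] at h
  rw [rowOffset, if_pos h.1, key]

theorem eq_of_mul_add_eq {n : ℕ} {a b c d : ℤ} (hbd : |b - d| < 4 * n + 5)
    (h : a * (4 * n + 5) + b = c * (4 * n + 5) + d) : a = c ∧ b = d := by
  have h₁ : b - d = 0 := by
    refine Int.eq_zero_of_abs_lt_dvd (m := 4 * n + 5) ⟨c - a, by linarith⟩ hbd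
  have h₂ : b = d := by linarith
  subst h₂
  refine ⟨mul_right_cancel₀ (b := (4 * n + 5 : ℤ)) (by positivity) (by linarith), rfl⟩

theorem key_inj {n : ℕ} {o a b : Cell} (h : |a.2 - b.2| < 4 * n + 5)
    (hab : key n o a = key n o b) : a = b := by
  obtain ⟨h₁, h₂⟩ := eq_of_mul_add_eq (by rwa [sub_sub_sub_cancel_right]) hab
  exact Prod.ext (by linarith) (by linarith)

theorem key_mem_image {n : ℕ} {o p : Cell} {A : Shape} (hA : ∀ c ∈ A, Near n o c)
    (hp : |p.2 - o.2| ≤ n + 1) : key n o p ∈ A.image (key n o) ↔ p ∈ A := by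
  constructor
  · intro h
    obtain ⟨c, hc, hcp⟩ := Finset.mem_image.1 h
    have h₁ := (hA c hc).2
    have : c = p := key_inj (by rw [abs_le] at *; rw [abs_lt]; omega) hcp
    exact this ▸ hc
  · exact Finset.mem_image_of_mem _

/-- Neighbours have adjacent numbers, and conversely because the rows do not wrap around. -/
theorem keyAdj_iff {n : ℕ} {o a b : Cell} (ha : Near n o a) (hb : Near n o b) :
    KeyAdj (4 * n + 5) (key n o a) (key n o b) ↔ gridGraph.Adj a b := by
  have hab := ha.2
  have hbb := hb.2
  rw [abs_le] at hab hbb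
  have e₁ : key n o a + 1 = key n o (a + (0, 1)) := by simp [key]; ring
  have e₂ : key n o a + -1 = key n o (a + (0, -1)) := by simp [key]; ring
  have e₃ : key n o a + (4 * n + 5) = key n o (a + (1, 0)) := by simp [key]; ring
  have e₄ : key n o a + -(4 * n + 5) = key n o (a + (-1, 0)) := by simp [key]; ring
  have inj : ∀ d : Cell, |d.2| ≤ 1 → (key n o b = key n o (a + d) ↔ b = a + d) := by
    intro d hd
    refine ⟨fun h => key_inj ?_ h, fun h => by rw [h]⟩
    rw [abs_le] at hd
    rw [abs_lt, Prod.snd_add]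
    omega
  rw [KeyAdj, e₁, e₂, e₃, e₄, inj _ (by simp), inj _ (by simp), inj _ (by simp), inj _ (by simp),
    gridGraph_adj_iff]
  simp only [Prod.ext_iff, Prod.fst_add, Prod.snd_add]
  omega

theorem abs_le_of_walk {A : Shape} {a b : (A : Set Cell)}
    (w : (gridGraph.induce (A : Set Cell)).Walk a b) :
    |b.1.1 - a.1.1| ≤ w.length ∧ |b.1.2 - a.1.2| ≤ w.length := by
  induction w with
  | nil => simp
  | cons h w ih =>
    rw [SimpleGraph.comap_adj, Function.Embedding.subtype_apply, Function.Embedding.subtype_apply,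
      gridGraph_adj_iff] at h
    rw [SimpleGraph.Walk.length_cons, Nat.cast_succ]
    simp only [abs_le] at ih ⊢
    omega

/-- A path in the shape visits each node at most once, so that its length is less than the number of
nodes. -/
theorem IsConnectedShape.near {A : Shape} {o c : Cell} (h : IsConnectedShape A) (ho : o ∈ A)
    (hc : c ∈ A) : Near A.card o c := by
  obtain ⟨w, hw⟩ := (h.preconnected ⟨o, ho⟩ ⟨c, hc⟩).exists_isPath
  have h₁ := hw.length_lt
  have h₂ := abs_le_of_walk w
  have h₃ : Fintype.card (A : Set Cell) = A.card := by simp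
  simp only at h₂
  rw [h₃] at h₁
  exact ⟨by omega, by omega⟩

/-- Connectivity of a shape in terms of the numbers of its cells. -/
theorem isConnectedShape_iff {A : Shape} {n : ℕ} {o : Cell} (hn : A.card = n) (ho : o ∈ A) :
    IsConnectedShape A ↔ (∀ c ∈ A, Near n o c) ∧
      ∀ y ∈ A.image (key n o), KeyReach (4 * n + 5) (A.image (key n o) : Finset ℤ) (key n o o) y := by
  constructor
  · intro h
    have hnear : ∀ c ∈ A, Near n o c := fun c hc => hn ▸ h.near ho hc
    refine ⟨hnear, fun y hy => ?_⟩
    obtain ⟨c, hc, rfl⟩ := Finset.mem_image.1 hy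
    have := (SimpleGraph.reachable_iff_reflTransGen _ _).1 (h.preconnected ⟨o, ho⟩ ⟨c, hc⟩)
    refine this.lift (fun a : (A : Set Cell) => key n o a.1) ?_
    rintro ⟨a, ha⟩ ⟨b, hb⟩ hab
    exact ⟨by simpa using ⟨b.1, b.2, hb, rfl⟩, (keyAdj_iff (hnear a ha) (hnear b hb)).2 hab⟩
  · rintro ⟨hnear, h⟩
    have key' : ∀ y, KeyReach (4 * n + 5) (A.image (key n o) : Finset ℤ) (key n o o) y →
        ∃ c : (A : Set Cell), key n o c.1 = y ∧
          (gridGraph.induce (A : Set Cell)).Reachable ⟨o, ho⟩ c := by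
      intro y hy
      induction hy with
      | refl => exact ⟨⟨o, ho⟩, rfl, SimpleGraph.Reachable.refl _⟩
      | tail _ hstep ih =>
        obtain ⟨c, rfl, hc⟩ := ih
        obtain ⟨b, hb, rfl⟩ := Finset.mem_image.1 (Finset.mem_coe.1 hstep.1)
        refine ⟨⟨b, hb⟩, rfl, hc.trans (SimpleGraph.Adj.reachable ?_)⟩
        exact (keyAdj_iff (hnear _ c.2) (hnear b hb)).1 hstep.2
    have hreach : ∀ c : (A : Set Cell), (gridGraph.induce (A : Set Cell)).Reachable ⟨o, ho⟩ c := by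
      intro c
      obtain ⟨d, hd, hr⟩ := key' _ (h (key n o c.1) (Finset.mem_image_of_mem _ c.2))
      have : d = c := by
        refine Subtype.ext (key_inj ?_ hd)
        have h₁ := (hnear _ c.2).2
        have h₂ := (hnear _ d.2).2
        rw [abs_le] at h₁ h₂
        rw [abs_lt]
        omega
      exact this ▸ hr
    have : Nonempty (A : Set Cell) := ⟨⟨o, ho⟩⟩
    exact ⟨fun a b => (hreach a).symm.trans (hreach b)⟩

/-- The two nodes of a rotation movement can be interchanged, so that it suffices to look at pairs
`p`, `p + (0, 1)` and `p`, `p + (1, 0)`. -/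
theorem hasRotation_iff_exists {A : Shape} : HasRotation A ↔ ∃ p ∈ A,
    (p + (0, 1) ∈ A ∧ p + (0, 1) + (1, 0) ∉ A ∧ p + (1, 0) ∉ A) ∨
    (p + (0, 1) ∈ A ∧ p + (0, 1) + (-1, 0) ∉ A ∧ p + (-1, 0) ∉ A) ∨
    (p + (1, 0) ∈ A ∧ p + (1, 0) + (0, 1) ∉ A ∧ p + (0, 1) ∉ A) ∨
    (p + (1, 0) ∈ A ∧ p + (1, 0) + (0, -1) ∉ A ∧ p + (0, -1) ∉ A) := by
  constructor
  · rintro ⟨T, ⟨a, b⟩, ⟨c, d⟩, ⟨e, f⟩, hp, hq, hadj, hd, h₁, h₂, -⟩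
    rw [gridGraph_adj_iff] at hadj
    have hd' : (e = b - d ∧ f = c - a) ∨ (e = d - b ∧ f = a - c) := by
      rcases hd with h | h <;> simp only [turn, Prod.mk.injEq, Prod.snd_sub, Prod.fst_sub,
        Prod.neg_mk] at h <;> omega
    simp only at hadj
    simp only [Prod.mk_add_mk] at h₁ h₂
    have hn : ∀ x y, (x = a + e ∧ y = b + f ∨ x = c + e ∧ y = d + f) → (x, y) ∉ A := by
      rintro x y (⟨rfl, rfl⟩ | ⟨rfl, rfl⟩) <;> assumption
    have hm : ∀ x y, (x = a ∧ y = b ∨ x = c ∧ y = d) → (x, y) ∈ A := by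
      rintro x y (⟨rfl, rfl⟩ | ⟨rfl, rfl⟩) <;> assumption
    clear hd h₁ h₂
    rcases hadj with ⟨h, h' | h'⟩ | ⟨h, h' | h'⟩ <;> rcases hd' with hd | hd
    · refine ⟨(a, b), hp, ?_⟩
      simp only [Prod.mk_add_mk]
      exact Or.inr (Or.inl ⟨hm _ _ (by omega), hn _ _ (by omega), hn _ _ (by omega)⟩)
    · refine ⟨(a, b), hp, ?_⟩
      simp only [Prod.mk_add_mk]
      exact Or.inl ⟨hm _ _ (by omega), hn _ _ (by omega), hn _ _ (by omega)⟩
    · refine ⟨(c, d), hq, ?_⟩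
      simp only [Prod.mk_add_mk]
      exact Or.inl ⟨hm _ _ (by omega), hn _ _ (by omega), hn _ _ (by omega)⟩
    · refine ⟨(c, d), hq, ?_⟩
      simp only [Prod.mk_add_mk]
      exact Or.inr (Or.inl ⟨hm _ _ (by omega), hn _ _ (by omega), hn _ _ (by omega)⟩)
    · refine ⟨(a, b), hp, ?_⟩
      simp only [Prod.mk_add_mk]
      exact Or.inr (Or.inr (Or.inl
        ⟨hm _ _ (by omega), hn _ _ (by omega), hn _ _ (by omega)⟩))
    · refine ⟨(a, b), hp, ?_⟩
      simp only [Prod.mk_add_mk]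
      exact Or.inr (Or.inr (Or.inr
        ⟨hm _ _ (by omega), hn _ _ (by omega), hn _ _ (by omega)⟩))
    · refine ⟨(c, d), hq, ?_⟩
      simp only [Prod.mk_add_mk]
      exact Or.inr (Or.inr (Or.inr
        ⟨hm _ _ (by omega), hn _ _ (by omega), hn _ _ (by omega)⟩))
    · refine ⟨(c, d), hq, ?_⟩
      simp only [Prod.mk_add_mk]
      exact Or.inr (Or.inr (Or.inl
        ⟨hm _ _ (by omega), hn _ _ (by omega), hn _ _ (by omega)⟩))
  · have adj : ∀ p q : Cell, q = p + (0, 1) ∨ q = p + (1, 0) → gridGraph.Adj p q := by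
      rintro p q (rfl | rfl) <;> rw [gridGraph_adj_iff] <;> simp
    rintro ⟨p, hp, ⟨h₁, h₂, h₃⟩ | ⟨h₁, h₂, h₃⟩ | ⟨h₁, h₂, h₃⟩ | ⟨h₁, h₂, h₃⟩⟩
    · exact ⟨_, p, _, _, hp, h₁, adj _ _ (by simp), Or.inr (by simp [turn]), h₃, h₂, rfl⟩
    · exact ⟨_, p, _, _, hp, h₁, adj _ _ (by simp), Or.inl (by simp [turn]), h₃, h₂, rfl⟩
    · exact ⟨_, p, _, _, hp, h₁, adj _ _ (by simp), Or.inl (by simp [turn]), h₃, h₂, rfl⟩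
    · exact ⟨_, p, _, _, hp, h₁, adj _ _ (by simp), Or.inr (by simp [turn]), h₃, h₂, rfl⟩

theorem sideFree_indicator {g : ℤ → ℤ} {K : Finset ℤ} (hg : ∀ z, g z = if z ∈ K then 1 else 0)
    {x e d : ℤ} : SideFree g x e d ↔ x + e ∈ K ∧ x + e + d ∉ K ∧ x + d ∉ K := by
  simp only [SideFree, hg]
  split_ifs <;> simp [*]

theorem hasRotation_iff_sideFree {A : Shape} {n : ℕ} {o : Cell} {g : ℤ → ℤ}
    (hA : ∀ c ∈ A, Near n o c) (hg : ∀ z, g z = if z ∈ A.image (key n o) then 1 else 0) :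
    HasRotation A ↔ ∃ p ∈ A,
      SideFree g (key n o p) 1 (4 * n + 5) ∨ SideFree g (key n o p) 1 (-(4 * n + 5)) ∨
        SideFree g (key n o p) (4 * n + 5) 1 ∨ SideFree g (key n o p) (4 * n + 5) (-1) := by
  rw [hasRotation_iff_exists]
  refine exists_congr fun p => and_congr_right fun hp => ?_
  have e₁ : ∀ a, key n o a + 1 = key n o (a + (0, 1)) := fun a => by simp [key]; ring
  have e₂ : ∀ a, key n o a + -1 = key n o (a + (0, -1)) := fun a => by simp [key]; ring
  have e₃ : ∀ a, key n o a + (4 * n + 5) = key n o (a + (1, 0)) := fun a => by simp [key]; ring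
  have e₄ : ∀ a, key n o a + -(4 * n + 5) = key n o (a + (-1, 0)) := fun a => by simp [key]; ring
  have hp₂ := (hA p hp).2
  rw [abs_le] at hp₂
  have mem : ∀ d : Cell, |d.2| ≤ 1 → (key n o (p + d) ∈ A.image (key n o) ↔ p + d ∈ A) := by
    intro d hd
    rw [abs_le] at hd
    refine key_mem_image hA ?_
    rw [abs_le, Prod.snd_add]
    omega
  simp only [sideFree_indicator hg, e₁, e₂, e₃, e₄, add_assoc]
  rw [mem _ (by simp), mem _ (by simp), mem _ (by simp), mem _ (by simp), mem _ (by simp),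
    mem _ (by simp), mem _ (by simp), mem _ (by simp)]

theorem reds_eq_sum {l : List Cell} (hl : l.Nodup) :
    ∑ i ∈ Finset.range l.length, ((l.getD i 0).1 + (l.getD i 0).2) % 2 = (reds l.toFinset : ℤ) := by
  rw [Finset.sum_range]
  simp only [List.getD_eq_getElem _ _ (Fin.is_lt _)]
  have h₁ := List.sum_toFinset (fun c : Cell => (c.1 + c.2) % 2) hl
  rw [← Fin.sum_univ_fun_getElem l (fun c : Cell => (c.1 + c.2) % 2)] at h₁
  refine h₁.symm.trans ?_
  rw [reds, Finset.card_filter]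
  push_cast
  refine Finset.sum_congr rfl fun c _ => ?_
  split_ifs with h
  · exact Int.odd_iff.1 h
  · exact Int.even_iff.1 (Int.not_odd_iff_even.1 h)

/-! ### Motions in terms of numbers -/

/-- If the numbers of the cells `φ b` are those of cells of `A` after a shift that matches the
minima, then `φ` followed by a translation maps `B` into `A`, and conversely. -/
theorem exists_translate_iff {A B : Shape} {n : ℕ} {o : Cell} (hA : ∀ c ∈ A, Near n o c)
    {φ : Cell → Cell} (hφ : Set.InjOn φ B) (hB : ∀ b ∈ B, |(φ b).2| ≤ n) (hcard : A.card ≤ B.card)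
    {f : Cell → ℤ} {e : ℤ} (hf : ∀ b ∈ B, f b = (φ b).1 * (4 * n + 5) + (φ b).2 + e) {mA mB : ℤ}
    (hmA : ∃ a ∈ A, mA = key n o a) (hmA' : ∀ a ∈ A, mA ≤ key n o a)
    (hmB : ∃ b ∈ B, mB = f b) (hmB' : ∀ b ∈ B, mB ≤ f b) :
    (∀ b ∈ B, f b + (mA - mB) ∈ A.image (key n o)) ↔ ∃ t, A = B.image (fun b => φ b + t) := by
  constructor
  · intro h
    obtain ⟨a₀, ha₀, hma⟩ := hmA
    obtain ⟨b₀, hb₀, hmb⟩ := hmB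
    refine ⟨a₀ - φ b₀, (Finset.eq_of_subset_of_card_le ?_ ?_).symm⟩
    · intro c hc
      obtain ⟨b, hb, rfl⟩ := Finset.mem_image.1 hc
      obtain ⟨a, ha, hab⟩ := Finset.mem_image.1 (h b hb)
      rw [hma, hmb, hf b hb, hf b₀ hb₀] at hab
      simp only [key] at hab
      have h₁ := (hA a ha).2
      have h₂ := (hA a₀ ha₀).2
      have h₃ := hB b hb
      have h₄ := hB b₀ hb₀
      rw [abs_le] at h₁ h₂ h₃ h₄
      obtain ⟨h₅, h₆⟩ := eq_of_mul_add_eq (n := n) (a := a.1 - a₀.1) (b := a.2 - a₀.2)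
        (c := (φ b).1 - (φ b₀).1) (d := (φ b).2 - (φ b₀).2) (by rw [abs_lt]; omega) (by linarith)
      have : φ b + (a₀ - φ b₀) = a := by
        ext <;> simp only [Prod.fst_add, Prod.snd_add, Prod.fst_sub, Prod.snd_sub] <;> linarith
      exact this ▸ ha
    · rwa [Finset.card_image_of_injOn fun a ha b hb hab => hφ ha hb (add_right_cancel hab)]
  · rintro ⟨t, rfl⟩
    have hk : ∀ b ∈ B, key n o (φ b + t) = f b +
        ((t.1 - o.1 + n + 1) * (4 * n + 5) + (t.2 - o.2) - e) := by
      intro b hb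
      rw [hf b hb, key, Prod.fst_add, Prod.snd_add]
      ring
    have hm : mA - mB = (t.1 - o.1 + n + 1) * (4 * n + 5) + (t.2 - o.2) - e := by
      apply le_antisymm
      · obtain ⟨b, hb, rfl⟩ := hmB
        have := hmA' _ (Finset.mem_image_of_mem _ hb)
        rw [hk b hb] at this
        linarith
      · obtain ⟨a, ha, rfl⟩ := hmA
        obtain ⟨b, hb, rfl⟩ := Finset.mem_image.1 ha
        have := hmB' b hb
        rw [hk b hb]
        linarith
    intro b hb
    rw [hm, ← hk b hb]
    exact Finset.mem_image_of_mem _ (Finset.mem_image_of_mem _ hb)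

theorem turn_iterate_neg (k : ℕ) (a : Cell) : turn^[k] (-a) = -turn^[k] a := by
  induction k generalizing a with
  | zero => rfl
  | succ k ih => rw [Function.iterate_succ_apply, turn_neg, ih]; rfl

/-- Congruence in terms of at most three quarter turns about an arbitrary cell `o`. -/
theorem congruent_iff_exists {A B : Shape} (o : Cell) : Congruent A B ↔
    ∃ k < 4, ∃ t, A = B.image (fun b => turn^[k] (b - o) + t) := by
  constructor
  · intro h
    obtain ⟨k, t, hA⟩ := h.symm
    refine ⟨k % 4, Nat.mod_lt _ (by norm_num), t + turn^[k % 4] o, hA.trans ?_⟩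
    refine Finset.image_congr fun c _ => ?_
    have : turn^[k] c = turn^[k % 4] c := by
      conv_lhs => rw [← Nat.mod_add_div k 4, Function.iterate_add_apply, turn_iterate_four_mul]
    simp only [this, sub_eq_add_neg, turn_iterate_add, turn_iterate_neg]
    abel
  · rintro ⟨k, -, t, hA⟩
    refine Congruent.symm ⟨k, t - turn^[k] o, hA.trans ?_⟩
    refine Finset.image_congr fun c _ => ?_
    simp only [sub_eq_add_neg, turn_iterate_add, turn_iterate_neg]
    abel

theorem Congruent.card_eq {A B : Shape} (h : Congruent A B) : A.card = B.card := by
  obtain ⟨k, t, rfl⟩ := h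
  refine (Finset.card_image_of_injective _ fun a b hab => ?_).symm
  exact turn_injective.iterate k (add_right_cancel hab)

theorem even_turn_iterate (k : ℕ) (c : Cell) :
    Even ((turn^[k] c).1 + (turn^[k] c).2) ↔ Even (c.1 + c.2) := by
  induction k generalizing c with
  | zero => rfl
  | succ k ih =>
    rw [Function.iterate_succ_apply, ih]
    simp only [turn, Int.even_iff]
    omega

theorem card_filter_image {f : Cell → Cell} (hf : Function.Injective f) (p q : Cell → Prop)
    [DecidablePred p] [DecidablePred q] (hpq : ∀ c, p (f c) ↔ q c) (S : Shape) :
    ((S.image f).filter p).card = (S.filter q).card := by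
  rw [Finset.filter_image, Finset.card_image_of_injective _ hf]
  simp only [hpq]

/-- A motion either preserves the colours or interchanges them. -/
theorem Congruent.reds_eq {A B : Shape} (h : Congruent A B) :
    reds B = reds A ∨ reds B = blacks A := by
  obtain ⟨k, t, rfl⟩ := h
  have hinj : Function.Injective (fun c => turn^[k] c + t) := fun a b hab =>
    turn_injective.iterate k (add_right_cancel hab)
  have par : ∀ c : Cell, Even ((turn^[k] c + t).1 + (turn^[k] c + t).2) ↔
      (Even (c.1 + c.2) ↔ Even (t.1 + t.2)) := by
    intro c
    rw [← even_turn_iterate k c, ← Int.even_add, Prod.fst_add, Prod.snd_add]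
    ring_nf
  by_cases ht : Even (t.1 + t.2)
  · left
    refine card_filter_image hinj _ _ (fun c => ?_) A
    rw [← Int.not_even_iff_odd, ← Int.not_even_iff_odd, par]
    simp [ht]
  · right
    refine card_filter_image hinj _ _ (fun c => ?_) A
    rw [← Int.not_even_iff_odd, par]
    simp [ht]

theorem colorConsistent_iff {A B : Shape} (h : A.card = B.card) :
    ColorConsistent A B ↔ reds A = reds B := by
  rw [card_eq_blacks_add_reds, card_eq_blacks_add_reds] at h
  rw [ColorConsistent]
  omega

theorem colorConsistentUpToMotion_iff {A B : Shape} (h : A.card = B.card) :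
    ColorConsistentUpToMotion A B ↔ reds A = reds B ∨ reds A + reds B = A.card := by
  have hA := card_eq_blacks_add_reds A
  have hB := card_eq_blacks_add_reds B
  constructor
  · rintro ⟨B', hB', hc⟩
    have := hc.2
    rcases hB'.reds_eq with h | h <;> omega
  · rintro (h' | h')
    · exact ⟨B, congruent_refl B, (colorConsistent_iff h).2 h'⟩
    · -- The translation by one column interchanges the colours.
      have hc : Congruent B (B.image (fun c => turn^[0] c + (0, 1))) := ⟨0, (0, 1), rfl⟩
      refine ⟨_, hc, (colorConsistent_iff (h.trans hc.card_eq)).2 ?_⟩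
      have : reds (B.image (fun c => turn^[0] c + (0, 1))) = blacks B := by
        refine card_filter_image (fun a b hab => by simpa using hab) _ _ (fun c => ?_) B
        simp only [Function.iterate_zero, id, Prod.fst_add, Prod.snd_add, Int.odd_iff, Int.even_iff]
        omega
      omega

/-! ### Analysing a shape -/

theorem Frame.seq {P P' : Prog} {s s' s'' : Store} (h : Frame P s s') (h' : Frame P' s' s'') :
    Frame (P ;; P') s s'' := by
  constructor
  · intro x hx
    simp only [Prog.writesReg, Bool.or_eq_false_iff] at hx
    exact (h'.reg x hx.2).trans (h.reg x hx.1)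
  · intro x hx
    simp only [Prog.writesMem, Bool.or_eq_false_iff] at hx
    exact (h'.mem x hx.2).trans (h.mem x hx.1)

/-- The arrays `R` and `C` of the store hold the rows and columns of the cells in the list `l`. -/
def Holds (l : List Cell) (R C : ℕ) (s : Store) : Prop :=
  ∀ i < l.length, s.mem R i = (l.getD i 0).1 ∧ s.mem C i = (l.getD i 0).2

theorem forall_lt_getD_iff {l : List Cell} {p : Cell → Prop} :
    (∀ i < l.length, p (l.getD i 0)) ↔ ∀ c ∈ l.toFinset, p c := by
  constructor
  · intro h c hc
    obtain ⟨i, hi, rfl⟩ := List.getElem_of_mem (List.mem_toFinset.1 hc)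
    simpa [hi] using h i hi
  · intro h i hi
    exact h _ (by simp [hi])

theorem exists_lt_getD_iff {l : List Cell} {p : Cell → Prop} :
    (∃ i < l.length, p (l.getD i 0)) ↔ ∃ c ∈ l.toFinset, p c := by
  simpa using not_congr (forall_lt_getD_iff (l := l) (p := fun c => ¬p c))

/-- Compute everything that matters about one of the two shapes, the first one if `k = 0` and the
second one if `k = 1`.  Let `r = 20 + 4 k`.  The registers `r`, `r + 1`, `r + 2` and `r + 3`
receive a flag for cells that are too far away, the number of cells found by the search, a flag
for available rotation movements, and the number of red cells.  The array `13 + 3 k` marks the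
numbers of the cells, and the arrays `5 + 4 k`, …, `8 + 4 k` list the numbers of the cells after 0,
3, 2 and 1 quarter turns, up to constants. -/
def analyse (k : ℕ) : Prog :=
  .load 13 (2 * k) 19 ;; .load 14 (2 * k + 1) 19 ;;
    keyPass (2 * k) (2 * k + 1) (5 + 4 * k) (6 + 4 * k) (7 + 4 * k) (8 + 4 * k) ;;
    .add (20 + 4 * k) 10 19 ;;
    markPass (5 + 4 * k) (13 + 3 * k) (14 + 3 * k) ;;
    bfsPass (5 + 4 * k) (14 + 3 * k) (15 + 3 * k) ;; .add (21 + 4 * k) 12 19 ;;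
    rotPass (5 + 4 * k) (13 + 3 * k) ;; .add (22 + 4 * k) 10 19 ;;
    redsPass (2 * k) (2 * k + 1) ;; .add (23 + 4 * k) 10 19

/-- The result of `analyse` for the shape listed by `l`, where cells are numbered relative to the
first cell of the list.  The numbers say nothing about cells that are too far away, but a shape with
such cells is not connected. -/
structure Analysed (l : List Cell) (k : ℕ) (s : Store) : Prop where
  far_nonneg : 0 ≤ s.reg (20 + 4 * k)
  found_le : s.reg (21 + 4 * k) ≤ l.length
  connected_iff : IsConnectedShape l.toFinset ↔
    s.reg (20 + 4 * k) = 0 ∧ s.reg (21 + 4 * k) = l.length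
  rotation_iff : IsConnectedShape l.toFinset →
    (0 < s.reg (22 + 4 * k) ↔ HasRotation l.toFinset)
  reds_eq : s.reg (23 + 4 * k) = reds l.toFinset
  marks : IsConnectedShape l.toFinset → ∀ z, 0 < s.mem (13 + 3 * k) z ↔
    z ∈ l.toFinset.image (key l.length (l.getD 0 0))
  keys₀ : IsConnectedShape l.toFinset → ∀ i < l.length,
    s.mem (5 + 4 * k) i = key l.length (l.getD 0 0) (l.getD i 0)
  keys₁ : IsConnectedShape l.toFinset → ∀ i < l.length,
    s.mem (6 + 4 * k) i = ((l.getD i 0).2 - (l.getD 0 0).2 + l.length + 1) * (4 * l.length + 5) -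
      ((l.getD i 0).1 - (l.getD 0 0).1)
  keys₂ : IsConnectedShape l.toFinset → ∀ i < l.length,
    s.mem (7 + 4 * k) i = -key l.length (l.getD 0 0) (l.getD i 0)
  keys₃ : IsConnectedShape l.toFinset → ∀ i < l.length,
    s.mem (8 + 4 * k) i = -(((l.getD i 0).2 - (l.getD 0 0).2 + l.length + 1) *
      (4 * l.length + 5) - ((l.getD i 0).1 - (l.getD 0 0).1))

/-- The analysis halts in linear time on every list; connectivity is part of its outcome. -/
theorem runs_analyse {l : List Cell} {k N : ℕ} {s : Store} (hk : k = 0 ∨ k = 1) (hl : l.Nodup)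
    (hpos : 0 < l.length) (hN : l.length ≤ N) (h : Ready l.length s)
    (h4 : ∀ z, s.mem 4 z = rowOffset l.length z) (hR : Holds l (2 * k) (2 * k + 1) s)
    (hG : ∀ z, s.mem (13 + 3 * k) z = 0) (hU : ∀ z, s.mem (14 + 3 * k) z = 0) :
    Runs (analyse k) 163 N s (Analysed l k) := by
  refine Runs.mono (C := 1 + (1 + (30 + (1 + (6 + (50 + (1 + (60 + (1 + (11 + 1))))))))))
    (Q := Analysed l k) ?_ (by norm_num) (fun _ _ h => h)
  set n := l.length with hn
  set o := l.getD 0 0 with ho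
  refine Runs.seq (Q := fun s' => s'.reg 13 = o.1) (runs_straight rfl ?_) ?_
  · have := (hR 0 hpos).1
    simp only [Prog.eval, Store.setReg_reg, h.r19] at this ⊢
    simpa [ho] using this
  intro s₁ F₁ q₁
  refine Runs.seq (Q := fun s' => s'.reg 14 = o.2) (runs_straight rfl ?_) ?_
  · have e₁ := F₁.reg 19 rfl
    have e₂ := F₁.mem (2 * k + 1) rfl
    have := (hR 0 hpos).2
    simpa [Prog.eval, e₁, e₂, h.r19, ho] using this
  intro s₂ f₂ q₂
  have F₂ := F₁.seq f₂
  refine Runs.seq (runs_keyPass (n := n) (r := fun i => (l.getD i 0).1) (c := fun i => (l.getD i 0).2)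
    (o₁ := o.1) (o₂ := o.2) hN (by rcases hk with rfl | rfl <;> decide)
    (h.frame F₂ (by rcases hk with rfl | rfl <;> decide)) ?_ ?_ ?_ ((f₂.reg 13 rfl).trans q₁) q₂) ?_
  · rw [F₂.mem 4 rfl]; exact h4
  · rw [F₂.mem (2 * k) rfl]; exact fun i hi => (hR i hi).1
  · rw [F₂.mem (2 * k + 1) rfl]; exact fun i hi => (hR i hi).2
  rintro s₃ f₃ ⟨hfar, hkeys⟩
  have F₃ := F₂.seq f₃
  have R₃ := h.frame F₃ (by rcases hk with rfl | rfl <;> decide)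
  refine Runs.seq (runs_straight rfl rfl) ?_
  intro s₄ f₄ q₄
  have F₄ := F₃.seq f₄
  have R₄ := h.frame F₄ (by rcases hk with rfl | rfl <;> decide)
  -- The numbers that the program computes, for cells nearby or not.
  set ks : ℕ → ℤ := fun i => rowOffset n ((l.getD i 0).1 - o.1) + ((l.getD i 0).2 - o.2) with hks'
  have hks : ∀ i, ks i = rowOffset n ((l.getD i 0).1 - o.1) + ((l.getD i 0).2 - o.2) := fun _ => rfl
  set K : Finset ℤ := (Finset.range n).image ks with hK
  have memK : ∀ z, z ∈ K ↔ ∃ i < n, ks i = z := by simp [hK]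
  have c₀₄ : ∀ i < n, s₄.mem (5 + 4 * k) i = ks i := by
    rw [f₄.mem _ rfl]; exact fun i hi => (hkeys i hi).1
  refine Runs.seq (runs_markPass (n := n) (ks := ks) hN (by rcases hk with rfl | rfl <;> decide) R₄
    c₀₄ ?_ ?_) ?_
  · rw [F₄.mem _ (by rcases hk with rfl | rfl <;> decide)]; exact hG
  · rw [F₄.mem _ (by rcases hk with rfl | rfl <;> decide)]; exact hU
  intro s₅ f₅ q₅
  have F₅ := F₄.seq f₅
  have R₅ := h.frame F₅ (by rcases hk with rfl | rfl <;> decide)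
  have c₀₅ : ∀ i < n, s₅.mem (5 + 4 * k) i = ks i := by
    rw [f₅.mem _ (by rcases hk with rfl | rfl <;> decide)]; exact c₀₄
  have g₅ : ∀ z, s₅.mem (13 + 3 * k) z = if z ∈ K then 1 else 0 := by
    intro z
    rw [(q₅ z).1, anyFlag]
    simp only [memK, zero_le, true_and]
  refine Runs.seq (runs_bfsPass (n := n) (S := K) rfl hN (by rcases hk with rfl | rfl <;> decide) R₅
    (c₀₅ 0 hpos) ((memK _).2 ⟨0, hpos, rfl⟩) (Finset.card_image_le.trans (by simp)) ?_) ?_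
  · intro z
    rw [(q₅ z).2, anyFlag_zero_pos, memK]
  rintro s₆ f₆ ⟨D, hD, hD'⟩
  have F₆ := F₅.seq f₆
  refine Runs.seq (runs_straight rfl rfl) ?_
  intro s₇ f₇ q₇
  have F₇ := F₆.seq f₇
  have R₇ := h.frame F₇ (by rcases hk with rfl | rfl <;> decide)
  refine Runs.seq (runs_rotPass (n := n) (ks := ks) (g := fun z => if z ∈ K then 1 else 0) rfl hN R₇
    ?_ ?_) ?_
  · rw [(f₆.seq f₇).mem _ (by rcases hk with rfl | rfl <;> decide)]; exact c₀₅
  · rw [(f₆.seq f₇).mem _ (by rcases hk with rfl | rfl <;> decide)]; exact g₅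
  intro s₈ f₈ q₈
  have F₈ := F₇.seq f₈
  refine Runs.seq (runs_straight rfl rfl) ?_
  intro s₉ f₉ q₉
  have F₉ := F₈.seq f₉
  refine Runs.seq (runs_redsPass (n := n) (r := fun i => (l.getD i 0).1)
    (c := fun i => (l.getD i 0).2) hN (h.frame F₉ (by rcases hk with rfl | rfl <;> decide)) ?_ ?_) ?_
  · rw [F₉.mem (2 * k) (by rcases hk with rfl | rfl <;> decide)]; exact fun i hi => (hR i hi).1
  · rw [F₉.mem (2 * k + 1) (by rcases hk with rfl | rfl <;> decide)]; exact fun i hi => (hR i hi).2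
  intro s₁₀ f₁₀ q₁₀
  have F₁₀ := F₉.seq f₁₀
  refine runs_straight rfl ?_
  have f₁₁ := frame_eval (P := .add (23 + 4 * k) 10 19) rfl s₁₀
  have q₁₁ : ((Prog.add (23 + 4 * k) 10 19).eval s₁₀).reg (23 + 4 * k) = s₁₀.reg 10 := by
    have := F₁₀.reg 19 (by rcases hk with rfl | rfl <;> decide)
    simp [Prog.eval, this, h.r19]
  generalize (Prog.add (23 + 4 * k) 10 19).eval s₁₀ = s₁₁ at f₁₁ q₁₁
  -- The contents of the output registers and arrays.
  have G₆ := (((f₆.seq f₇).seq f₈).seq f₉).seq f₁₀ |>.seq f₁₁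
  have G₅ := f₅.seq G₆
  have G₃ := f₄.seq G₅
  have o₀ : s₁₁.reg (20 + 4 * k) = s₃.reg 10 := by
    rw [G₅.reg _ (by rcases hk with rfl | rfl <;> decide), ← q₄]
    simp [Prog.eval, R₃.r19]
  have o₁ : s₁₁.reg (21 + 4 * k) = D.card := by
    rw [(((f₈.seq f₉).seq f₁₀).seq f₁₁).reg _ (by rcases hk with rfl | rfl <;> decide), ← q₇, ← hD]
    have := F₆.reg 19 (by rcases hk with rfl | rfl <;> decide)
    simp [Prog.eval, this, h.r19]
  have o₂ : s₁₁.reg (22 + 4 * k) = s₈.reg 10 := by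
    rw [(f₁₀.seq f₁₁).reg _ (by rcases hk with rfl | rfl <;> decide), ← q₉]
    have := F₈.reg 19 (by rcases hk with rfl | rfl <;> decide)
    simp [Prog.eval, this, h.r19]
  have far_iff : s₃.reg 10 = 0 ↔ ∀ c ∈ l.toFinset, Near n o c := by
    rw [hfar, anyFlag_zero_eq_zero]
    simp only [not_not]
    rw [forall_lt_getD_iff (l := l)
      (p := fun c => 0 < rowOffset n (c.1 - o.1) ∧ 0 < rowOffset n (c.2 - o.2))]
    simp only [near_iff]
  have hcard : l.toFinset.card = n := List.toFinset_card_of_nodup hl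
  have hoS : o ∈ l.toFinset := by rw [ho, List.getD_eq_getElem _ _ hpos]; simp
  have KS : (∀ c ∈ l.toFinset, Near n o c) → K = l.toFinset.image (key n o) := by
    intro hnear
    ext z
    rw [memK, Finset.mem_image, ← exists_lt_getD_iff (p := fun c => key n o c = z)]
    refine exists_congr fun i => and_congr_right fun hi => ?_
    rw [hks, (forall_lt_getD_iff.2 hnear i hi).key_eq]
  have hDK : D ⊆ K := fun y hy => ((hD' y).1 hy).1
  -- All the reachable numbers are found, so that the count decides about connectivity.
  have hconn : IsConnectedShape l.toFinset ↔ s₃.reg 10 = 0 ∧ (D.card : ℤ) = n := by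
    rw [isConnectedShape_iff hcard hoS, far_iff]
    refine and_congr_right fun hnear => ?_
    rw [← KS hnear]
    have hKcard : K.card = n := by
      rw [KS hnear, Finset.card_image_of_injOn, hcard]
      intro a ha b hb hab
      have h₁ := (hnear a ha).2
      have h₂ := (hnear b hb).2
      rw [abs_le] at h₁ h₂
      exact key_inj (by rw [abs_lt]; omega) hab
    have h₀ : ks 0 = key n o o := by
      rw [hks]
      exact (hnear o hoS).key_eq
    rw [Nat.cast_inj]
    constructor
    · intro hr
      rw [← hKcard]
      congr 1
      ext y
      rw [hD', h₀]
      exact ⟨fun h => h.1, fun h => ⟨h, hr y h⟩⟩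
    · intro hc y hy
      rw [← Finset.eq_of_subset_of_card_le hDK (by omega), hD', h₀] at hy
      exact hy.2
  have hnear : IsConnectedShape l.toFinset → ∀ c ∈ l.toFinset, Near n o c := fun hc =>
    far_iff.1 (hconn.1 hc).1
  have col : IsConnectedShape l.toFinset → ∀ i < n, rowOffset n ((l.getD i 0).2 - o.2) =
      ((l.getD i 0).2 - o.2 + n + 1) * (4 * n + 5) := fun hc i hi =>
    if_pos (abs_le.1 (forall_lt_getD_iff.2 (hnear hc) i hi).2)
  refine ⟨?_, ?_, ?_, ?_, ?_, ?_, ?_, ?_, ?_, ?_⟩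
  · rw [o₀, hfar, anyFlag]
    split_ifs <;> norm_num
  · rw [o₁, Nat.cast_le]
    exact (Finset.card_le_card hDK).trans (Finset.card_image_le.trans (by simp [hn]))
  · rw [o₀, o₁, hconn]
  · intro hc
    rw [o₂, q₈, anyFlag_zero_pos, hasRotation_iff_sideFree
      (g := fun z => if z ∈ K then 1 else 0) (hnear hc) fun z =>
        if_congr (by rw [KS (hnear hc)]) rfl rfl,
      ← exists_lt_getD_iff]
    refine exists_congr fun i => and_congr_right fun hi => ?_
    rw [hks, (forall_lt_getD_iff.2 (hnear hc) i hi).key_eq]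
  · rw [q₁₁, q₁₀, reds_eq_sum hl]
  · intro hc z
    rw [G₆.mem _ (by rcases hk with rfl | rfl <;> decide), g₅, ← KS (hnear hc)]
    split_ifs with hz <;> simp [hz]
  · intro hc i hi
    rw [G₆.mem _ (by rcases hk with rfl | rfl <;> decide), c₀₅ i hi, hks,
      (forall_lt_getD_iff.2 (hnear hc) i hi).key_eq]
  · intro hc i hi
    rw [G₃.mem _ (by rcases hk with rfl | rfl <;> decide), (hkeys i hi).2.1, col hc i hi]
  · intro hc i hi
    rw [G₃.mem _ (by rcases hk with rfl | rfl <;> decide), (hkeys i hi).2.2.1,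
      (forall_lt_getD_iff.2 (hnear hc) i hi).key_eq]
  · intro hc i hi
    rw [G₃.mem _ (by rcases hk with rfl | rfl <;> decide), (hkeys i hi).2.2.2, col hc i hi]

/-! ### Comparing the two shapes -/

theorem Analysed.frame {l : List Cell} {k : ℕ} {P : Prog} {s s' : Store} (h : Analysed l k s)
    (F : Frame P s s') (hr : ∀ x ∈ [20 + 4 * k, 21 + 4 * k, 22 + 4 * k, 23 + 4 * k],
      P.writesReg x = false)
    (hm : ∀ a ∈ [13 + 3 * k, 5 + 4 * k, 6 + 4 * k, 7 + 4 * k, 8 + 4 * k], P.writesMem a = false) :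
    Analysed l k s' := by
  have r₀ := F.reg _ (hr (20 + 4 * k) (by simp))
  have r₁ := F.reg _ (hr (21 + 4 * k) (by simp))
  have r₂ := F.reg _ (hr (22 + 4 * k) (by simp))
  have r₃ := F.reg _ (hr (23 + 4 * k) (by simp))
  have m₀ := F.mem _ (hm (13 + 3 * k) (by simp))
  have m₁ := F.mem _ (hm (5 + 4 * k) (by simp))
  have m₂ := F.mem _ (hm (6 + 4 * k) (by simp))
  have m₃ := F.mem _ (hm (7 + 4 * k) (by simp))
  have m₄ := F.mem _ (hm (8 + 4 * k) (by simp))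
  obtain ⟨h₀, h₁, h₂, h₃, h₄, h₅, h₆, h₇, h₈, h₉⟩ := h
  constructor <;> simp only [r₀, r₁, r₂, r₃, m₀, m₁, m₂, m₃, m₄] <;> assumption

/-- The state of the computation after the analysis of both shapes. -/
structure Prepared (lA lB : List Cell) (s : Store) : Prop where
  ready : Ready lA.length s
  table : ∀ z, s.mem 4 z = rowOffset lA.length z
  first : Holds lA 0 1 s
  second : Holds lB 2 3 s
  analysed : Analysed lA 0 s
  analysed' : Analysed lB 1 s

/-- Analyse both shapes. -/
def prepare : Prog := setup ;; tablePass ;; analyse 0 ;; analyse 1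

theorem listArray_map {l : List Cell} (f : Cell → ℤ) {i : ℕ} (hi : i < l.length) :
    listArray (l.map f) i = f (l.getD i 0) := by
  simp [listArray, hi]

theorem runs_prepare {lA lB : List Cell} (hA : lA.Nodup) (hB : lB.Nodup)
    (hlen : lA.length = lB.length) (hpos : 0 < lA.length) {s : Store}
    (hreg : s.reg 0 = lA.length) (hmem : s.mem = (inputStore lA lB).mem) :
    Runs prepare 345 (2 * lA.length + 1) s (Prepared lA lB) := by
  refine Runs.mono (C := 8 + (11 + (163 + 163))) (Q := Prepared lA lB) ?_ (by norm_num)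
    (fun _ _ h => h)
  have iA : Holds lA 0 1 s := fun i hi => by
    simp [hmem, inputStore, listArray_map _ hi]
  have iB : Holds lB 2 3 s := fun i hi => by
    simp [hmem, inputStore, listArray_map _ hi]
  have iz : ∀ a, 4 ≤ a → ∀ z, s.mem a z = 0 := fun a ha z => by
    simp only [hmem, inputStore]
    iterate 4 rw [if_neg (by omega)]
  refine Runs.seq (runs_setup hreg) fun s₁ F₁ r₁ => ?_
  refine Runs.seq (runs_tablePass r₁ (by rw [F₁.mem 4 rfl]; exact iz 4 le_rfl)) fun s₂ f₂ t₂ => ?_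
  have F₂ := F₁.seq f₂
  have r₂ := r₁.frame f₂ (by decide)
  have a₂ : Holds lA 0 1 s₂ := by
    rw [Holds, F₂.mem 0 rfl, F₂.mem 1 rfl]; exact iA
  refine Runs.seq (runs_analyse (Or.inl rfl) hA hpos (by omega) r₂ t₂ a₂ ?_ ?_) fun s₃ f₃ q₃ => ?_
  · rw [F₂.mem _ rfl]; exact iz _ (by norm_num)
  · rw [F₂.mem _ rfl]; exact iz _ (by norm_num)
  have F₃ := F₂.seq f₃
  have r₃ := r₂.frame f₃ (by decide)
  have t₃ : ∀ z, s₃.mem 4 z = rowOffset lA.length z := by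
    rw [f₃.mem 4 rfl]; exact t₂
  have b₃ : Holds lB 2 3 s₃ := by
    rw [Holds, F₃.mem 2 rfl, F₃.mem 3 rfl]; exact iB
  have a₃ : Holds lA 0 1 s₃ := by
    rw [Holds, F₃.mem 0 rfl, F₃.mem 1 rfl]; exact iA
  refine Runs.mono (runs_analyse (l := lB) (k := 1) (Or.inr rfl) hB (hlen ▸ hpos) (by omega)
    (hlen ▸ r₃) (hlen ▸ t₃) b₃ ?_ ?_) le_rfl fun s₄ f₄ q₄ => ?_
  · rw [F₃.mem _ rfl]; exact iz _ (by norm_num)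
  · rw [F₃.mem _ rfl]; exact iz _ (by norm_num)
  refine ⟨r₃.frame f₄ (by decide), ?_, ?_, ?_, q₃.frame f₄ (by decide) (by decide), q₄⟩
  · rw [f₄.mem 4 rfl]; exact t₃
  · rw [Holds, f₄.mem 0 rfl, f₄.mem 1 rfl]; exact a₃
  · rw [Holds, f₄.mem 2 rfl, f₄.mem 3 rfl]; exact b₃

/-- Test whether the shapes are equal: the cells of the second shape are numbered relative to the
first cell of the first shape and looked up there.  Register 28 is positive if the shapes
differ. -/
def equalPass : Prog :=
  .load 13 0 19 ;; .load 14 1 19 ;; keyPass 2 3 19 20 21 22 ;; .add 28 10 19 ;; .const 11 0 ;;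
    subsetPass 19 13 ;; .add 28 28 10

theorem anyFlag_nonneg (p : ℕ → Prop) (m n : ℕ) : 0 ≤ anyFlag p m n := by
  rw [anyFlag]
  split_ifs <;> norm_num

theorem runs_equalPass {lA lB : List Cell} (hA : lA.Nodup) (hB : lB.Nodup)
    (hlen : lA.length = lB.length) (hpos : 0 < lA.length) {N : ℕ} (hN : lA.length ≤ N) {s : Store}
    (h : Prepared lA lB s) :
    Runs equalPass 46 N s (fun s' => IsConnectedShape lA.toFinset → IsConnectedShape lB.toFinset →
      (0 < s'.reg 28 ↔ lA.toFinset ≠ lB.toFinset)) := by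
  refine Runs.mono (C := 1 + (1 + (30 + (1 + (1 + (11 + 1)))))) (Q := fun s' =>
    IsConnectedShape lA.toFinset → IsConnectedShape lB.toFinset →
      (0 < s'.reg 28 ↔ lA.toFinset ≠ lB.toFinset)) ?_ (by norm_num) (fun _ _ h => h)
  set n := lA.length with hn
  set o := lA.getD 0 0 with ho
  refine Runs.seq (Q := fun s' => s'.reg 13 = o.1) (runs_straight rfl ?_) fun s₁ F₁ q₁ => ?_
  · have := (h.first 0 hpos).1
    simp only [Prog.eval, Store.setReg_reg, h.ready.r19] at this ⊢
    simpa [ho] using this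
  refine Runs.seq (Q := fun s' => s'.reg 14 = o.2) (runs_straight rfl ?_) fun s₂ f₂ q₂ => ?_
  · have e₁ := F₁.reg 19 rfl
    have e₂ := F₁.mem 1 rfl
    have := (h.first 0 hpos).2
    simpa [Prog.eval, e₁, e₂, h.ready.r19, ho] using this
  have F₂ := F₁.seq f₂
  refine Runs.seq (runs_keyPass (n := n) (r := fun i => (lB.getD i 0).1)
    (c := fun i => (lB.getD i 0).2) (o₁ := o.1) (o₂ := o.2) hN (by decide)
    (h.ready.frame F₂ (by decide)) ?_ ?_ ?_ ((f₂.reg 13 rfl).trans q₁) q₂) ?_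
  · rw [F₂.mem 4 rfl]; exact h.table
  · rw [F₂.mem 2 rfl]; exact fun i hi => (h.second i (hlen ▸ hi)).1
  · rw [F₂.mem 3 rfl]; exact fun i hi => (h.second i (hlen ▸ hi)).2
  rintro s₃ f₃ ⟨hfar, hkeys⟩
  have F₃ := F₂.seq f₃
  refine Runs.seq (runs_straight rfl rfl) fun s₄ f₄ q₄ => ?_
  refine Runs.seq (Q := fun s' => s'.reg 11 = 0) (runs_straight rfl (by simp [Prog.eval]))
    fun s₅ f₅ q₅ => ?_
  have F₅ := (F₃.seq f₄).seq f₅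
  refine Runs.seq (runs_subsetPass (n := n) (ks := fun i => rowOffset n ((lB.getD i 0).1 - o.1) +
    ((lB.getD i 0).2 - o.2)) (g := s.mem 13) hN (h.ready.frame F₅ (by decide)) ?_ ?_ q₅)
    fun s₆ f₆ q₆ => ?_
  · rw [(f₄.seq f₅).mem 19 rfl]; exact fun i hi => (hkeys i hi).1
  · rw [F₅.mem 13 rfl]; exact fun _ => rfl
  refine runs_straight rfl fun cA cB => ?_
  have e₁ := (f₅.seq f₆).reg 28 rfl
  have e₂ := F₃.reg 19 rfl
  rw [← q₄] at e₁
  simp only [Prog.eval, Store.setReg_reg, if_true] at e₁ ⊢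
  rw [e₁, e₂, h.ready.r19, add_zero, hfar, q₆, ← not_iff_not, ne_eq, not_not, not_lt]
  have n₁ := anyFlag_nonneg (fun i => ¬(0 < rowOffset n ((lB.getD i 0).1 - o.1) ∧
    0 < rowOffset n ((lB.getD i 0).2 - o.2))) 0 n
  have n₂ := anyFlag_nonneg (fun i => ¬0 < s.mem 13 (rowOffset n ((lB.getD i 0).1 - o.1) +
    ((lB.getD i 0).2 - o.2) + 0)) 0 n
  have hoA : o ∈ lA.toFinset := by rw [ho, List.getD_eq_getElem _ _ hpos]; simp
  have hcA : lA.toFinset.card = n := List.toFinset_card_of_nodup hA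
  have hcB : lB.toFinset.card = n := (List.toFinset_card_of_nodup hB).trans hlen.symm
  have nearA : ∀ c ∈ lA.toFinset, Near n o c := fun c hc => hcA ▸ cA.near hoA hc
  have marks := h.analysed.marks cA
  have e₃ : ∀ a b : ℤ, 0 ≤ a → 0 ≤ b → (a + b ≤ 0 ↔ a = 0 ∧ b = 0) := by omega
  rw [e₃ _ _ n₁ n₂, anyFlag_zero_eq_zero, anyFlag_zero_eq_zero]
  simp only [not_not, add_zero]
  have all : ∀ p : Cell → Prop, (∀ i < n, p (lB.getD i 0)) ↔ ∀ c ∈ lB.toFinset, p c := by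
    rw [hlen]
    exact fun p => forall_lt_getD_iff
  rw [all fun c => 0 < rowOffset n (c.1 - o.1) ∧ 0 < rowOffset n (c.2 - o.2),
    all fun c => 0 < s.mem 13 (rowOffset n (c.1 - o.1) + (c.2 - o.2))]
  simp only [← near_iff]
  -- The flags are clear exactly if the second shape is contained in the first one, which has
  -- equally many cells.
  constructor
  · rintro ⟨nearB, hsub⟩
    refine (Finset.eq_of_subset_of_card_le (fun c hc => ?_) (by rw [hcA, hcB])).symm
    have := hsub c hc
    rw [(nearB c hc).key_eq] at this
    exact (key_mem_image nearA (by have := (nearB c hc).2; omega)).1 ((marks _).1 this)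
  · intro hAB
    rw [← hAB]
    refine ⟨nearA, fun c hc => ?_⟩
    rw [(nearA c hc).key_eq]
    exact (marks _).2 (Finset.mem_image_of_mem _ hc)

/-- Test whether some translation takes the cells with numbers in the array `K` to the first
shape.  The only candidate is the translation that matches the least numbers; the least number in
the first shape is expected in register 32.  Register 28 is cleared if the test succeeds. -/
def translatePass (K : ℕ) : Prog :=
  minPass K ;; .sub 11 32 10 ;; subsetPass K 13 ;; .ite 10 .skip (.const 28 0)

/-- Here `m` is the least number in the array `K`. -/
theorem runs_translatePass {K n N : ℕ} {s : Store} (hN : n ≤ N) (hpos : 0 < n) (h : Ready n s) :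
    Runs (translatePass K) 25 N s (fun s' => ∃ m, (∃ i < n, m = s.mem K i) ∧
      (∀ i < n, m ≤ s.mem K i) ∧ (0 < s'.reg 28 ↔ 0 < s.reg 28 ∧
        ¬∀ i < n, 0 < s.mem 13 (s.mem K i + (s.reg 32 - m)))) := by
  refine Runs.mono (C := 10 + (1 + (11 + 3))) (Q := fun s' => ∃ m, (∃ i < n, m = s.mem K i) ∧
    (∀ i < n, m ≤ s.mem K i) ∧ (0 < s'.reg 28 ↔ 0 < s.reg 28 ∧
      ¬∀ i < n, 0 < s.mem 13 (s.mem K i + (s.reg 32 - m)))) ?_ (by norm_num) (fun _ _ h => h)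
  refine Runs.seq (runs_minPass hN hpos h fun _ _ => rfl) fun s₁ F₁ q₁ => ?_
  have e₁ := F₁.reg 32 rfl
  refine Runs.seq (Q := fun s' => s'.reg 11 = s.reg 32 - s₁.reg 10)
    (runs_straight rfl (by simp [Prog.eval, e₁])) fun s₂ f₂ q₂ => ?_
  have F₂ := F₁.seq f₂
  refine Runs.seq (runs_subsetPass (ks := fun i => s.mem K i) (g := s.mem 13) hN
    (h.frame F₂ (by simp [Prog.writesReg, minPass, Prog.countdown, Prog.skip])) ?_ ?_ q₂)
    fun s₃ f₃ q₃ => ?_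
  · rw [F₂.mem K rfl]; exact fun _ _ => rfl
  · rw [F₂.mem 13 rfl]; exact fun _ => rfl
  have e₃ := (F₂.seq f₃).reg 28 rfl
  refine runs_straight rfl ⟨s₁.reg 10, q₁.1, q₁.2, ?_⟩
  have := anyFlag_zero_pos (p := fun i : ℕ => ¬0 < s.mem 13 (s.mem K i + (s.reg 32 - s₁.reg 10)))
    (n := n)
  rw [← q₃] at this
  simp only [Prog.eval]
  split_ifs with h₁
  · simp only [Prog.skip, Prog.eval, Store.setReg_reg]
    rw [if_neg (by norm_num), e₃]
    have := this.1 h₁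
    push Not
    push Not at this
    exact (and_iff_left this).symm
  · rw [this] at h₁
    push Not at h₁
    simp only [Store.setReg_reg, if_true, lt_irrefl, false_iff, not_and, not_not]
    exact fun _ => h₁

/-- Test whether the shapes are congruent, by comparing the first shape with the second one after
each number of quarter turns.  Register 28 is positive if they are not. -/
def congruentPass : Prog :=
  .const 28 1 ;; minPass 5 ;; .add 32 10 19 ;; translatePass 9 ;; translatePass 10 ;;
    translatePass 11 ;; translatePass 12

theorem exists_lt_four (p : ℕ → Prop) : (∃ k < 4, p k) ↔ p 0 ∨ p 1 ∨ p 2 ∨ p 3 := by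
  constructor
  · rintro ⟨k, hk, hp⟩
    interval_cases k <;> tauto
  · rintro (h | h | h | h)
    exacts [⟨0, by norm_num, h⟩, ⟨1, by norm_num, h⟩, ⟨2, by norm_num, h⟩, ⟨3, by norm_num, h⟩]

theorem runs_congruentPass {lA lB : List Cell} (hA : lA.Nodup) (hB : lB.Nodup)
    (hlen : lA.length = lB.length) (hpos : 0 < lA.length) {N : ℕ} (hN : lA.length ≤ N) {s : Store}
    (h : Prepared lA lB s) :
    Runs congruentPass 112 N s (fun s' =>
      IsConnectedShape lA.toFinset → IsConnectedShape lB.toFinset →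
        (0 < s'.reg 28 ↔ ¬Congruent lA.toFinset lB.toFinset)) := by
  refine Runs.mono (C := 1 + (10 + (1 + (25 + (25 + (25 + 25)))))) (Q := fun s' =>
    IsConnectedShape lA.toFinset → IsConnectedShape lB.toFinset →
      (0 < s'.reg 28 ↔ ¬Congruent lA.toFinset lB.toFinset)) ?_ (by norm_num) (fun _ _ h => h)
  set n := lA.length with hn
  have hr := h.ready
  refine Runs.seq (Q := fun s' => s'.reg 28 = 1) (runs_straight rfl (by simp [Prog.eval]))
    fun s₁ F₁ q₁ => ?_
  refine Runs.seq (runs_minPass hN hpos (hr.frame F₁ (by decide)) fun _ _ => rfl) fun s₂ f₂ q₂ => ?_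
  rw [F₁.mem 5 rfl] at q₂
  have F₂ := F₁.seq f₂
  have e₂ := F₂.reg 19 rfl
  refine Runs.seq (Q := fun s' => s'.reg 32 = s₂.reg 10)
    (runs_straight rfl (by simp [Prog.eval, e₂, hr.r19])) fun s₃ f₃ q₃ => ?_
  have F₃ := F₂.seq f₃
  refine Runs.seq (runs_translatePass hN hpos (hr.frame F₃ (by decide))) fun s₄ f₄ q₄ => ?_
  have F₄ := F₃.seq f₄
  refine Runs.seq (runs_translatePass hN hpos (hr.frame F₄ (by decide))) fun s₅ f₅ q₅ => ?_
  have F₅ := F₄.seq f₅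
  refine Runs.seq (runs_translatePass hN hpos (hr.frame F₅ (by decide))) fun s₆ f₆ q₆ => ?_
  have F₆ := F₅.seq f₆
  refine Runs.mono (runs_translatePass hN hpos (hr.frame F₆ (by decide))) le_rfl
    fun s₇ f₇ q₇ cA cB => ?_
  have c₃ := (f₂.seq f₃).reg 28 rfl
  rw [F₃.mem 9 rfl, F₃.mem 13 rfl, q₃, c₃, q₁] at q₄
  rw [F₄.mem 10 rfl, F₄.mem 13 rfl, f₄.reg 32 rfl, q₃] at q₅
  rw [F₅.mem 11 rfl, F₅.mem 13 rfl, (f₄.seq f₅).reg 32 rfl, q₃] at q₆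
  rw [F₆.mem 12 rfl, F₆.mem 13 rfl, ((f₄.seq f₅).seq f₆).reg 32 rfl, q₃] at q₇
  generalize s₂.reg 10 = mA at q₂ q₄ q₅ q₆ q₇
  have hcA : lA.toFinset.card = n := List.toFinset_card_of_nodup hA
  have hcB : lB.toFinset.card = n := (List.toFinset_card_of_nodup hB).trans hlen.symm
  set a := lA.getD 0 0 with ha
  set b := lB.getD 0 0 with hb
  have haA : a ∈ lA.toFinset := by rw [ha, List.getD_eq_getElem _ _ hpos]; simp
  have hbB : b ∈ lB.toFinset := by rw [hb, List.getD_eq_getElem _ _ (hlen ▸ hpos)]; simp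
  have nearA : ∀ c ∈ lA.toFinset, Near n a c := fun c hc => hcA ▸ cA.near haA hc
  have nearB : ∀ c ∈ lB.toFinset, Near n b c := fun c hc => hcB ▸ cB.near hbB hc
  have marks := h.analysed.marks cA
  have allB : ∀ p : Cell → Prop, (∀ i < n, p (lB.getD i 0)) ↔ ∀ c ∈ lB.toFinset, p c := by
    rw [hlen]
    exact fun p => forall_lt_getD_iff
  have exB : ∀ p : Cell → Prop, (∃ i < n, p (lB.getD i 0)) ↔ ∃ c ∈ lB.toFinset, p c := by
    rw [hlen]
    exact fun p => exists_lt_getD_iff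
  have hmA : ∃ c ∈ lA.toFinset, mA = key n a c := by
    obtain ⟨i, hi, e⟩ := q₂.1
    exact exists_lt_getD_iff.1 ⟨i, hi, e.trans (h.analysed.keys₀ cA i hi)⟩
  have hmA' : ∀ c ∈ lA.toFinset, mA ≤ key n a c :=
    forall_lt_getD_iff.1 fun i hi => (q₂.2 i hi).trans_eq (h.analysed.keys₀ cA i hi)
  -- The outcome of the comparison with the second shape after `k` quarter turns.
  have turned : ∀ (k : ℕ) (f : Cell → ℤ) (e : ℤ) (g : ℤ → ℤ),
      (∀ c ∈ lB.toFinset, |(turn^[k] (c - b)).2| ≤ n) →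
      (∀ c ∈ lB.toFinset, f c = (turn^[k] (c - b)).1 * (4 * n + 5) + (turn^[k] (c - b)).2 + e) →
      (∀ i < n, g i = f (lB.getD i 0)) → ∀ r r' : ℤ,
      (∃ m, (∃ i < n, m = g i) ∧ (∀ i < n, m ≤ g i) ∧ (0 < r' ↔ 0 < r ∧
        ¬∀ i < n, 0 < s.mem 13 (g i + (mA - m)))) →
      (0 < r' ↔ 0 < r ∧ ¬∃ t, lA.toFinset = lB.toFinset.image (fun c => turn^[k] (c - b) + t)) := by
    rintro k f e g h₁ h₂ h₃ r r' ⟨m, ⟨i, hi, hm⟩, hm', hr⟩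
    rw [hr, ← exists_translate_iff nearA
      (fun x _ y _ hxy => sub_left_injective (turn_injective.iterate k hxy)) h₁ (by omega) h₂ hmA
      hmA' ((exB fun c => m = f c).1 ⟨i, hi, hm.trans (h₃ i hi)⟩)
      ((allB fun c => m ≤ f c).1 fun i hi => (hm' i hi).trans_eq (h₃ i hi)),
      ← allB fun c => f c + (mA - m) ∈ lA.toFinset.image (key n a)]
    refine and_congr_right fun _ => not_congr (forall₂_congr fun i hi => ?_)
    rw [marks, h₃ i hi]
  have t₀ := turned 0 (key n b) ((n + 1) * (4 * n + 5)) (s.mem 9) (fun c hc => (nearB c hc).2)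
    (fun c _ => by simp only [key, Function.iterate_zero, id, Prod.fst_sub, Prod.snd_sub]; ring)
    (by rw [hlen]; exact h.analysed'.keys₀ cB) _ _ q₄
  have t₃ := turned 3 (fun c => (c.2 - b.2 + n + 1) * (4 * n + 5) - (c.1 - b.1))
    ((n + 1) * (4 * n + 5)) (s.mem 10)
    (fun c hc => by
      have := (nearB c hc).1
      simpa [Function.iterate_succ_apply, turn, abs_sub_comm] using this)
    (fun c _ => by
      simp only [turn, Function.iterate_succ_apply, Function.iterate_zero, id, Prod.fst_sub,
        Prod.snd_sub]
      ring)
    (by rw [hlen]; exact h.analysed'.keys₁ cB) _ _ q₅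
  have t₂ := turned 2 (fun c => -key n b c) (-((n + 1) * (4 * n + 5))) (s.mem 11)
    (fun c hc => by
      have := (nearB c hc).2
      simpa [Function.iterate_succ_apply, turn, abs_sub_comm] using this)
    (fun c _ => by
      simp only [key, turn, Function.iterate_succ_apply, Function.iterate_zero, id, Prod.fst_sub,
        Prod.snd_sub]
      ring)
    (by rw [hlen]; exact h.analysed'.keys₂ cB) _ _ q₆
  have t₁ := turned 1 (fun c => -((c.2 - b.2 + n + 1) * (4 * n + 5) - (c.1 - b.1)))
    (-((n + 1) * (4 * n + 5))) (s.mem 12)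
    (fun c hc => (nearB c hc).1)
    (fun c _ => by
      simp only [turn, Function.iterate_succ_apply, Function.iterate_zero, id, Prod.fst_sub,
        Prod.snd_sub]
      ring)
    (by rw [hlen]; exact h.analysed'.keys₃ cB) _ _ q₇
  rw [t₁, t₂, t₃, t₀, congruent_iff_exists b]
  rw [exists_lt_four fun k => ∃ t, lA.toFinset = lB.toFinset.image (fun c => turn^[k] (c - b) + t)]
  simp only [one_pos, true_and, not_or]
  exact ⟨fun ⟨⟨⟨h₀, h₃⟩, h₂⟩, h₁⟩ => ⟨h₀, h₁, h₂, h₃⟩, fun ⟨h₀, h₁, h₂, h₃⟩ => ⟨⟨⟨h₀, h₃⟩, h₂⟩, h₁⟩⟩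

/-! ### The answer -/

/-- The program without loops `P`, started in the store `s`, writes the truth value of `p` into
register 0. -/
def Decides (P : Prog) (s : Store) (p : Prop) : Prop :=
  (p ∧ (P.eval s).reg 0 = 1) ∨ (¬p ∧ (P.eval s).reg 0 = 0)

theorem decides_const_one {s : Store} {p : Prop} (h : p) : Decides (.const 0 1) s p :=
  Or.inl ⟨h, by simp [Prog.eval]⟩

theorem decides_const_zero {s : Store} {p : Prop} (h : ¬p) : Decides (.const 0 0) s p :=
  Or.inr ⟨h, by simp [Prog.eval]⟩

theorem Decides.ite {x : ℕ} {P P' : Prog} {s : Store} {p : Prop} (h : 0 < s.reg x → Decides P s p)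
    (h' : s.reg x ≤ 0 → Decides P' s p) : Decides (.ite x P P') s p := by
  by_cases hx : 0 < s.reg x
  · simpa only [Decides, Prog.eval, if_pos hx] using h hx
  · simpa only [Decides, Prog.eval, if_neg hx] using h' (not_lt.1 hx)

/-- If the registers `x` and `y` are equal then `P` else `P'`; this overwrites the registers 6
and 7. -/
def Prog.ifEq (x y : ℕ) (P P' : Prog) : Prog := .sub 6 x y ;; .sub 7 y x ;; .ite 6 P' (.ite 7 P' P)

theorem Decides.ifEq {x y : ℕ} {P P' : Prog} {s : Store} {p : Prop} (hx : x ≠ 6) (hy : y ≠ 6)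
    (h : s.reg x = s.reg y → ∀ s', Frame (.sub 6 x y ;; .sub 7 y x) s s' → Decides P s' p)
    (h' : s.reg x ≠ s.reg y → ∀ s', Frame (.sub 6 x y ;; .sub 7 y x) s s' → Decides P' s' p) :
    Decides (.ifEq x y P P') s p := by
  have F := frame_eval (P := .sub 6 x y ;; .sub 7 y x) rfl s
  have e₆ : ((Prog.sub 6 x y ;; .sub 7 y x).eval s).reg 6 = s.reg x - s.reg y := by
    simp [Prog.eval]
  have e₇ : ((Prog.sub 6 x y ;; .sub 7 y x).eval s).reg 7 = s.reg y - s.reg x := by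
    simp [Prog.eval, hx, hy]
  generalize hs : (Prog.sub 6 x y ;; .sub 7 y x).eval s = s' at F e₆ e₇
  have main : Decides (.ite 6 P' (.ite 7 P' P)) s' p := by
    refine Decides.ite (fun h₁ => h' (by omega) _ F) fun h₁ => ?_
    exact Decides.ite (fun h₂ => h' (by omega) _ F) fun h₂ => h (by omega) _ F
  rw [← hs] at main
  exact main

/-- Decide whether the shapes can be transformed into each other, once they are analysed and
compared; `P` decides about the colours. -/
def answer (P : Prog) : Prog :=
  .sub 6 0 21 ;; .sub 7 0 25 ;; .add 6 6 7 ;; .add 6 6 20 ;; .add 6 6 24 ;;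
    .ite 6 (.const 0 0) (.ite 28 (.ite 22 (.ite 26 P (.const 0 0)) (.const 0 0)) (.const 0 1))

theorem decides_answer {lA lB : List Cell} {s : Store} {P : Prog} {p q : Prop}
    (hlen : lA.length = lB.length) (h₀ : s.reg 0 = lA.length) (hA : Analysed lA 0 s)
    (hB : Analysed lB 1 s)
    (hq : IsConnectedShape lA.toFinset → IsConnectedShape lB.toFinset → (0 < s.reg 28 ↔ ¬q))
    (hP : ∀ s' : Store, s'.reg 0 = lA.length → s'.reg 23 = reds lA.toFinset →
      s'.reg 27 = reds lB.toFinset → Decides P s' p) :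
    Decides (answer P) s (IsConnectedShape lA.toFinset ∧ IsConnectedShape lB.toFinset ∧
      (q ∨ p ∧ HasRotation lA.toFinset ∧ HasRotation lB.toFinset)) := by
  have F := frame_eval (P := .sub 6 0 21 ;; .sub 7 0 25 ;; .add 6 6 7 ;; .add 6 6 20 ;; .add 6 6 24)
    rfl s
  have e₆ : ((Prog.sub 6 0 21 ;; .sub 7 0 25 ;; .add 6 6 7 ;; .add 6 6 20 ;; .add 6 6 24).eval s).reg
      6 = s.reg 0 - s.reg 21 + (s.reg 0 - s.reg 25) + s.reg 20 + s.reg 24 := by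
    simp [Prog.eval]
  generalize hs : (Prog.sub 6 0 21 ;; .sub 7 0 25 ;; .add 6 6 7 ;; .add 6 6 20 ;; .add 6 6 24).eval
    s = s' at F e₆
  have main : Decides (.ite 6 (.const 0 0) (.ite 28 (.ite 22 (.ite 26 P (.const 0 0)) (.const 0 0))
      (.const 0 1))) s' (IsConnectedShape lA.toFinset ∧ IsConnectedShape lB.toFinset ∧
      (q ∨ p ∧ HasRotation lA.toFinset ∧ HasRotation lB.toFinset)) := by
    have a₁ := hA.far_nonneg
    have a₂ := hA.found_le
    have a₃ := hA.connected_iff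
    have b₁ := hB.far_nonneg
    have b₂ := hB.found_le
    have b₃ := hB.connected_iff
    simp only [mul_zero, add_zero, mul_one, Nat.reduceAdd] at a₁ a₂ a₃ b₁ b₂ b₃
    refine Decides.ite (fun h => decides_const_zero ?_) fun h => ?_
    · rintro ⟨cA, cB, -⟩
      rw [a₃] at cA
      rw [b₃] at cB
      omega
    have cA : IsConnectedShape lA.toFinset := a₃.2 (by omega)
    have cB : IsConnectedShape lB.toFinset := b₃.2 (by omega)
    have hq := hq cA cB
    have rA := hA.rotation_iff cA
    have rB := hB.rotation_iff cB
    simp only [mul_zero, add_zero, mul_one, Nat.reduceAdd] at rA rB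
    simp only [cA, cB, true_and, ← rA, ← rB]
    refine Decides.ite (fun h => ?_) fun h => decides_const_one ?_
    · rw [F.reg 28 rfl, hq] at h
      refine Decides.ite (fun h' => ?_) fun h' => decides_const_zero ?_
      · rw [F.reg 22 rfl] at h'
        refine Decides.ite (fun h'' => ?_) fun h'' => decides_const_zero ?_
        · rw [F.reg 26 rfl] at h''
          simp only [h, h', h'', and_true, false_or]
          exact hP s' ((F.reg 0 rfl).trans h₀) ((F.reg 23 rfl).trans hA.reds_eq)
            ((F.reg 27 rfl).trans hB.reds_eq)
        · rw [F.reg 26 rfl] at h''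
          rintro (h₁ | ⟨-, -, h₁⟩)
          exacts [h h₁, absurd h₁ (not_lt.2 h'')]
      · rw [F.reg 22 rfl] at h'
        rintro (h₁ | ⟨-, h₁, -⟩)
        exacts [h h₁, absurd h₁ (not_lt.2 h')]
    · rw [F.reg 28 rfl, ← not_lt, hq, not_not] at h
      exact Or.inl h
  rw [← hs] at main
  exact main

/-- Decide whether the shapes are color-consistent, given that they have equally many nodes. -/
def compareColors : Prog := .ifEq 23 27 (.const 0 1) (.const 0 0)

/-- Decide whether the shapes are color-consistent for some placement of the second one, given that
they have equally many nodes. -/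
def compareColorsUpToMotion : Prog :=
  .ifEq 23 27 (.const 0 1) (.add 8 23 27 ;; .ifEq 8 0 (.const 0 1) (.const 0 0))

theorem decides_compareColors {A B : Shape} {s : Store} (h : A.card = B.card)
    (hA : s.reg 23 = reds A) (hB : s.reg 27 = reds B) :
    Decides compareColors s (ColorConsistent A B) := by
  rw [colorConsistent_iff h]
  refine Decides.ifEq (by norm_num) (by norm_num) (fun h _ _ => decides_const_one (by omega))
    (fun h _ _ => decides_const_zero (by omega))

theorem decides_compareColorsUpToMotion {A B : Shape} {s : Store} (h : A.card = B.card)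
    (h₀ : s.reg 0 = A.card) (hA : s.reg 23 = reds A) (hB : s.reg 27 = reds B) :
    Decides compareColorsUpToMotion s (ColorConsistentUpToMotion A B) := by
  rw [colorConsistentUpToMotion_iff h]
  refine Decides.ifEq (by norm_num) (by norm_num) (fun h _ _ => decides_const_one (by omega))
    (fun h s' F => ?_)
  have e₀ := F.reg 0 rfl
  have eA := F.reg 23 rfl
  have eB := F.reg 27 rfl
  have main : Decides (.ifEq 8 0 (.const 0 1) (.const 0 0)) ((Prog.add 8 23 27).eval s')
      (reds A = reds B ∨ reds A + reds B = A.card) := by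
    refine Decides.ifEq (by norm_num) (by norm_num) (fun h _ _ => decides_const_one ?_)
      (fun h _ _ => decides_const_zero ?_) <;> simp [Prog.eval, e₀, eA, eB] at h <;> omega
  exact main

/-- The decision procedure: `T` compares the shapes and `P` decides about the colours.  Empty
shapes, which are not connected, and shapes with different numbers of nodes are rejected at once. -/
def decisionProg (T P : Prog) : Prog :=
  .ite 0 (.sub 6 0 1 ;; .sub 7 1 0 ;;
    .ite 6 (.const 0 0) (.ite 7 (.const 0 0) (prepare ;; T ;; answer P))) (.const 0 0)

/-- A problem is decidable in linear time if its instances are the pairs of connected shapes that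
are either related by `same`, as tested by `T`, or both have a rotation movement and are related by
`colors`, as tested by `P`. -/
theorem inLinearTime_of_runs {L : Set (Shape × Shape)} {same colors : Shape → Shape → Prop}
    {T P : Prog} {C : ℕ} (hP : P.straight = true)
    (hL : ∀ A B, (A, B) ∈ L ↔ IsConnectedShape A ∧ IsConnectedShape B ∧
      (same A B ∨ colors A B ∧ HasRotation A ∧ HasRotation B))
    (hcard : ∀ A B, (A, B) ∈ L → A.card = B.card)
    (hT : ∀ lA lB : List Cell, lA.Nodup → lB.Nodup → lA.length = lB.length → 0 < lA.length →
      ∀ s, Prepared lA lB s → Runs T C (2 * lA.length + 1) s (fun s' =>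
        IsConnectedShape lA.toFinset → IsConnectedShape lB.toFinset →
          (0 < s'.reg 28 ↔ ¬same lA.toFinset lB.toFinset)))
    (hreg : ∀ x ∈ [0, 20, 21, 22, 23, 24, 25, 26, 27], T.writesReg x = false)
    (hmem : ∀ a ∈ [13, 5, 6, 7, 8, 16, 9, 10, 11, 12], T.writesMem a = false)
    (hcol : ∀ (A B : Shape) (s : Store), A.card = B.card → s.reg 0 = A.card →
      s.reg 23 = reds A → s.reg 27 = reds B → Decides P s (colors A B)) :
    InLinearTime L := by
  have hans : (answer P).straight = true := by simp [answer, Prog.straight, hP]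
  refine ⟨decisionProg T P, 2 * (1 + (1 + (345 + (C + (answer P).size)) + 2) + 1 + 1), ?_⟩
  rintro A B lA lB hA hB rfl rfl
  set C' := 1 + (1 + (345 + (C + (answer P).size)) + 2) with hC'
  have cA := List.toFinset_card_of_nodup hA
  have cB := List.toFinset_card_of_nodup hB
  suffices h : Runs (decisionProg T P) (C' + 1 + 1) (2 * lA.length + 1) (inputStore lA lB)
      (fun s' => ((lA.toFinset, lB.toFinset) ∈ L ∧ s'.reg 0 = 1) ∨
        ((lA.toFinset, lB.toFinset) ∉ L ∧ s'.reg 0 = 0)) by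
    obtain ⟨s, t, c, e, ht, hs⟩ := h
    refine ⟨s, t, c, e, hs, ?_, le_top⟩
    refine Nat.cast_le.2 (ht.trans ?_)
    rw [cA, cB, mul_comm 2 (C' + 1 + 1), mul_assoc]
    exact Nat.mul_le_mul_left _ (by omega)
  have no : ∀ {C s}, (lA.toFinset, lB.toFinset) ∉ L → Runs (.const 0 0) (C + 1) (2 * lA.length + 1) s
      (fun s' => ((lA.toFinset, lB.toFinset) ∈ L ∧ s'.reg 0 = 1) ∨
        ((lA.toFinset, lB.toFinset) ∉ L ∧ s'.reg 0 = 0)) := fun h =>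
    Runs.mono (runs_straight rfl (Or.inr ⟨h, by simp [Prog.eval]⟩)) (by simp [Prog.size])
      fun _ _ h => h
  refine Runs.ite (fun hpos => ?_) fun hpos => no fun h => ?_
  swap
  · obtain ⟨c, hc⟩ := ((hL _ _).1 h).1.nonempty
    rw [List.length_eq_zero_iff.1 (by simpa [inputStore] using hpos : lA.length = 0)] at hc
    simp at hc
  have hpos : 0 < lA.length := by simpa [inputStore] using hpos
  refine Runs.mono (C := 1 + (1 + (345 + (C + (answer P).size) + 1 + 1))) ?_ (by omega)
    fun _ _ h => h
  refine Runs.seq (runs_straight rfl rfl) fun s₁ f₁ q₁ => ?_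
  refine Runs.seq (runs_straight rfl rfl) fun s₂ f₂ q₂ => ?_
  have F₂ := f₁.seq f₂
  have e₀ := F₂.reg 0 rfl
  have e₆ : s₂.reg 6 = lA.length - lB.length := by
    rw [f₂.reg 6 rfl, ← q₁]; simp [Prog.eval, inputStore]
  have e₇ : s₂.reg 7 = lB.length - lA.length := by
    rw [← q₂, ← q₁]; simp [Prog.eval, inputStore]
  refine Runs.ite (fun h => no fun h' => ?_) fun h₆ =>
    Runs.ite (fun h => no fun h' => ?_) fun h₇ => ?_
  · have := hcard _ _ h'
    omega
  · have := hcard _ _ h'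
    omega
  have hlen : lA.length = lB.length := by omega
  refine Runs.seq (runs_prepare hA hB hlen hpos (e₀.trans (by simp [inputStore])) ?_)
    fun s₃ f₃ q₃ => ?_
  · rw [← q₂, ← q₁]; rfl
  refine Runs.seq (hT lA lB hA hB hlen hpos s₃ q₃) fun s₄ f₄ q₄ => ?_
  refine runs_straight hans ?_
  rw [hL]
  refine decides_answer hlen ?_ (q₃.analysed.frame f₄ ?_ ?_) (q₃.analysed'.frame f₄ ?_ ?_) q₄
    fun s' h h' h'' => hcol _ _ _ (by omega) (h.trans (by rw [cA])) h' h''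
  · rw [f₄.reg 0 (hreg 0 (by simp)), q₃.ready.r0]
  · exact fun x hx => hreg x (by revert x; decide)
  · exact fun x hx => hmem x (by revert x; decide)
  · exact fun x hx => hreg x (by revert x; decide)
  · exact fun x hx => hmem x (by revert x; decide)

theorem inLinearTime_rotTransformabilityFixed : InLinearTime RotTransformabilityFixed := by
  refine inLinearTime_of_runs (same := Eq) (colors := ColorConsistent) (T := equalPass)
    (P := compareColors) (C := 46) rfl (fun A B => ?_) (fun A B h => ?_)
    (fun lA lB hA hB hlen hpos s h => runs_equalPass hA hB hlen hpos (by omega) h) (by decide)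
    (by decide) (fun A B s h _ h₁ h₂ => decides_compareColors h h₁ h₂)
  · rw [RotTransformabilityFixed, Set.mem_ofPred_eq, transforms_iff]
    tauto
  · have := h.2.2.colorConsistent
    rw [card_eq_blacks_add_reds, card_eq_blacks_add_reds B, this.1, this.2]

theorem inLinearTime_rotTransformability : InLinearTime RotTransformability := by
  refine inLinearTime_of_runs (same := Congruent) (colors := ColorConsistentUpToMotion)
    (T := congruentPass) (P := compareColorsUpToMotion) (C := 112) rfl (fun A B => ?_)
    (fun A B h => ?_)
    (fun lA lB hA hB hlen hpos s h => runs_congruentPass hA hB hlen hpos (by omega) h) (by decide)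
    (by decide) (fun A B s => decides_compareColorsUpToMotion)
  · rw [RotTransformability, Set.mem_ofPred_eq, transformsUpToMotion_iff]
    tauto
  · obtain ⟨B', hB, hAB⟩ := h.2.2
    have := hAB.colorConsistent
    rw [hB.card_eq, card_eq_blacks_add_reds, card_eq_blacks_add_reds B', this.1, this.2]

end RotGrid

theorem mainTheorem1 :
    -- two connected shapes, with fixed positions on the grid
    (∀ A B : RotGrid.Shape, RotGrid.IsConnectedShape A → RotGrid.IsConnectedShape B →
      (RotGrid.Transforms A B ↔
        (RotGrid.ColorConsistent A B ∧ RotGrid.HasRotation A ∧ RotGrid.HasRotation B) ∨ A = B)) ∧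
    -- two connected shapes, up to translations and rotations
    (∀ A B : RotGrid.Shape, RotGrid.IsConnectedShape A → RotGrid.IsConnectedShape B →
      (RotGrid.TransformsUpToMotion A B ↔
        (RotGrid.ColorConsistentUpToMotion A B ∧ RotGrid.HasRotation A ∧ RotGrid.HasRotation B) ∨
          RotGrid.Congruent A B)) ∧
    -- available rotations and extraction of a 2-line
    (∀ S : RotGrid.Shape, RotGrid.HasRotation S ↔ RotGrid.TwoLineExtractable S) ∧
    -- complexity
    (RotGrid.InP RotGrid.RotTransformability ∧ RotGrid.InLinearTime RotGrid.RotTransformability) ∧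
    (RotGrid.InP RotGrid.RotTransformabilityFixed ∧
      RotGrid.InLinearTime RotGrid.RotTransformabilityFixed) := by
  refine ⟨fun A B _ _ => ?_, fun A B _ _ => ?_, fun S => RotGrid.hasRotation_iff_twoLineExtractable,
    ⟨RotGrid.inLinearTime_rotTransformability.inP, RotGrid.inLinearTime_rotTransformability⟩,
    RotGrid.inLinearTime_rotTransformabilityFixed.inP, RotGrid.inLinearTime_rotTransformabilityFixed⟩
  · exact RotGrid.transforms_iff
  · exact RotGrid.transformsUpToMotion_iff
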